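/- **Conventions.** All manifolds, metrics and forms are smooth. Lorentzian metrics have signature $(-,+,\dots,+)$. Wedge products are in the determinant normalisation, so that $(\alpha\wedge\beta)(u,v,w)=\alpha(u)\beta(v,w)+\alpha(v)\beta(w,u)+\alpha(w)\beta(u,v)$ for a one-form $\alpha$ and a two-form $\beta$, and $\mathrm d\alpha(u,v)=u(\alpha(v))-v(\alpha(u))-\alpha([u,v])$. The metric volume form is denoted $\nu_g$, and the Hodge dual is given by $\alpha\wedge\star_g\beta=\frac1{k!}\alpha_{i_1\dots i_k}\beta^{i_1\dots i_k}\,\nu_g$ for $k$-forms $\alpha,\beta$. For a three-form $H$ put $|H|_g^2=H_{ijk}H^{ijk}$ and $(H\circ H)(v,w)=H_{v\,ij}\,H_w{}^{ij}$ (all indices are summed over). **Definitions.** Let $(M,g)$ be an oriented Riemannian ($s_g=1$) or Lorentzian ($s_g=-1$) three-manifold. An $\varepsilon$-contact structure on it, $\varepsilon\in\{-1,0,1\}$, is a one-form $\alpha$ with $\alpha=\star_g\mathrm d\alpha$ and $|\alpha|_g^2=\varepsilon$. It is $\varepsilon\eta$-Einstein with constants $(\lambda^2,\kappa)$, where $\lambda,\kappa\in\mathbb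 R$ and $\kappa\ge 0$ if $g$ is Lorentzian, if $$\mathrm{Ric}^g=\tfrac{s_g}{2}(\lambda^2+\kappa\varepsilon)\,g-s_g\,\kappa\,\alpha\otimes\alpha .$$ In the Riemannian case $\varepsilon=1$ is understood. A pair $(\hat g,H)$ of a Lorentzian metric and a three-form on an oriented six-manifold $\hat M$ is a (bosonic) solution of six-dimensional minimal supergravity coupled to a tensor multiplet with constant dilaton if $$\mathrm{Ric}^{\hat g}=\tfrac14\,H\circ H,\qquad \mathrm dH=0,\qquad \mathrm d\star_{\hat g}H=0,\qquad |H|^2_{\hat g}=0 .$$ **Theorem.** Let $\lambda,l\in\mathbb R$. Let $(N,\chi)$ be an oriented Lorentzian three-manifold with an $\varepsilon_N$-contact structure $\alpha_N$ that is $\varepsilon\eta$-Einstein with constants $(\lambda^2,l^2)$, and let $(X,h)$ be an oriented Riemannian three-manifold with a $1$-contact structure $\alpha_X$ that is $\varepsilon\eta$-Einstein with constants $(\lambda^2,\varepsilon_N l^2)$. Then on the oriented product $\hat M=N\times X$ the pair $$\hat g=\chi\oplus h,\qquad H_{\lambda,l}=\lambda\,\nu_\chi+l\,(\star_\chi\alpha_N)\wedge\alpha_X+l\,\alpha_N\wedge(\star_h\alpha_X)+\lambda\,\nu_h$$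 is a solution of six-dimensional minimal supergravity coupled to a tensor multiplet with constant dilaton. Thus one obtains a family of solutions parametrised by $(\lambda,l)\in\mathbb R^2$. -/

import Mathlib

set_option maxSynthPendingDepth 3

open Set Filter Topology Module
open scoped Manifold ContDiff

noncomputable section

/-! ### Multilinear algebra on a finite-dimensional vector space with a symmetric bilinear form -/

section Pointwise

variable {V : Type*} [AddCommGroup V] [Module ℝ V] [TopologicalSpace V]

/-- The (not yet antisymmetrised) product
`(v₁, …, v_{p+q}) ↦ α(v₁, …, v_p) β(v_{p+1}, …, v_{p+q})`. -/
def tensorForm {p q : ℕ} (α : V [⋀^Fin p]→L[ℝ] ℝ) (β : V [⋀^Fin q]→L[ℝ] ℝ) :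
    ContinuousMultilinearMap ℝ (fun _ : Fin (p + q) => V) ℝ where
  toFun v := α (fun i => v (Fin.castAdd q i)) * β (fun j => v (Fin.natAdd p j))
  map_update_add' := by
    intro _ v i x y
    have h1 : ∀ (a : Fin p) (z : V),
        (fun i => Function.update v (Fin.castAdd q a) z (Fin.castAdd q i))
          = Function.update (fun i => v (Fin.castAdd q i)) a z := by
      intro a z; ext i; simp [Function.update_apply]
    have h2 : ∀ (a : Fin q) (z : V),
        (fun i => Function.update v (Fin.natAdd p a) z (Fin.natAdd p i))
          = Function.update (fun i => v (Fin.natAdd p i)) a z := by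
      intro a z; ext i; simp [Function.update_apply]
    have h3 : ∀ (a : Fin p) (z : V),
        (fun i => Function.update v (Fin.castAdd q a) z (Fin.natAdd p i))
          = (fun i => v (Fin.natAdd p i)) := by
      intro a z; ext i
      rw [Function.update_of_ne]
      intro h; have := congrArg Fin.val h; simp at this; omega
    have h4 : ∀ (a : Fin q) (z : V),
        (fun i => Function.update v (Fin.natAdd p a) z (Fin.castAdd q i))
          = (fun i => v (Fin.castAdd q i)) := by
      intro a z; ext i
      rw [Function.update_of_ne]
      intro h; have := congrArg Fin.val h; simp at this; omega
    have e : (‹DecidableEq (Fin (p + q))›) = instDecidableEqFin _ := Subsingleton.elim _ _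
    subst e
    induction i using Fin.addCases with
    | left a => simp only [h1, h3, α.map_update_add]; ring
    | right a => simp only [h2, h4, β.map_update_add]; ring
  map_update_smul' := by
    intro _ v i c x
    have h1 : ∀ (a : Fin p) (z : V),
        (fun i => Function.update v (Fin.castAdd q a) z (Fin.castAdd q i))
          = Function.update (fun i => v (Fin.castAdd q i)) a z := by
      intro a z; ext i; simp [Function.update_apply]
    have h2 : ∀ (a : Fin q) (z : V),
        (fun i => Function.update v (Fin.natAdd p a) z (Fin.natAdd p i))
          = Function.update (fun i => v (Fin.natAdd p i)) a z := by
      intro a z; ext i; simp [Function.update_apply]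
    have h3 : ∀ (a : Fin p) (z : V),
        (fun i => Function.update v (Fin.castAdd q a) z (Fin.natAdd p i))
          = (fun i => v (Fin.natAdd p i)) := by
      intro a z; ext i
      rw [Function.update_of_ne]
      intro h; have := congrArg Fin.val h; simp at this; omega
    have h4 : ∀ (a : Fin q) (z : V),
        (fun i => Function.update v (Fin.natAdd p a) z (Fin.castAdd q i))
          = (fun i => v (Fin.castAdd q i)) := by
      intro a z; ext i
      rw [Function.update_of_ne]
      intro h; have := congrArg Fin.val h; simp at this; omega
    have e : (‹DecidableEq (Fin (p + q))›) = instDecidableEqFin _ := Subsingleton.elim _ _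
    subst e
    induction i using Fin.addCases with
    | left a => simp only [h1, h3, α.map_update_smul, smul_eq_mul]; ring
    | right a => simp only [h2, h4, β.map_update_smul, smul_eq_mul]; ring
  cont := by
    have hα : Continuous fun v : Fin (p + q) → V => α (fun i => v (Fin.castAdd q i)) :=
      α.cont.comp (by fun_prop)
    have hβ : Continuous fun v : Fin (p + q) → V => β (fun i => v (Fin.natAdd p i)) :=
      β.cont.comp (by fun_prop)
    exact hα.mul hβ

/-- The wedge product in the usual (determinant) normalisation
`(α ∧ β)(v₁, …, v_{p+q}) = 1/(p! q!) ∑_σ sgn σ α(v_{σ1}, …, v_{σp}) β(v_{σ(p+1)}, …, v_{σ(p+q)})`;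
for one-forms, `(α ∧ β)(u, v) = α(u) β(v) - α(v) β(u)`. -/
def wedge {p q : ℕ} (α : V [⋀^Fin p]→L[ℝ] ℝ) (β : V [⋀^Fin q]→L[ℝ] ℝ) :
    V [⋀^Fin (p + q)]→L[ℝ] ℝ :=
  (1 / ((p.factorial : ℝ) * (q.factorial : ℝ))) •
    ContinuousMultilinearMap.alternatization (tensorForm α β)

/-- Insertion of `k` vectors into the first `k` slots: `(insertFirst u α)(w) = α(u₁, …, u_k, w)`.
For `k = 1` this is the interior product. -/
def insertFirst {k m : ℕ} (u : Fin k → V) (α : V [⋀^Fin (k + m)]→L[ℝ] ℝ) :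
    V [⋀^Fin m]→L[ℝ] ℝ where
  toFun w := α (Fin.append u w)
  map_update_add' := by
    intro _ w i x y
    have h : ∀ z : V, Fin.append u (Function.update w i z)
        = Function.update (Fin.append u w) (Fin.natAdd k i) z := by
      intro z
      ext j
      induction j using Fin.addCases with
      | left a =>
        rw [Function.update_of_ne]
        · simp
        · intro h; have := congrArg Fin.val h; simp at this; omega
      | right a => simp [Function.update_apply]
    simp only [h, α.map_update_add]
  map_update_smul' := by
    intro _ w i c x
    have h : ∀ z : V, Fin.append u (Function.update w i z)
        = Function.update (Fin.append u w) (Fin.natAdd k i) z := by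
      intro z
      ext j
      induction j using Fin.addCases with
      | left a =>
        rw [Function.update_of_ne]
        · simp
        · intro h; have := congrArg Fin.val h; simp at this; omega
      | right a => simp [Function.update_apply]
    simp only [h, α.map_update_smul]
  map_eq_zero_of_eq' := by
    intro w i j hw hij
    exact α.map_eq_zero_of_eq (i := Fin.natAdd k i) (j := Fin.natAdd k j) _ (by simpa using hw)
      (by simpa using hij)
  cont := by
    refine α.cont.comp (continuous_pi fun j => ?_)
    induction j using Fin.addCases with
    | left a => simpa using continuous_const
    | right a => simpa using continuous_apply a

/-- The interior product `ι_v α = α(v, ·, …, ·)`. -/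
def interior₃ (v : V) (α : V [⋀^Fin 3]→L[ℝ] ℝ) : V [⋀^Fin 2]→L[ℝ] ℝ :=
  insertFirst (k := 1) (m := 2) ![v] α

variable [IsTopologicalAddGroup V] [ContinuousSMul ℝ V] [T2Space V] [FiniteDimensional ℝ V]

/-- For a nondegenerate bilinear form `B` and the reference basis `e` of `V`, the vectors `eⁱ`
obtained by raising the index of the dual basis: `B(eⁱ, e_j) = δⁱ_j`. -/
def raisedBasis (B : V →L[ℝ] V →L[ℝ] ℝ) (i : Fin (finrank ℝ V)) : V :=
  B.inverse (LinearMap.toContinuousLinearMap ((finBasis ℝ V).coord i))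

/-- The full contraction `ρ_{i₁…i_k} σ^{i₁…i_k}` of two `k`-forms with respect to `B`
(all indices are summed over, without the factor `1/k!`). It does not depend on the basis. -/
def contractForms (B : V →L[ℝ] V →L[ℝ] ℝ) {k : ℕ} (ρ σ : V [⋀^Fin k]→L[ℝ] ℝ) : ℝ :=
  ∑ i : Fin k → Fin (finrank ℝ V),
    ρ (fun a => raisedBasis B (i a)) * σ (fun a => finBasis ℝ V (i a))

/-- The metric volume form of `B` in the orientation of the nonzero top-degree form `θ`: the
positive multiple `ν` of `θ` with `|ν_{i₁…i_n} ν^{i₁…i_n}| = n!`, i.e. with `ν(e₁, …, e_n) = 1` on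
positively oriented orthonormal bases. -/
def metricVolume (B : V →L[ℝ] V →L[ℝ] ℝ) {n : ℕ} (θ : V [⋀^Fin n]→L[ℝ] ℝ) :
    V [⋀^Fin n]→L[ℝ] ℝ :=
  Real.sqrt ((n.factorial : ℝ) / |contractForms B θ θ|) • θ

/-- The Hodge dual of a `k`-form in dimension `k + m`, with respect to `B` and the orientation of
the top-degree form `θ`: `(⋆β)(w₁, …, w_m) = 1/k! β^{i₁…i_k} ν(e_{i₁}, …, e_{i_k}, w₁, …, w_m)`,
where `ν` is the metric volume form; equivalently `α ∧ ⋆β = (1/k!) α_{i₁…i_k} β^{i₁…i_k} ν`. -/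
def hodge (k m : ℕ) (B : V →L[ℝ] V →L[ℝ] ℝ) (θ : V [⋀^Fin (k + m)]→L[ℝ] ℝ)
    (β : V [⋀^Fin k]→L[ℝ] ℝ) : V [⋀^Fin m]→L[ℝ] ℝ :=
  (1 / (k.factorial : ℝ)) • ∑ i : Fin k → Fin (finrank ℝ V),
    β (fun a => raisedBasis B (i a)) •
      insertFirst (fun a => finBasis ℝ V (i a)) (metricVolume B θ)

end Pointwise

/-! ### Levi-Civita connection and Ricci tensor of a metric on an open set of a vector space -/

section Coordinates

variable {E : Type*} [NormedAddCommGroup E] [NormedSpace ℝ E]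

/-- The Christoffel symbol of the first kind:
`(u, v, w) ↦ ½ (∂_u g(v, w) + ∂_v g(u, w) - ∂_w g(u, v))`. -/
def christoffelLower (g : E → E →L[ℝ] E →L[ℝ] ℝ) (z : E) : E →L[ℝ] E →L[ℝ] E →L[ℝ] ℝ :=
  let D : E →L[ℝ] E →L[ℝ] E →L[ℝ] ℝ := fderiv ℝ g z
  let D' : E →L[ℝ] E →L[ℝ] E →L[ℝ] ℝ :=
    (ContinuousLinearMap.flipₗᵢ ℝ E E ℝ).toContinuousLinearEquiv.toContinuousLinearMap ∘L D.flip
  (1 / 2 : ℝ) • (D + D.flip - D')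

/-- The Christoffel symbol `Γ_z(u, v)` of the Levi-Civita connection `∇_u v = ∂_u v + Γ(u, v)`,
determined by `g(Γ(u, v), w) = ½ (∂_u g(v, w) + ∂_v g(u, w) - ∂_w g(u, v))`. -/
def christoffel (g : E → E →L[ℝ] E →L[ℝ] ℝ) (z : E) : E →L[ℝ] E →L[ℝ] E :=
  (ContinuousLinearMap.compL ℝ E (E →L[ℝ] ℝ) E (g z).inverse) ∘L christoffelLower g z

/-- The Riemann curvature `R(u, v)w = ∇_u ∇_v w - ∇_v ∇_u w - ∇_{[u,v]} w`. -/
def riemannCoord (g : E → E →L[ℝ] E →L[ℝ] ℝ) (z u v w : E) : E :=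
  fderiv ℝ (christoffel g) z u v w - fderiv ℝ (christoffel g) z v u w
    + christoffel g z u (christoffel g z v w) - christoffel g z v (christoffel g z u w)

/-- The Ricci curvature `Ric(v, w) = tr (u ↦ R(u, v)w)` (positive on round spheres). -/
def ricciCoord (g : E → E →L[ℝ] E →L[ℝ] ℝ) (z v w : E) : ℝ :=
  LinearMap.trace ℝ E
    { toFun := fun u => riemannCoord g z u v w
      map_add' := by intro a b; simp [riemannCoord]; abel
      map_smul' := by intro c a; simp [riemannCoord, smul_sub, smul_add] }

end Coordinates

/-! ### Tensor fields on manifolds -/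

section Manifold

variable {E : Type*} [NormedAddCommGroup E] [NormedSpace ℝ E]
  {H : Type*} [TopologicalSpace H] (I : ModelWithCorners ℝ E H)
  (M : Type*) [TopologicalSpace M] [ChartedSpace H M]

instance tangentSpace_finiteDimensional [FiniteDimensional ℝ E] (x : M) :
    FiniteDimensional ℝ (TangentSpace I x) :=
  inferInstanceAs (FiniteDimensional ℝ E)

instance tangentSpace_t2Space (x : M) : T2Space (TangentSpace I x) :=
  inferInstanceAs (T2Space E)

/-- Differential `k`-forms on `M` (no regularity), as fields of alternating forms. -/
abbrev FormField (k : ℕ) : Type _ := ∀ x : M, TangentSpace I x [⋀^Fin k]→L[ℝ] ℝ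

/-- Fields of bilinear forms on the tangent spaces of `M` (no regularity). -/
abbrev BilinField : Type _ := ∀ x : M, TangentSpace I x →L[ℝ] TangentSpace I x →L[ℝ] ℝ

variable {I M}

/-- The derivative at `z` of the inverse of the chart `φ` of `M` at `x`: it maps the constant
vector `u` of the model space to the coordinate vector with components `u` at `φ⁻¹(z)`. -/
def coordFrame (x : M) (z : E) : E →L[ℝ] TangentSpace I ((extChartAt I x).symm z) :=
  mfderiv 𝓘(ℝ, E) I (extChartAt I x).symm z

/-- The coordinate components, at the point `x`, of a tangent vector at `x` in the chart at `x`. -/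
def coordVec (x : M) : TangentSpace I x →L[ℝ] E :=
  mfderiv I 𝓘(ℝ, E) (extChartAt I x) x

/-- The coordinate expression of a `k`-form in the chart at `x`. -/
def FormField.inChart {k : ℕ} (θ : FormField I M k) (x : M) (z : E) : E [⋀^Fin k]→L[ℝ] ℝ :=
  (θ ((extChartAt I x).symm z)).compContinuousLinearMap (coordFrame x z)

/-- The coordinate expression of a field of bilinear forms in the chart at `x`. -/
def BilinField.inChart (g : BilinField I M) (x : M) (z : E) : E →L[ℝ] E →L[ℝ] ℝ :=
  (ContinuousLinearMap.precomp ℝ (coordFrame x z)) ∘L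
    (g ((extChartAt I x).symm z)) ∘L (coordFrame x z)

/-- A `k`-form is smooth if its coordinate expressions are. -/
def FormField.IsSmooth {k : ℕ} (θ : FormField I M k) : Prop :=
  ∀ x : M, ContDiffOn ℝ ∞ (θ.inChart x) (extChartAt I x).target

/-- A field of bilinear forms is smooth if its coordinate expressions are. -/
def BilinField.IsSmooth (g : BilinField I M) : Prop :=
  ∀ x : M, ContDiffOn ℝ ∞ (g.inChart x) (extChartAt I x).target

/-- The exterior derivative, computed at `x` in the chart at `x`. -/
def extD {k : ℕ} (θ : FormField I M k) : FormField I M (k + 1) := fun x =>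
  (extDeriv (θ.inChart x) (extChartAt I x x)).compContinuousLinearMap (coordVec x)

/-- The Ricci tensor of a pseudo-Riemannian metric, computed at `x` in the chart at `x`. -/
def ricci (g : BilinField I M) (x : M) (v w : TangentSpace I x) : ℝ :=
  ricciCoord (g.inChart x) (extChartAt I x x) (coordVec x v) (coordVec x w)

/-- A Riemannian metric. -/
structure IsRiemannianMetric (g : BilinField I M) : Prop where
  smooth : g.IsSmooth
  symm : ∀ (x : M) (v w : TangentSpace I x), g x v w = g x w v
  pos : ∀ (x : M) (v : TangentSpace I x), v ≠ 0 → 0 < g x v v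

/-- A Lorentzian metric, of signature `(-, +, …, +)`: at every point there is a timelike vector
on whose orthogonal complement the metric is positive definite. -/
structure IsLorentzianMetric (g : BilinField I M) : Prop where
  smooth : g.IsSmooth
  symm : ∀ (x : M) (v w : TangentSpace I x), g x v w = g x w v
  signature : ∀ x : M, ∃ t : TangentSpace I x, g x t t < 0 ∧
    ∀ v : TangentSpace I x, g x t v = 0 → v ≠ 0 → 0 < g x v v

/-- An orientation of an `n`-dimensional manifold, given by a nowhere vanishing smooth `n`-form. -/
structure IsOrientationForm {n : ℕ} (θ : FormField I M n) : Prop where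
  dim : finrank ℝ E = n
  smooth : θ.IsSmooth
  ne_zero : ∀ x : M, θ x ≠ 0

section Operators

variable [FiniteDimensional ℝ E]

/-- The metric volume form. -/
def volumeForm {n : ℕ} (g : BilinField I M) (θ : FormField I M n) : FormField I M n :=
  fun x => metricVolume (g x) (θ x)

/-- The Hodge dual of a `k`-form on a manifold of dimension `k + m` oriented by `θ`. -/
def hodgeStar (k m : ℕ) (g : BilinField I M) (θ : FormField I M (k + m)) (β : FormField I M k) :
    FormField I M m :=
  fun x => hodge k m (g x) (θ x) (β x)

/-- An `ε`-contact metric structure `(g, α, ε)` on a three-manifold oriented by `θ`: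
`α = ⋆ dα`, `|α|² = ε` and `ε ∈ {-1, 0, 1}`. -/
structure IsEpsContact (g : BilinField I M) (θ : FormField I M 3) (α : FormField I M 1)
    (ε : ℝ) : Prop where
  eps_mem : ε = -1 ∨ ε = 0 ∨ ε = 1
  smooth : α.IsSmooth
  eq_star_d : α = hodgeStar 2 1 g θ (extD α)
  norm_sq : ∀ x : M, contractForms (g x) (α x) (α x) = ε

/-- The equation `Ric = (s/2)(λ² + κ ε) g - s κ α ⊗ α`. -/
def EpsEtaEinsteinEq (s : ℝ) (g : BilinField I M) (α : FormField I M 1) (ε lamSq κ : ℝ) : Prop :=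
  ∀ (x : M) (v w : TangentSpace I x),
    ricci g x v w = s / 2 * (lamSq + κ * ε) * g x v w - s * κ * (α x ![v] * α x ![w])

/-- Lorentzian `εη`-Einstein structures with constants `(λ², κ)` and Reeb vector of norm `ε`. -/
structure IsLorentzianEpsEtaEinstein (g : BilinField I M) (θ : FormField I M 3)
    (α : FormField I M 1) (ε lamSq κ : ℝ) : Prop where
  orientation : IsOrientationForm θ
  metric : IsLorentzianMetric g
  contact : IsEpsContact g θ α ε
  kappa_nonneg : 0 ≤ κ
  einstein : EpsEtaEinsteinEq (-1) g α ε lamSq κ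

/-- Riemannian `εη`-Einstein structures with constants `(λ², κ)`; here the Reeb vector is a unit
vector, `ε = 1`. -/
structure IsRiemannianEpsEtaEinstein (g : BilinField I M) (θ : FormField I M 3)
    (α : FormField I M 1) (lamSq κ : ℝ) : Prop where
  orientation : IsOrientationForm θ
  metric : IsRiemannianMetric g
  contact : IsEpsContact g θ α 1
  einstein : EpsEtaEinsteinEq 1 g α 1 lamSq κ

/-- The symmetric tensor `(ρ ∘ σ)(v, w) = g⁻¹(ι_v ρ, ι_w σ) = ρ_{v i j} σ_w^{i j}`. -/
def compForms (g : BilinField I M) (ρ σ : FormField I M 3) (x : M) (v w : TangentSpace I x) : ℝ :=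
  contractForms (g x) (interior₃ v (ρ x)) (interior₃ w (σ x))

/-- `(g, H)` is a (bosonic) solution of six-dimensional minimal supergravity coupled to a tensor
multiplet with constant dilaton, on the six-manifold oriented by `θ`. -/
structure IsSugraSolution (θ : FormField I M 6) (g : BilinField I M) (H : FormField I M 3) :
    Prop where
  orientation : IsOrientationForm θ
  metric : IsLorentzianMetric g
  smooth : H.IsSmooth
  ricci_eq : ∀ (x : M) (v w : TangentSpace I x), ricci g x v w - 1 / 4 * compForms g H H x v w = 0
  closed : extD H = 0
  coclosed : extD (hodgeStar 3 3 g θ H) = 0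
  isotropic : ∀ x : M, contractForms (g x) (H x) (H x) = 0

end Operators

end Manifold

/-! ### Products -/

section Product

variable {E : Type*} [NormedAddCommGroup E] [NormedSpace ℝ E]
  {H : Type*} [TopologicalSpace H] {I : ModelWithCorners ℝ E H}
  {M : Type*} [TopologicalSpace M] [ChartedSpace H M]
  {E' : Type*} [NormedAddCommGroup E'] [NormedSpace ℝ E']
  {H' : Type*} [TopologicalSpace H'] {I' : ModelWithCorners ℝ E' H'}
  {M' : Type*} [TopologicalSpace M'] [ChartedSpace H' M']

/-- The pullback `f^*θ` of a differential form. -/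
def pullbackForm {k : ℕ} (f : M → M') (θ : FormField I' M' k) : FormField I M k := fun x =>
  (θ (f x)).compContinuousLinearMap (mfderiv I I' f x)

/-- The pullback `f^*g` of a field of bilinear forms. -/
def pullbackBilin (f : M → M') (g : BilinField I' M') : BilinField I M := fun x =>
  (ContinuousLinearMap.precomp ℝ (mfderiv I I' f x)) ∘L (g (f x)) ∘L (mfderiv I I' f x)

/-- The product metric `g ⊕ g' = pr₁^* g + pr₂^* g'`. -/
def prodMetric (g : BilinField I M) (g' : BilinField I' M') :
    BilinField (I.prod I') (M × M') :=
  fun x => pullbackBilin (I := I.prod I') Prod.fst g x + pullbackBilin (I := I.prod I') Prod.snd g' x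

/-- The exterior product `pr₁^* ρ ∧ pr₂^* σ` on `M × M'`. For top-degree forms it defines the
product orientation. -/
def prodForm {p q : ℕ} (ρ : FormField I M p) (σ : FormField I' M' q) :
    FormField (I.prod I') (M × M') (p + q) :=
  fun x => wedge (pullbackForm (I := I.prod I') Prod.fst ρ x)
    (pullbackForm (I := I.prod I') Prod.snd σ x)

/-- The three-form `λ ν_χ + l (⋆_χ α_N) ∧ α_X + l α_N ∧ (⋆_h α_X) + λ ν_h` on the product of two
three-manifolds oriented by `θN` and `θX`. -/
def sugraFlux [FiniteDimensional ℝ E] [FiniteDimensional ℝ E']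
    (χ : BilinField I M) (θN : FormField I M 3) (αN : FormField I M 1)
    (h : BilinField I' M') (θX : FormField I' M' 3) (αX : FormField I' M' 1) (lam l : ℝ) :
    FormField (I.prod I') (M × M') 3 := fun x =>
  lam • pullbackForm (I := I.prod I') Prod.fst (volumeForm χ θN) x
    + l • prodForm (hodgeStar 1 2 χ θN αN) αX x
    + l • prodForm αN (hodgeStar 1 2 h θX αX) x
    + lam • pullbackForm (I := I.prod I') Prod.snd (volumeForm h θX) x

end Product

end

set_option linter.unusedSectionVars false

noncomputable section

/-! ### Contractions in arbitrary dual frames -/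

section DualFrames

variable {V : Type*} [AddCommGroup V] [Module ℝ V]

theorem sum_dual_frames_eq {ι κ : Type*} [Fintype ι] [Fintype κ] {k : ℕ} {e e' : κ → V}
    {b b' : ι → V} (c : κ → ι → ℝ) (he : ∀ i, e i = ∑ j, c i j • b j)
    (hb' : ∀ j, b' j = ∑ i, c i j • e' i) (P Q : MultilinearMap ℝ (fun _ : Fin k => V) ℝ) :
    ∑ i : Fin k → κ, P (fun a => e' (i a)) * Q (fun a => e (i a))
      = ∑ j : Fin k → ι, P (fun a => b' (j a)) * Q (fun a => b (j a)) := by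
  classical
  simp only [he, hb', MultilinearMap.map_sum, MultilinearMap.map_smul_univ, smul_eq_mul,
    Finset.mul_sum, Finset.sum_mul]
  rw [Finset.sum_comm]
  refine Finset.sum_congr rfl fun j _ => Finset.sum_congr rfl fun i _ => ?_
  ring

variable [TopologicalSpace V]

theorem continuousAlternatingMap_comp_perm {ι : Type*} [Fintype ι] [DecidableEq ι]
    (θ : V [⋀^ι]→L[ℝ] ℝ) (v : ι → V) (σ : Equiv.Perm ι) :
    θ (v ∘ σ) = (Equiv.Perm.sign σ : ℤ) * θ v := by
  have := θ.toAlternatingMap.map_perm v σ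
  have h2 : θ (v ∘ σ) = Equiv.Perm.sign σ • θ v := this
  rw [h2, Units.smul_def, zsmul_eq_mul]

theorem basis_apply_ne_zero {n : ℕ} (b : Basis (Fin n) ℝ V) {θ : V [⋀^Fin n]→L[ℝ] ℝ}
    (hθ : θ ≠ 0) : θ b ≠ 0 := by
  intro h
  apply hθ
  have := θ.toAlternatingMap.eq_smul_basis_det b
  have h2 : θ.toAlternatingMap b = 0 := h
  rw [h2, zero_smul] at this
  ext v
  exact congrArg (fun f : V [⋀^Fin n]→ₗ[ℝ] ℝ => f v) this

variable [IsTopologicalAddGroup V] [ContinuousSMul ℝ V] [T2Space V]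
  [FiniteDimensional ℝ V]

/-- `b'` is the frame obtained from the dual basis of `b` by raising the index with `B`. -/
structure IsDualFrame {ι : Type*} [DecidableEq ι] (B : V →L[ℝ] V →L[ℝ] ℝ) (b : Basis ι ℝ V)
    (b' : ι → V) : Prop where
  apply_eq : ∀ i j, B (b' i) (b j) = if i = j then 1 else 0
  invertible : B.IsInvertible

theorem isInvertible_of_nondegenerate {B : V →L[ℝ] V →L[ℝ] ℝ}
    (h : ∀ v, (∀ w, B v w = 0) → v = 0) : B.IsInvertible := by
  have hinj : Function.Injective (B : V →ₗ[ℝ] V →L[ℝ] ℝ) := by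
    rw [injective_iff_map_eq_zero]
    intro v hv
    refine h v fun w => ?_
    have : B v = 0 := hv
    simp [this]
  have e0 : (V →ₗ[ℝ] ℝ) ≃ₗ[ℝ] (V →L[ℝ] ℝ) := LinearMap.toContinuousLinearMap
  have : FiniteDimensional ℝ (V →L[ℝ] ℝ) := Module.Finite.equiv e0
  have hd : finrank ℝ V = finrank ℝ (V →L[ℝ] ℝ) := by
    rw [← e0.finrank_eq]; exact (Subspace.dual_finrank_eq (K := ℝ) (V := V)).symm
  let e := (LinearEquiv.ofInjectiveOfFinrankEq (B : V →ₗ[ℝ] V →L[ℝ] ℝ) hinj hd)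
  exact ⟨e.toContinuousLinearEquiv, by ext v w; rfl⟩

theorem isDualFrame_raisedBasis {B : V →L[ℝ] V →L[ℝ] ℝ} (h : B.IsInvertible) :
    IsDualFrame B (finBasis ℝ V) (raisedBasis B) := by
  refine ⟨fun i j => ?_, h⟩
  obtain ⟨e, rfl⟩ := h
  simp [raisedBasis, ContinuousLinearMap.inverse_equiv, Finsupp.single_apply, eq_comm]

theorem sum_raisedBasis {ι : Type*} [Fintype ι] [DecidableEq ι] {B : V →L[ℝ] V →L[ℝ] ℝ}
    {b : Basis ι ℝ V} {b' : ι → V} (hb : IsDualFrame B b b') {k : ℕ}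
    (P Q : MultilinearMap ℝ (fun _ : Fin k => V) ℝ) :
    ∑ i : Fin k → Fin (finrank ℝ V),
        P (fun a => raisedBasis B (i a)) * Q (fun a => finBasis ℝ V (i a))
      = ∑ j : Fin k → ι, P (fun a => b' (j a)) * Q (fun a => b (j a)) := by
  refine sum_dual_frames_eq (fun i j => b.repr (finBasis ℝ V i) j)
    (fun i => (b.sum_repr _).symm) (fun j => ?_) P Q
  obtain ⟨e, he⟩ := hb.invertible
  have hr := isDualFrame_raisedBasis hb.invertible
  refine e.injective ?_
  have he' : ∀ v, e v = B v := fun v => by rw [← he]; rfl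
  rw [he', he']
  refine ContinuousLinearMap.coe_injective ((finBasis ℝ V).ext fun m => ?_)
  rw [ContinuousLinearMap.coe_coe, ContinuousLinearMap.coe_coe]
  have h1 : B (b' j) (finBasis ℝ V m) = b.repr (finBasis ℝ V m) j := by
    conv_lhs => rw [← b.sum_repr (finBasis ℝ V m)]
    rw [map_sum]
    simp only [map_smul, hb.apply_eq, smul_eq_mul, mul_ite, mul_one, mul_zero,
      Finset.sum_ite_eq, Finset.mem_univ, if_true]
  rw [h1, map_sum]
  simp [hr.apply_eq]

theorem contractForms_eq_sum {ι : Type*} [Fintype ι] [DecidableEq ι] {B : V →L[ℝ] V →L[ℝ] ℝ}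
    {b : Basis ι ℝ V} {b' : ι → V} (hb : IsDualFrame B b b') {k : ℕ}
    (ρ σ : V [⋀^Fin k]→L[ℝ] ℝ) :
    contractForms B ρ σ = ∑ j : Fin k → ι, ρ (fun a => b' (j a)) * σ (fun a => b (j a)) :=
  sum_raisedBasis hb ρ.toMultilinearMap σ.toMultilinearMap

theorem hodge_apply_eq_sum {ι : Type*} [Fintype ι] [DecidableEq ι] {B : V →L[ℝ] V →L[ℝ] ℝ}
    {b : Basis ι ℝ V} {b' : ι → V} (hb : IsDualFrame B b b') {k m : ℕ}
    (θ : V [⋀^Fin (k + m)]→L[ℝ] ℝ) (β : V [⋀^Fin k]→L[ℝ] ℝ) (w : Fin m → V) :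
    hodge k m B θ β w = 1 / (k.factorial : ℝ) * ∑ j : Fin k → ι,
      β (fun a => b' (j a)) * metricVolume B θ (Fin.append (fun a => b (j a)) w) := by
  set ν := metricVolume B θ
  let Q : MultilinearMap ℝ (fun _ : Fin k => V) ℝ :=
    { toFun := fun u => ν (Fin.append u w)
      map_update_add' := by
        intro _ u i x y
        have h : ∀ z : V, Fin.append (Function.update u i z) w
            = Function.update (Fin.append u w) (Fin.castAdd m i) z := by
          intro z
          ext j
          induction j using Fin.addCases with
          | left a => simp [Function.update_apply]
          | right a =>
            rw [Function.update_of_ne]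
            · simp
            · intro h; have := congrArg Fin.val h; simp at this; omega
        simp only [h, ν.map_update_add]
      map_update_smul' := by
        intro _ u i c x
        have h : ∀ z : V, Fin.append (Function.update u i z) w
            = Function.update (Fin.append u w) (Fin.castAdd m i) z := by
          intro z
          ext j
          induction j using Fin.addCases with
          | left a => simp [Function.update_apply]
          | right a =>
            rw [Function.update_of_ne]
            · simp
            · intro h; have := congrArg Fin.val h; simp at this; omega
        simp only [h, ν.map_update_smul] }
  have := sum_raisedBasis hb β.toMultilinearMap Q
  rw [hodge, ContinuousAlternatingMap.smul_apply, ContinuousAlternatingMap.sum_apply, smul_eq_mul]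
  congr 1

/-- A basis in which the symmetric form `B` is diagonal with entries `η i = ±1`. -/
structure IsOrthoFrame {ι : Type*} [DecidableEq ι] (B : V →L[ℝ] V →L[ℝ] ℝ) (b : Basis ι ℝ V)
    (η : ι → ℝ) : Prop where
  apply_eq : ∀ i j, B (b i) (b j) = if i = j then η i else 0
  sq_eq : ∀ i, η i * η i = 1

theorem IsOrthoFrame.isDualFrame {ι : Type*} [Fintype ι] [DecidableEq ι]
    {B : V →L[ℝ] V →L[ℝ] ℝ}
    {b : Basis ι ℝ V} {η : ι → ℝ} (h : IsOrthoFrame B b η) :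
    IsDualFrame B b (fun i => η i • b i) := by
  refine ⟨fun i j => ?_, isInvertible_of_nondegenerate fun v hv => ?_⟩
  · by_cases hij : i = j <;> simp [h.apply_eq, hij, h.sq_eq]
  · rw [← b.sum_repr v]
    refine Finset.sum_eq_zero fun i _ => ?_
    have h1 := hv (b i)
    have h2 := h.sq_eq i
    rw [← b.sum_repr v] at h1
    simp only [map_sum, map_smul, sum_apply, smul_apply,
      h.apply_eq, smul_eq_mul, mul_ite, mul_zero, Finset.sum_ite_eq', Finset.mem_univ, if_true]
      at h1
    have : b.repr v i = 0 := by
      rcases mul_eq_zero.1 h1 with h3 | h3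
      · exact h3
      · rw [h3] at h2; norm_num at h2
    rw [this, zero_smul]

theorem IsOrthoFrame.contractForms_eq {ι : Type*} [Fintype ι] [DecidableEq ι]
    {B : V →L[ℝ] V →L[ℝ] ℝ}
    {b : Basis ι ℝ V} {η : ι → ℝ} (h : IsOrthoFrame B b η) {k : ℕ}
    (ρ σ : V [⋀^Fin k]→L[ℝ] ℝ) :
    contractForms B ρ σ = ∑ j : Fin k → ι,
      (∏ a, η (j a)) * (ρ (fun a => b (j a)) * σ (fun a => b (j a))) := by
  rw [contractForms_eq_sum h.isDualFrame]
  refine Finset.sum_congr rfl fun j _ => ?_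
  have := ρ.toMultilinearMap.map_smul_univ (fun a => η (j a)) (fun a => b (j a))
  have h2 : ρ (fun a => η (j a) • b (j a)) = (∏ a, η (j a)) * ρ (fun a => b (j a)) := this
  rw [h2]; ring

theorem IsOrthoFrame.hodge_apply {ι : Type*} [Fintype ι] [DecidableEq ι]
    {B : V →L[ℝ] V →L[ℝ] ℝ}
    {b : Basis ι ℝ V} {η : ι → ℝ} (h : IsOrthoFrame B b η) {k m : ℕ}
    (θ : V [⋀^Fin (k + m)]→L[ℝ] ℝ) (β : V [⋀^Fin k]→L[ℝ] ℝ) (w : Fin m → V) :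
    hodge k m B θ β w = 1 / (k.factorial : ℝ) * ∑ j : Fin k → ι,
      (∏ a, η (j a)) * (β (fun a => b (j a)) *
        metricVolume B θ (Fin.append (fun a => b (j a)) w)) := by
  rw [hodge_apply_eq_sum h.isDualFrame]
  congr 1
  refine Finset.sum_congr rfl fun j _ => ?_
  have := β.toMultilinearMap.map_smul_univ (fun a => η (j a)) (fun a => b (j a))
  have h2 : β (fun a => η (j a) • b (j a)) = (∏ a, η (j a)) * β (fun a => b (j a)) := this
  rw [h2]; ring

theorem IsOrthoFrame.contractForms_top {n : ℕ} {B : V →L[ℝ] V →L[ℝ] ℝ}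
    {b : Basis (Fin n) ℝ V} {η : Fin n → ℝ} (h : IsOrthoFrame B b η) (θ : V [⋀^Fin n]→L[ℝ] ℝ) :
    contractForms B θ θ = (n.factorial : ℝ) * ((∏ i, η i) * θ b ^ 2) := by
  rw [h.contractForms_eq]
  have h0 : ∀ j ∈ Finset.univ, j ∉ Finset.univ.image
      (fun σ : Equiv.Perm (Fin n) => (σ : Fin n → Fin n)) →
      (∏ a, η (j a)) * (θ (fun a => b (j a)) * θ (fun a => b (j a))) = 0 := by
    intro j _ hj
    have : ¬ Function.Injective j := by
      intro hinj
      apply hj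
      simp only [Finset.mem_image, Finset.mem_univ, true_and]
      exact ⟨Equiv.ofBijective j (Finite.injective_iff_bijective.1 hinj), rfl⟩
    obtain ⟨x, y, hxy, hne⟩ : ∃ x y, j x = j y ∧ x ≠ y := by
      simpa [Function.Injective] using this
    have h1 : θ (fun a => b (j a)) = 0 := θ.map_eq_zero_of_eq _ (by simp [hxy]) hne
    rw [h1]; ring
  rw [← Finset.sum_subset (Finset.subset_univ _) h0, Finset.sum_image
    (fun σ _ τ _ hst => DFunLike.coe_injective hst)]
  have h1 : ∀ σ : Equiv.Perm (Fin n), (∏ a, η (σ a)) * (θ (fun a => b (σ a)) *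
      θ (fun a => b (σ a))) = (∏ i, η i) * θ b ^ 2 := by
    intro σ
    have h2 : θ (fun a => b (σ a)) = (Equiv.Perm.sign σ : ℤ) * θ b :=
      continuousAlternatingMap_comp_perm θ b σ
    rw [h2, Equiv.prod_comp σ η]
    have h3 : ((Equiv.Perm.sign σ : ℤ) : ℝ) * ((Equiv.Perm.sign σ : ℤ) : ℝ) = 1 := by
      rw [← Int.cast_mul, ← Units.val_mul, Int.units_mul_self]; simp
    linear_combination (∏ i, η i) * θ b ^ 2 * h3
  simp [h1, Finset.sum_const, Fintype.card_perm]

theorem IsOrthoFrame.metricVolume_eq {n : ℕ} {B : V →L[ℝ] V →L[ℝ] ℝ}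
    {b : Basis (Fin n) ℝ V} {η : Fin n → ℝ} (h : IsOrthoFrame B b η) (θ : V [⋀^Fin n]→L[ℝ] ℝ) :
    metricVolume B θ = |θ b|⁻¹ • θ := by
  have hη : |∏ i, η i| = 1 := by
    rw [Finset.abs_prod]
    refine Finset.prod_eq_one fun i _ => ?_
    rcases mul_self_eq_one_iff.1 (h.sq_eq i) with h1 | h1 <;> simp [h1]
  rw [metricVolume, h.contractForms_top, abs_mul, abs_mul, hη, one_mul, Nat.abs_cast]
  congr 1
  have hn : (n.factorial : ℝ) ≠ 0 := by positivity
  rw [div_mul_cancel_left₀ hn, Real.sqrt_inv, abs_pow, Real.sqrt_sq (abs_nonneg _)]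

end DualFrames

/-! ### Exterior products of forms on the factors of a product -/

section WedgeProduct

theorem wedge_apply {V : Type*} [AddCommGroup V] [Module ℝ V] [TopologicalSpace V] {p q : ℕ}
    (α : V [⋀^Fin p]→L[ℝ] ℝ) (β : V [⋀^Fin q]→L[ℝ] ℝ) (v : Fin (p + q) → V) :
    wedge α β v = 1 / ((p.factorial : ℝ) * (q.factorial : ℝ)) *
      ∑ σ : Equiv.Perm (Fin (p + q)), ((Equiv.Perm.sign σ : ℤ) : ℝ) *
        (α (fun i => v (σ (Fin.castAdd q i))) * β (fun j => v (σ (Fin.natAdd p j)))) := by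
  rw [wedge, ContinuousAlternatingMap.smul_apply, smul_eq_mul,
    ContinuousMultilinearMap.alternatization_apply_apply]
  congr 1
  refine Finset.sum_congr rfl fun σ _ => ?_
  rw [Units.smul_def, zsmul_eq_mul]
  rfl

theorem wedge_compContinuousLinearMap {V W : Type*} [AddCommGroup V] [Module ℝ V]
    [TopologicalSpace V] [AddCommGroup W] [Module ℝ W] [TopologicalSpace W] {p q : ℕ}
    (α : V [⋀^Fin p]→L[ℝ] ℝ) (β : V [⋀^Fin q]→L[ℝ] ℝ) (L : W →L[ℝ] V) :
    (wedge α β).compContinuousLinearMap L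
      = wedge (α.compContinuousLinearMap L) (β.compContinuousLinearMap L) := by
  ext v
  rw [ContinuousAlternatingMap.compContinuousLinearMap_apply, wedge_apply, wedge_apply]
  rfl

variable {V W : Type*} [AddCommGroup V] [Module ℝ V] [TopologicalSpace V]
  [AddCommGroup W] [Module ℝ W] [TopologicalSpace W]

/-- The exterior product `pr₁^* ρ ∧ pr₂^* σ` on a product of vector spaces. -/
def prodWedge {p q : ℕ} (ρ : V [⋀^Fin p]→L[ℝ] ℝ) (σ : W [⋀^Fin q]→L[ℝ] ℝ) :
    (V × W) [⋀^Fin (p + q)]→L[ℝ] ℝ :=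
  wedge (ρ.compContinuousLinearMap (ContinuousLinearMap.fst ℝ V W))
    (σ.compContinuousLinearMap (ContinuousLinearMap.snd ℝ V W))

theorem prodWedge_apply {p q : ℕ} (ρ : V [⋀^Fin p]→L[ℝ] ℝ) (σ : W [⋀^Fin q]→L[ℝ] ℝ)
    (v : Fin (p + q) → V × W) :
    prodWedge ρ σ v = 1 / ((p.factorial : ℝ) * (q.factorial : ℝ)) *
      ∑ τ : Equiv.Perm (Fin (p + q)), ((Equiv.Perm.sign τ : ℤ) : ℝ) *
        (ρ (fun i => (v (τ (Fin.castAdd q i))).1) * σ (fun j => (v (τ (Fin.natAdd p j))).2)) :=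
  wedge_apply _ _ _

theorem prodWedge_eq_zero_of_snd {p q : ℕ} (ρ : V [⋀^Fin p]→L[ℝ] ℝ) (σ : W [⋀^Fin q]→L[ℝ] ℝ)
    (t : Fin (p + q) → V × W) (S : Finset (Fin (p + q))) (hS : p < S.card)
    (ht : ∀ i ∈ S, (t i).2 = 0) : prodWedge ρ σ t = 0 := by
  rw [prodWedge_apply, Finset.sum_eq_zero, mul_zero]
  intro τ _
  obtain ⟨j, hj⟩ : ∃ j : Fin q, τ (Fin.natAdd p j) ∈ S := by
    by_contra! hcon
    have hsub : S ⊆ Finset.univ.image (fun i : Fin p => τ (Fin.castAdd q i)) := by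
      intro s hs
      obtain ⟨i, rfl⟩ := τ.surjective s
      induction i using Fin.addCases with
      | left a => exact Finset.mem_image.2 ⟨a, Finset.mem_univ _, rfl⟩
      | right a => exact absurd hs (hcon a)
    have := (Finset.card_le_card hsub).trans Finset.card_image_le
    simp at this
    omega
  have h0 : σ (fun j => (t (τ (Fin.natAdd p j))).2) = 0 :=
    σ.toMultilinearMap.map_coord_zero j (ht _ hj)
  rw [h0]; ring

theorem prodWedge_eq_zero_of_fst {p q : ℕ} (ρ : V [⋀^Fin p]→L[ℝ] ℝ) (σ : W [⋀^Fin q]→L[ℝ] ℝ)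
    (t : Fin (p + q) → V × W) (S : Finset (Fin (p + q))) (hS : q < S.card)
    (ht : ∀ i ∈ S, (t i).1 = 0) : prodWedge ρ σ t = 0 := by
  rw [prodWedge_apply, Finset.sum_eq_zero, mul_zero]
  intro τ _
  obtain ⟨j, hj⟩ : ∃ j : Fin p, τ (Fin.castAdd q j) ∈ S := by
    by_contra! hcon
    have hsub : S ⊆ Finset.univ.image (fun i : Fin q => τ (Fin.natAdd p i)) := by
      intro s hs
      obtain ⟨i, rfl⟩ := τ.surjective s
      induction i using Fin.addCases with
      | left a => exact absurd hs (hcon a)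
      | right a => exact Finset.mem_image.2 ⟨a, Finset.mem_univ _, rfl⟩
    have := (Finset.card_le_card hsub).trans Finset.card_image_le
    simp at this
    omega
  have h0 : ρ (fun j => (t (τ (Fin.castAdd q j))).1) = 0 :=
    ρ.toMultilinearMap.map_coord_zero j (ht _ hj)
  rw [h0]; ring

theorem prodWedge_append {p q : ℕ} (ρ : V [⋀^Fin p]→L[ℝ] ℝ) (σ : W [⋀^Fin q]→L[ℝ] ℝ)
    (v : Fin p → V) (w : Fin q → W) :
    prodWedge ρ σ (Fin.append (fun i => (v i, 0)) (fun j => (0, w j))) = ρ v * σ w := by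
  classical
  rw [prodWedge_apply]
  set t : Fin (p + q) → V × W := Fin.append (fun i => (v i, 0)) (fun j => (0, w j)) with ht
  let Φ : Equiv.Perm (Fin p) × Equiv.Perm (Fin q) → Equiv.Perm (Fin (p + q)) := fun x =>
    finSumFinEquiv.permCongr (Equiv.Perm.sumCongrHom (Fin p) (Fin q) x)
  have hΦl : ∀ x i, Φ x (Fin.castAdd q i) = Fin.castAdd q (x.1 i) := by
    intro x i; simp [Φ, Equiv.permCongr_apply]
  have hΦr : ∀ x j, Φ x (Fin.natAdd p j) = Fin.natAdd p (x.2 j) := by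
    intro x i; simp [Φ, Equiv.permCongr_apply]
  have hΦ : Function.Injective Φ :=
    finSumFinEquiv.permCongr.injective.comp Equiv.Perm.sumCongrHom_injective
  have h0 : ∀ τ ∈ Finset.univ, τ ∉ Finset.univ.image Φ →
      ((Equiv.Perm.sign τ : ℤ) : ℝ) * (ρ (fun i => (t (τ (Fin.castAdd q i))).1) *
        σ (fun j => (t (τ (Fin.natAdd p j))).2)) = 0 := by
    intro τ _ hτ
    obtain ⟨i, j, hij⟩ : ∃ i j, τ (Fin.castAdd q i) = Fin.natAdd p j := by
      by_contra! hcon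
      apply hτ
      have hm : MapsTo (finSumFinEquiv.symm.permCongr τ) (range (Sum.inl : Fin p → Fin p ⊕ Fin q))
          (range Sum.inl) := by
        rintro _ ⟨i, rfl⟩
        rcases h : finSumFinEquiv.symm (τ (Fin.castAdd q i)) with a | a
        · exact ⟨a, by simp [Equiv.permCongr_apply, h]⟩
        · exfalso
          rw [Equiv.symm_apply_eq] at h
          exact hcon i a (by simpa using h)
      obtain ⟨x, hx⟩ := Equiv.Perm.mem_sumCongrHom_range_of_perm_mapsTo_inl hm
      refine Finset.mem_image.2 ⟨x, Finset.mem_univ _, ?_⟩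
      simp only [Φ, hx]
      ext i
      simp [Equiv.permCongr_apply]
    have h1 : ρ (fun i => (t (τ (Fin.castAdd q i))).1) = 0 :=
      ρ.toMultilinearMap.map_coord_zero i (by simp [hij, ht])
    rw [h1]; ring
  rw [← Finset.sum_subset (Finset.subset_univ _) h0, Finset.sum_image
    (fun _ _ _ _ hst => hΦ hst)]
  have h1 : ∀ x : Equiv.Perm (Fin p) × Equiv.Perm (Fin q),
      ((Equiv.Perm.sign (Φ x) : ℤ) : ℝ) * (ρ (fun i => (t (Φ x (Fin.castAdd q i))).1) *
        σ (fun j => (t (Φ x (Fin.natAdd p j))).2)) = ρ v * σ w := by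
    intro x
    have hρ : ρ (fun i => (t (Φ x (Fin.castAdd q i))).1) = (Equiv.Perm.sign x.1 : ℤ) * ρ v := by
      rw [← continuousAlternatingMap_comp_perm]
      congr 1; ext i; simp [hΦl, ht]
    have hσ : σ (fun i => (t (Φ x (Fin.natAdd p i))).2) = (Equiv.Perm.sign x.2 : ℤ) * σ w := by
      rw [← continuousAlternatingMap_comp_perm]
      congr 1; ext i; simp [hΦr, ht]
    have hs : Equiv.Perm.sign (Φ x) = Equiv.Perm.sign x.1 * Equiv.Perm.sign x.2 := by
      simp only [Φ, Equiv.Perm.sign_permCongr]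
      exact Equiv.Perm.sign_sumCongr x.1 x.2
    have hsq : ∀ u : ℤˣ, ((u : ℤ) : ℝ) * ((u : ℤ) : ℝ) = 1 := by
      intro u; rw [← Int.cast_mul, ← Units.val_mul, Int.units_mul_self]; simp
    rw [hρ, hσ, hs, Units.val_mul, Int.cast_mul]
    linear_combination (((Equiv.Perm.sign x.2 : ℤ) : ℝ) * ((Equiv.Perm.sign x.2 : ℤ) : ℝ) *
      ρ v * σ w) * hsq (Equiv.Perm.sign x.1) + (ρ v * σ w) * hsq (Equiv.Perm.sign x.2)
  simp only [h1, Finset.sum_const, Finset.card_univ, Fintype.card_prod, Fintype.card_perm,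
    Fintype.card_fin, nsmul_eq_mul, Nat.cast_mul]
  field_simp

end WedgeProduct

/-! ### Contractions and Hodge duals of forms of low degree in orthonormal frames -/

section FrameFormulas

theorem sum_fin_succ_arrow {ι M : Type*} [Fintype ι] [AddCommMonoid M] {n : ℕ}
    (f : (Fin (n + 1) → ι) → M) :
    ∑ j : Fin (n + 1) → ι, f j = ∑ a, ∑ j : Fin n → ι, f (Matrix.vecCons a j) := by
  rw [← (Fin.consEquiv (fun _ : Fin (n + 1) => ι)).sum_comp, Fintype.sum_prod_type]
  rfl

theorem sum_fin_zero_arrow {ι M : Type*} [Fintype ι] [AddCommMonoid M]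
    (f : (Fin 0 → ι) → M) : ∑ j : Fin 0 → ι, f j = f ![] := by
  rw [Fintype.sum_unique]
  congr 1

variable {V : Type*} [AddCommGroup V] [Module ℝ V] [TopologicalSpace V]
  [IsTopologicalAddGroup V] [ContinuousSMul ℝ V] [T2Space V] [FiniteDimensional ℝ V]
  {ι : Type*} [Fintype ι] [DecidableEq ι] {B : V →L[ℝ] V →L[ℝ] ℝ} {b : Basis ι ℝ V} {η : ι → ℝ}

theorem IsOrthoFrame.contractForms_one (h : IsOrthoFrame B b η) (ρ σ : V [⋀^Fin 1]→L[ℝ] ℝ) :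
    contractForms B ρ σ = ∑ i, η i * (ρ ![b i] * σ ![b i]) := by
  rw [h.contractForms_eq]
  simp only [sum_fin_succ_arrow, sum_fin_zero_arrow]
  refine Finset.sum_congr rfl fun i _ => ?_
  have : (fun a => b (![i] a)) = ![b i] := by ext a; fin_cases a; rfl
  rw [this, Fin.prod_univ_one]
  rfl

theorem IsOrthoFrame.contractForms_two (h : IsOrthoFrame B b η) (ρ σ : V [⋀^Fin 2]→L[ℝ] ℝ) :
    contractForms B ρ σ = ∑ i, ∑ j, η i * η j * (ρ ![b i, b j] * σ ![b i, b j]) := by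
  rw [h.contractForms_eq]
  simp only [sum_fin_succ_arrow, sum_fin_zero_arrow]
  refine Finset.sum_congr rfl fun i _ => Finset.sum_congr rfl fun j _ => ?_
  have : (fun a => b (![i, j] a)) = ![b i, b j] := by ext a; fin_cases a <;> rfl
  simp [this, Fin.prod_univ_succ]

theorem IsOrthoFrame.contractForms_three (h : IsOrthoFrame B b η) (ρ σ : V [⋀^Fin 3]→L[ℝ] ℝ) :
    contractForms B ρ σ = ∑ i, ∑ j, ∑ k, η i * η j * η k *
      (ρ ![b i, b j, b k] * σ ![b i, b j, b k]) := by
  rw [h.contractForms_eq]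
  simp only [sum_fin_succ_arrow, sum_fin_zero_arrow]
  refine Finset.sum_congr rfl fun i _ => Finset.sum_congr rfl fun j _ =>
    Finset.sum_congr rfl fun k _ => ?_
  have : (fun a => b (![i, j, k] a)) = ![b i, b j, b k] := by ext a; fin_cases a <;> rfl
  simp [this, Fin.prod_univ_succ, mul_assoc]

theorem IsOrthoFrame.hodge_one_two (h : IsOrthoFrame B b η) (θ : V [⋀^Fin 3]→L[ℝ] ℝ)
    (α : V [⋀^Fin 1]→L[ℝ] ℝ) (x y : V) :
    hodge 1 2 B θ α ![x, y] = ∑ i, η i * (α ![b i] * metricVolume B θ ![b i, x, y]) := by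
  rw [h.hodge_apply]
  simp only [sum_fin_succ_arrow, sum_fin_zero_arrow]
  rw [Nat.factorial_one, Nat.cast_one, div_one, one_mul]
  refine Finset.sum_congr rfl fun i _ => ?_
  have h1 : (fun a => b (![i] a)) = ![b i] := by ext a; fin_cases a; rfl
  have h2 : Fin.append ![b i] ![x, y] = ![b i, x, y] := by ext a; fin_cases a <;> rfl
  rw [h1, h2, Fin.prod_univ_one]
  rfl

theorem IsOrthoFrame.hodge_two_one (h : IsOrthoFrame B b η) (θ : V [⋀^Fin 3]→L[ℝ] ℝ)
    (φ : V [⋀^Fin 2]→L[ℝ] ℝ) (x : V) :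
    hodge 2 1 B θ φ ![x] = 1 / 2 * ∑ i, ∑ j, η i * η j *
      (φ ![b i, b j] * metricVolume B θ ![b i, b j, x]) := by
  rw [h.hodge_apply]
  simp only [sum_fin_succ_arrow, sum_fin_zero_arrow]
  rw [Nat.factorial_two, Nat.cast_two]
  congr 1
  refine Finset.sum_congr rfl fun i _ => Finset.sum_congr rfl fun j _ => ?_
  have h1 : (fun a => b (![i, j] a)) = ![b i, b j] := by ext a; fin_cases a <;> rfl
  have h2 : Fin.append ![b i, b j] ![x] = ![b i, b j, x] := by ext a; fin_cases a <;> rfl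
  simp [h1, h2, Fin.prod_univ_succ]

theorem IsOrthoFrame.hodge_three_three (h : IsOrthoFrame B b η) (θ : V [⋀^Fin 6]→L[ℝ] ℝ)
    (ρ : V [⋀^Fin 3]→L[ℝ] ℝ) (x y z : V) :
    hodge 3 3 B θ ρ ![x, y, z] = 1 / 6 * ∑ i, ∑ j, ∑ k, η i * η j * η k *
      (ρ ![b i, b j, b k] * metricVolume B θ ![b i, b j, b k, x, y, z]) := by
  rw [h.hodge_apply]
  simp only [sum_fin_succ_arrow, sum_fin_zero_arrow]
  rw [show ((Nat.factorial 3 : ℕ) : ℝ) = 6 by norm_num [Nat.factorial]]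
  congr 1
  refine Finset.sum_congr rfl fun i _ => Finset.sum_congr rfl fun j _ =>
    Finset.sum_congr rfl fun k _ => ?_
  have h1 : (fun a => b (![i, j, k] a)) = ![b i, b j, b k] := by ext a; fin_cases a <;> rfl
  have h2 : Fin.append ![b i, b j, b k] ![x, y, z] = ![b i, b j, b k, x, y, z] := by
    ext a; fin_cases a <;> rfl
  simp [h1, h2, Fin.prod_univ_succ, mul_assoc]

end FrameFormulas

/-! ### Forms of low degree -/

section LowDegree

variable {V : Type*} [AddCommGroup V] [Module ℝ V] [TopologicalSpace V]

theorem form_one_add (α : V [⋀^Fin 1]→L[ℝ] ℝ) (x y : V) : α ![x + y] = α ![x] + α ![y] := by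
  have h : ∀ z : V, Function.update ![0] 0 z = ![z] := by intro z; ext a; fin_cases a; rfl
  simpa only [h] using α.map_update_add ![0] 0 x y

theorem form_one_smul (α : V [⋀^Fin 1]→L[ℝ] ℝ) (c : ℝ) (x : V) : α ![c • x] = c * α ![x] := by
  have h : ∀ z : V, Function.update ![0] 0 z = ![z] := by intro z; ext a; fin_cases a; rfl
  simpa only [h, smul_eq_mul] using α.map_update_smul ![0] 0 c x

theorem form_two_swap (φ : V [⋀^Fin 2]→L[ℝ] ℝ) (x y : V) : φ ![y, x] = - φ ![x, y] := by
  have := φ.toAlternatingMap.map_swap ![x, y] (i := 0) (j := 1) (by decide)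
  have h : ![x, y] ∘ Equiv.swap (0 : Fin 2) 1 = ![y, x] := by
    ext a; fin_cases a <;> simp
  rwa [h] at this

theorem form_two_self (φ : V [⋀^Fin 2]→L[ℝ] ℝ) (x : V) : φ ![x, x] = 0 :=
  φ.map_eq_zero_of_eq (i := 0) (j := 1) _ rfl (by decide)

theorem form_three_cycle (φ : V [⋀^Fin 3]→L[ℝ] ℝ) (x y z : V) : φ ![y, z, x] = φ ![x, y, z] := by
  have := continuousAlternatingMap_comp_perm φ ![x, y, z] (finRotate 3)
  have h : ![x, y, z] ∘ finRotate 3 = ![y, z, x] := by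
    ext a; fin_cases a <;> rfl
  rw [h] at this
  simpa [sign_finRotate] using this

theorem form_three_swap (φ : V [⋀^Fin 3]→L[ℝ] ℝ) (x y z : V) : φ ![x, z, y] = - φ ![x, y, z] := by
  have := φ.toAlternatingMap.map_swap ![x, y, z] (i := 1) (j := 2) (by decide)
  have h : ![x, y, z] ∘ Equiv.swap (1 : Fin 3) 2 = ![x, z, y] := by
    ext a; fin_cases a <;> rfl
  rwa [h] at this

theorem form_three_add (φ : V [⋀^Fin 3]→L[ℝ] ℝ) (x x' y z : V) :
    φ ![x + x', y, z] = φ ![x, y, z] + φ ![x', y, z] := by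
  have h : ∀ u : V, Function.update ![0, y, z] 0 u = ![u, y, z] := by
    intro u; ext a; fin_cases a <;> rfl
  simpa only [h] using φ.map_update_add ![0, y, z] 0 x x'

theorem form_one_sum {ι : Type*} [Fintype ι] (b : Basis ι ℝ V) (α : V [⋀^Fin 1]→L[ℝ] ℝ) (x : V) :
    α ![x] = ∑ i, b.repr x i * α ![b i] := by
  let f : V →ₗ[ℝ] ℝ :=
    { toFun := fun x => α ![x]
      map_add' := form_one_add α
      map_smul' := form_one_smul α }
  change f x = ∑ i, b.repr x i * f (b i)
  conv_lhs => rw [← b.sum_repr x]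
  simp only [map_sum, map_smul, smul_eq_mul]

theorem form_three_eq_det (b : Basis (Fin 3) ℝ V) {ν : V [⋀^Fin 3]→L[ℝ] ℝ} (hν : ν b = 1)
    (x y z : V) : ν ![x, y, z] =
      b.repr x 0 * (b.repr y 1 * b.repr z 2 - b.repr y 2 * b.repr z 1)
      - b.repr x 1 * (b.repr y 0 * b.repr z 2 - b.repr y 2 * b.repr z 0)
      + b.repr x 2 * (b.repr y 0 * b.repr z 1 - b.repr y 1 * b.repr z 0) := by
  have h1 := ν.toAlternatingMap.eq_smul_basis_det b
  have h2 : ν.toAlternatingMap b = 1 := hν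
  rw [h2, one_smul] at h1
  have h3 : ν ![x, y, z] = b.det ![x, y, z] :=
    congrArg (fun f : V [⋀^Fin 3]→ₗ[ℝ] ℝ => f ![x, y, z]) h1
  rw [h3, Basis.det_apply, Matrix.det_fin_three]
  simp [Basis.toMatrix_apply]
  ring

theorem form_two_ext {ι : Type*} [Fintype ι] (b : Basis ι ℝ V) {φ φ' : V [⋀^Fin 2]→L[ℝ] ℝ}
    (h : ∀ i j, φ ![b i, b j] = φ' ![b i, b j]) : φ = φ' := by
  have : φ.toAlternatingMap = φ'.toAlternatingMap := by
    refine b.ext_alternating fun v _ => ?_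
    have h1 : (fun i => b (v i)) = ![b (v 0), b (v 1)] := by ext a; fin_cases a <;> rfl
    rw [h1]
    exact h _ _
  ext v
  exact congrArg (fun f : V [⋀^Fin 2]→ₗ[ℝ] ℝ => f v) this

end LowDegree

/-! ### Identities in dimension three -/

section ThreeDim

variable {V : Type*} [AddCommGroup V] [Module ℝ V] [TopologicalSpace V]
  [IsTopologicalAddGroup V] [ContinuousSMul ℝ V] [T2Space V] [FiniteDimensional ℝ V]

/-- A positively oriented orthonormal frame of a three-dimensional space oriented by `θ`, where
`s` is the sign of the determinant of the metric. -/
structure IsOrientedFrame (B : V →L[ℝ] V →L[ℝ] ℝ) (θ : V [⋀^Fin 3]→L[ℝ] ℝ)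
    (b : Basis (Fin 3) ℝ V) (η : Fin 3 → ℝ) (s : ℝ) : Prop extends IsOrthoFrame B b η where
  prod_eq : η 0 * η 1 * η 2 = s
  pos : 0 < θ b

variable {B : V →L[ℝ] V →L[ℝ] ℝ} {θ : V [⋀^Fin 3]→L[ℝ] ℝ} {b : Basis (Fin 3) ℝ V}
  {η : Fin 3 → ℝ} {s : ℝ}

theorem IsOrientedFrame.metricVolume_apply (h : IsOrientedFrame B θ b η s) :
    metricVolume B θ b = 1 := by
  rw [h.metricVolume_eq, ContinuousAlternatingMap.smul_apply, smul_eq_mul, abs_of_pos h.pos,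
    inv_mul_cancel₀ h.pos.ne']

theorem IsOrientedFrame.bilin_apply (h : IsOrientedFrame B θ b η s) (x y : V) :
    B x y = ∑ i, η i * (b.repr x i * b.repr y i) := by
  conv_lhs => rw [← b.sum_repr x, ← b.sum_repr y]
  simp only [map_sum, map_smul, sum_apply, smul_apply, h.apply_eq, smul_eq_mul, mul_ite, mul_zero,
    Finset.sum_ite_eq', Finset.mem_univ, if_true]
  refine Finset.sum_congr rfl fun i _ => ?_
  ring

theorem IsOrientedFrame.eta_cases (h : IsOrientedFrame B θ b η s) (i : Fin 3) :
    η i = 1 ∨ η i = -1 := mul_self_eq_one_iff.1 (h.sq_eq i)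

theorem IsOrientedFrame.sum_volume_volume (h : IsOrientedFrame B θ b η s) (x y : V) :
    ∑ i, ∑ j, η i * η j * (metricVolume B θ ![x, b i, b j] * metricVolume B θ ![y, b i, b j])
      = 2 * s * B x y := by
  simp only [form_three_eq_det b h.metricVolume_apply, h.bilin_apply, Fin.sum_univ_three,
    Basis.repr_self, Finsupp.single_apply, ← h.prod_eq]
  rcases h.eta_cases 0 with h0 | h0 <;> rcases h.eta_cases 1 with h1 | h1 <;>
  rcases h.eta_cases 2 with h2 | h2 <;> simp [h0, h1, h2] <;> ring

theorem IsOrientedFrame.sum_volume_hodge (h : IsOrientedFrame B θ b η s)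
    (α : V [⋀^Fin 1]→L[ℝ] ℝ) (x : V) :
    ∑ i, ∑ j, η i * η j * (metricVolume B θ ![x, b i, b j] * hodge 1 2 B θ α ![b i, b j])
      = 2 * s * α ![x] := by
  rw [form_one_sum b α x]
  simp only [h.hodge_one_two, form_three_eq_det b h.metricVolume_apply, Fin.sum_univ_three,
    Basis.repr_self, Finsupp.single_apply, ← h.prod_eq]
  rcases h.eta_cases 0 with h0 | h0 <;> rcases h.eta_cases 1 with h1 | h1 <;>
  rcases h.eta_cases 2 with h2 | h2 <;> simp [h0, h1, h2] <;> ring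

theorem IsOrientedFrame.sum_hodge_hodge (h : IsOrientedFrame B θ b η s)
    (α : V [⋀^Fin 1]→L[ℝ] ℝ) :
    ∑ i, ∑ j, η i * η j * (hodge 1 2 B θ α ![b i, b j] * hodge 1 2 B θ α ![b i, b j])
      = 2 * s * contractForms B α α := by
  rw [h.contractForms_one]
  simp only [h.hodge_one_two, form_three_eq_det b h.metricVolume_apply, Fin.sum_univ_three,
    Basis.repr_self, Finsupp.single_apply, ← h.prod_eq]
  rcases h.eta_cases 0 with h0 | h0 <;> rcases h.eta_cases 1 with h1 | h1 <;>
  rcases h.eta_cases 2 with h2 | h2 <;> simp [h0, h1, h2] <;> ring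

theorem IsOrientedFrame.sum_hodge_apply_hodge_apply (h : IsOrientedFrame B θ b η s)
    (α : V [⋀^Fin 1]→L[ℝ] ℝ) (x y : V) :
    ∑ i, η i * (hodge 1 2 B θ α ![x, b i] * hodge 1 2 B θ α ![y, b i])
      = s * (contractForms B α α * B x y - α ![x] * α ![y]) := by
  rw [h.contractForms_one, form_one_sum b α x, form_one_sum b α y]
  simp only [h.hodge_one_two, form_three_eq_det b h.metricVolume_apply, Fin.sum_univ_three,
    Basis.repr_self, Finsupp.single_apply, ← h.prod_eq, h.bilin_apply]
  rcases h.eta_cases 0 with h0 | h0 <;> rcases h.eta_cases 1 with h1 | h1 <;>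
  rcases h.eta_cases 2 with h2 | h2 <;> simp [h0, h1, h2] <;> ring

theorem IsOrientedFrame.sum_hodge_apply_mul (h : IsOrientedFrame B θ b η s)
    (α : V [⋀^Fin 1]→L[ℝ] ℝ) (x : V) :
    ∑ i, η i * (hodge 1 2 B θ α ![x, b i] * α ![b i]) = 0 := by
  simp only [h.hodge_one_two, form_three_eq_det b h.metricVolume_apply, Fin.sum_univ_three,
    Basis.repr_self, Finsupp.single_apply]
  simp
  ring

theorem IsOrientedFrame.sum_volume_sq (h : IsOrientedFrame B θ b η s) :
    ∑ i, ∑ j, ∑ k, η i * η j * η k *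
      (metricVolume B θ ![b i, b j, b k] * metricVolume B θ ![b i, b j, b k]) = 6 * s := by
  simp only [form_three_eq_det b h.metricVolume_apply, Fin.sum_univ_three,
    Basis.repr_self, Finsupp.single_apply, ← h.prod_eq]
  simp
  ring

theorem IsOrientedFrame.hodge_hodge (h : IsOrientedFrame B θ b η s)
    (φ : V [⋀^Fin 2]→L[ℝ] ℝ) : hodge 1 2 B θ (hodge 2 1 B θ φ) = s • φ := by
  refine form_two_ext b fun i j => ?_
  rw [ContinuousAlternatingMap.smul_apply, smul_eq_mul]
  have e10 := form_two_swap φ (b 0) (b 1)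
  have e20 := form_two_swap φ (b 0) (b 2)
  have e21 := form_two_swap φ (b 1) (b 2)
  simp only [h.hodge_one_two, h.hodge_two_one, form_three_eq_det b h.metricVolume_apply,
    Fin.sum_univ_three, Basis.repr_self, Finsupp.single_apply, ← h.prod_eq, form_two_self,
    e10, e20, e21]
  fin_cases i <;> fin_cases j <;> simp [form_two_self, e10, e20, e21] <;> ring

end ThreeDim

/-! ### Existence of oriented orthonormal frames -/

section Frames

variable {V : Type*} [AddCommGroup V] [Module ℝ V] [TopologicalSpace V]
  [IsTopologicalAddGroup V] [ContinuousSMul ℝ V] [T2Space V] [FiniteDimensional ℝ V]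
  {B : V →L[ℝ] V →L[ℝ] ℝ} {θ : V [⋀^Fin 3]→L[ℝ] ℝ}

theorem exists_isOrientedFrame (hsymm : ∀ v w, B v w = B w v)
    (hnd : ∀ v, (∀ w, B v w = 0) → v = 0) (hn : finrank ℝ V = 3) (hθ : θ ≠ 0) :
    ∃ (b : Basis (Fin 3) ℝ V) (η : Fin 3 → ℝ), IsOrientedFrame B θ b η (η 0 * η 1 * η 2) := by
  let B₀ : LinearMap.BilinForm ℝ V := (ContinuousLinearMap.coeLM ℝ) ∘ₗ (B : V →ₗ[ℝ] V →L[ℝ] ℝ)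
  have hB₀ : ∀ v w, B₀ v w = B v w := fun _ _ => rfl
  obtain ⟨v₀, hv₀⟩ := LinearMap.BilinForm.exists_orthogonal_basis (B := B₀) ⟨fun v w => by
    simpa [hB₀] using hsymm v w⟩
  let v : Basis (Fin 3) ℝ V := v₀.reindex (finCongr hn)
  have hv : ∀ i j, i ≠ j → B (v i) (v j) = 0 := by
    intro i j hij
    have h1 : (finCongr hn).symm i ≠ (finCongr hn).symm j := fun h => hij (Equiv.injective _ h)
    have h2 : B₀ (v₀ ((finCongr hn).symm i)) (v₀ ((finCongr hn).symm j)) = 0 := hv₀ h1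
    rw [hB₀] at h2
    simpa [v] using h2
  have hd : ∀ i, B (v i) (v i) ≠ 0 := by
    intro i h0
    refine v.ne_zero i (hnd _ fun w => ?_)
    rw [← v.sum_repr w, map_sum]
    refine Finset.sum_eq_zero fun j _ => ?_
    rw [map_smul]
    by_cases hij : i = j
    · rw [← hij, h0, smul_zero]
    · rw [hv i j hij, smul_zero]
  set τ : ℝ := ((SignType.sign (θ v) : SignType) : ℝ) with hτ
  have hθv : θ v ≠ 0 := basis_apply_ne_zero v hθ
  have hτθ : 0 < τ * θ v := by
    rw [hτ, mul_comm, self_mul_sign]; exact abs_pos.2 hθv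
  have hττ : τ * τ = 1 := by
    rcases lt_or_gt_of_ne hθv with h | h <;> simp [hτ, h]
  let c : Fin 3 → ℝ := fun i => (if i = 0 then τ else 1) * (Real.sqrt |B (v i) (v i)|)⁻¹
  have hsq : ∀ i, 0 < Real.sqrt |B (v i) (v i)| := fun i => Real.sqrt_pos.2 (abs_pos.2 (hd i))
  have hif : ∀ i : Fin 3, (if i = 0 then τ else 1) * (if i = 0 then τ else 1) = 1 := by
    intro i; by_cases hi : i = 0 <;> simp [hi, hττ]
  have hc : ∀ i, IsUnit (c i) := by
    intro i
    refine IsUnit.mk0 _ (mul_ne_zero (fun h => ?_) (inv_ne_zero (hsq i).ne'))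
    have := hif i
    rw [h] at this; norm_num at this
  let b := v.isUnitSMul hc
  have hb : ∀ i, b i = c i • v i := fun i => v.isUnitSMul_apply hc i
  have hcc : ∀ i, c i * c i = |B (v i) (v i)|⁻¹ := by
    intro i
    have h1 := Real.mul_self_sqrt (abs_nonneg (B (v i) (v i)))
    have h2 := hif i
    calc c i * c i = ((if i = 0 then τ else 1) * (if i = 0 then τ else 1)) *
          (Real.sqrt |B (v i) (v i)| * Real.sqrt |B (v i) (v i)|)⁻¹ := by
            simp only [c, mul_inv]; ring
      _ = _ := by rw [h1, h2, one_mul]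
  refine ⟨b, fun i => B (b i) (b i), ⟨⟨fun i j => ?_, fun i => ?_⟩, rfl, ?_⟩⟩
  · by_cases hij : i = j
    · simp [hij]
    · simp [hij, hb, hv i j hij]
  · have h1 : B (b i) (b i) = |B (v i) (v i)|⁻¹ * B (v i) (v i) := by
      rw [← hcc, hb]; simp; ring
    rw [h1]
    have h2 := abs_mul_abs_self (B (v i) (v i))
    have h3 : |B (v i) (v i)| ≠ 0 := abs_ne_zero.2 (hd i)
    field_simp
    linear_combination -h2
  · have h1 : (b : Fin 3 → V) = fun i => c i • v i := funext hb
    have h2 : θ (fun i => c i • v i) = (∏ i, c i) * θ v := θ.toMultilinearMap.map_smul_univ c v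
    rw [h1, h2, Fin.prod_univ_three]
    have h3 : c 0 * c 1 * c 2 * θ v = (τ * θ v) * ((Real.sqrt |B (v 0) (v 0)|)⁻¹ *
      (Real.sqrt |B (v 1) (v 1)|)⁻¹ * (Real.sqrt |B (v 2) (v 2)|)⁻¹) := by
      simp [c]; ring
    rw [h3]
    have := hsq 0
    have := hsq 1
    have := hsq 2
    positivity

theorem exists_isOrientedFrame_of_pos (hsymm : ∀ v w, B v w = B w v)
    (hpos : ∀ v, v ≠ 0 → 0 < B v v) (hn : finrank ℝ V = 3) (hθ : θ ≠ 0) :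
    ∃ (b : Basis (Fin 3) ℝ V) (η : Fin 3 → ℝ), IsOrientedFrame B θ b η 1 := by
  obtain ⟨b, η, h⟩ := exists_isOrientedFrame (θ := θ) hsymm (fun v hv => by
    by_contra hne; exact (hpos v hne).ne' (hv v)) hn hθ
  have h1 : ∀ i, η i = 1 := by
    intro i
    have h2 := hpos (b i) (b.ne_zero i)
    rw [h.apply_eq, if_pos rfl] at h2
    rcases h.eta_cases i with h3 | h3
    · exact h3
    · rw [h3] at h2; norm_num at h2
  have h2 : η 0 * η 1 * η 2 = 1 := by simp [h1]
  rw [h2] at h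
  exact ⟨b, η, h⟩

theorem nondegenerate_of_lorentzian
    (hsig : ∃ t, B t t < 0 ∧ ∀ v, B t v = 0 → v ≠ 0 → 0 < B v v)
    (v : V) (hv : ∀ w, B v w = 0) (hsymm : ∀ v w, B v w = B w v) : v = 0 := by
  obtain ⟨t, -, ht⟩ := hsig
  by_contra hne
  exact (ht v (by rw [hsymm]; exact hv t) hne).ne' (hv v)

theorem exists_isOrientedFrame_of_lorentzian (hsymm : ∀ v w, B v w = B w v)
    (hsig : ∃ t, B t t < 0 ∧ ∀ v, B t v = 0 → v ≠ 0 → 0 < B v v)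
    (hn : finrank ℝ V = 3) (hθ : θ ≠ 0) :
    ∃ (b : Basis (Fin 3) ℝ V) (η : Fin 3 → ℝ), IsOrientedFrame B θ b η (-1) := by
  obtain ⟨b, η, h⟩ := exists_isOrientedFrame (θ := θ) hsymm
    (fun v hv => nondegenerate_of_lorentzian hsig v hv hsymm) hn hθ
  obtain ⟨t, ht, hpos⟩ := hsig
  have two : ∀ i j, i ≠ j → η i = -1 → η j = -1 → False := by
    intro i j hij hi hj
    by_cases h0 : B t (b i) = 0
    · have := hpos _ h0 (b.ne_zero i)
      rw [h.apply_eq, if_pos rfl, hi] at this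
      norm_num at this
    · set u := B t (b j) • b i - B t (b i) • b j with hu
      have hne : u ≠ 0 := by
        intro hz
        have := congrArg (fun x => b.repr x j) hz
        simp [hu, hij] at this
        exact h0 this
      have h1 := hpos u (by simp [hu]; ring) hne
      have h2 : B u u = -(B t (b j) ^ 2 + B t (b i) ^ 2) := by
        simp [hu, h.apply_eq, hij, hij.symm, hi, hj]; ring
      rw [h2] at h1
      nlinarith [sq_nonneg (B t (b j)), sq_nonneg (B t (b i))]
  have some : ¬ (η 0 = 1 ∧ η 1 = 1 ∧ η 2 = 1) := by
    rintro ⟨h0, h1, h2⟩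
    rw [h.bilin_apply, Fin.sum_univ_three, h0, h1, h2] at ht
    nlinarith [mul_self_nonneg (b.repr t 0), mul_self_nonneg (b.repr t 1),
      mul_self_nonneg (b.repr t 2)]
  have hs : η 0 * η 1 * η 2 = -1 := by
    rcases h.eta_cases 0 with h0 | h0 <;> rcases h.eta_cases 1 with h1 | h1 <;>
    rcases h.eta_cases 2 with h2 | h2
    · exact absurd ⟨h0, h1, h2⟩ some
    · simp [h0, h1, h2]
    · simp [h0, h1, h2]
    · exact (two 1 2 (by decide) h1 h2).elim
    · simp [h0, h1, h2]
    · exact (two 0 2 (by decide) h0 h2).elim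
    · exact (two 0 1 (by decide) h0 h1).elim
    · exact (two 0 1 (by decide) h0 h1).elim
  rw [hs] at h
  exact ⟨b, η, h⟩

end Frames

/-! ### Metric algebra on a product of two three-dimensional spaces -/

section ProductAlgebra

variable {V W : Type*} [AddCommGroup V] [Module ℝ V] [TopologicalSpace V]
  [IsTopologicalAddGroup V] [ContinuousSMul ℝ V] [T2Space V] [FiniteDimensional ℝ V]
  [AddCommGroup W] [Module ℝ W] [TopologicalSpace W]
  [IsTopologicalAddGroup W] [ContinuousSMul ℝ W] [T2Space W] [FiniteDimensional ℝ W]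

/-- The direct sum of two bilinear forms. -/
def prodBilin (B : V →L[ℝ] V →L[ℝ] ℝ) (C : W →L[ℝ] W →L[ℝ] ℝ) :
    (V × W) →L[ℝ] (V × W) →L[ℝ] ℝ :=
  (ContinuousLinearMap.precomp ℝ (ContinuousLinearMap.fst ℝ V W)) ∘L B ∘L
      (ContinuousLinearMap.fst ℝ V W) +
    (ContinuousLinearMap.precomp ℝ (ContinuousLinearMap.snd ℝ V W)) ∘L C ∘L
      (ContinuousLinearMap.snd ℝ V W)

@[simp]
theorem prodBilin_apply (B : V →L[ℝ] V →L[ℝ] ℝ) (C : W →L[ℝ] W →L[ℝ] ℝ) (x y : V × W) :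
    prodBilin B C x y = B x.1 y.1 + C x.2 y.2 := rfl

variable {B : V →L[ℝ] V →L[ℝ] ℝ} {C : W →L[ℝ] W →L[ℝ] ℝ}

theorem prodBilin_signature
    (hB : ∃ t, B t t < 0 ∧ ∀ v, B t v = 0 → v ≠ 0 → 0 < B v v)
    (hC : ∀ w, w ≠ 0 → 0 < C w w) :
    ∃ t, prodBilin B C t t < 0 ∧
      ∀ v, prodBilin B C t v = 0 → v ≠ 0 → 0 < prodBilin B C v v := by
  obtain ⟨t, ht, hpos⟩ := hB
  refine ⟨(t, 0), by simpa using ht, fun ⟨v, w⟩ hv hne => ?_⟩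
  replace hv : B t v = 0 := by simpa using hv
  rw [prodBilin_apply]
  rcases eq_or_ne v 0 with rfl | h1
  · have h2 : w ≠ 0 := fun h2 => hne (by rw [h2]; rfl)
    simpa using hC w h2
  · refine add_pos_of_pos_of_nonneg (hpos v hv h1) ?_
    rcases eq_or_ne w 0 with rfl | h2
    · simp
    · exact (hC w h2).le

theorem IsOrthoFrame.prod {ι κ : Type*} [DecidableEq ι] [DecidableEq κ] {b : Basis ι ℝ V}
    {f : Basis κ ℝ W} {η : ι → ℝ} {ζ : κ → ℝ} (hb : IsOrthoFrame B b η)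
    (hf : IsOrthoFrame C f ζ) :
    IsOrthoFrame (prodBilin B C) (b.prod f) (Sum.elim η ζ) := by
  refine ⟨?_, ?_⟩
  · rintro (i | i) (j | j) <;> simp [hb.apply_eq, hf.apply_eq]
  · rintro (i | i) <;> simp [hb.sq_eq, hf.sq_eq]

theorem IsOrthoFrame.reindex {ι κ : Type*} [DecidableEq ι] [DecidableEq κ] {b : Basis ι ℝ V}
    {η : ι → ℝ} (hb : IsOrthoFrame B b η) (e : ι ≃ κ) :
    IsOrthoFrame B (b.reindex e) (η ∘ e.symm) := by
  refine ⟨fun i j => ?_, fun i => hb.sq_eq _⟩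
  simp [hb.apply_eq]

theorem prodWedge_smul_smul {p q : ℕ} (c d : ℝ) (ρ : V [⋀^Fin p]→L[ℝ] ℝ)
    (σ : W [⋀^Fin q]→L[ℝ] ℝ) : prodWedge (c • ρ) (d • σ) = (c * d) • prodWedge ρ σ := by
  ext v
  rw [ContinuousAlternatingMap.smul_apply, prodWedge_apply, prodWedge_apply, smul_eq_mul]
  simp only [Finset.mul_sum, ContinuousAlternatingMap.smul_apply, smul_eq_mul]
  refine Finset.sum_congr rfl fun τ _ => ?_
  ring

theorem metricVolume_prod {p q : ℕ} {b : Basis (Fin p) ℝ V} {f : Basis (Fin q) ℝ W}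
    {η : Fin p → ℝ} {ζ : Fin q → ℝ} (hb : IsOrthoFrame B b η) (hf : IsOrthoFrame C f ζ)
    (θ : V [⋀^Fin p]→L[ℝ] ℝ) (κ : W [⋀^Fin q]→L[ℝ] ℝ) :
    metricVolume (prodBilin B C) (prodWedge θ κ)
      = prodWedge (metricVolume B θ) (metricVolume C κ) := by
  rw [hb.metricVolume_eq, hf.metricVolume_eq, prodWedge_smul_smul,
    ((hb.prod hf).reindex finSumFinEquiv).metricVolume_eq]
  have : (((b.prod f).reindex finSumFinEquiv : Basis (Fin (p + q)) ℝ (V × W)) :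
      Fin (p + q) → V × W) = Fin.append (fun i => (b i, 0)) (fun j => (0, f j)) := by
    ext j : 1
    induction j using Fin.addCases <;> simp [Basis.prod_apply]
  rw [this, prodWedge_append, abs_mul, mul_inv]

theorem contractForms_three_prod {ι κ : Type*} [Fintype ι] [Fintype κ] [DecidableEq ι]
    [DecidableEq κ] {b : Basis ι ℝ V} {f : Basis κ ℝ W} {η : ι → ℝ} {ζ : κ → ℝ}
    (hb : IsOrthoFrame B b η) (hf : IsOrthoFrame C f ζ) (ρ σ : (V × W) [⋀^Fin 3]→L[ℝ] ℝ) :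
    contractForms (prodBilin B C) ρ σ =
      (∑ i, ∑ j, ∑ k, η i * η j * η k *
        (ρ ![(b i, 0), (b j, 0), (b k, 0)] * σ ![(b i, 0), (b j, 0), (b k, 0)]))
      + 3 * (∑ i, ∑ j, ∑ k, η i * η j * ζ k *
        (ρ ![(b i, 0), (b j, 0), (0, f k)] * σ ![(b i, 0), (b j, 0), (0, f k)]))
      + 3 * (∑ i, ∑ j, ∑ k, η i * ζ j * ζ k *
        (ρ ![(b i, 0), (0, f j), (0, f k)] * σ ![(b i, 0), (0, f j), (0, f k)]))
      + ∑ i, ∑ j, ∑ k, ζ i * ζ j * ζ k *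
        (ρ ![(0, f i), (0, f j), (0, f k)] * σ ![(0, f i), (0, f j), (0, f k)]) := by
  rw [(hb.prod hf).contractForms_three]
  simp only [Fintype.sum_sum_type, Sum.elim_inl, Sum.elim_inr, Basis.prod_apply,
    LinearMap.coe_inl, LinearMap.coe_inr, Finset.sum_add_distrib, Function.comp_apply]
  have s1 : ∀ (φ : (V × W) [⋀^Fin 3]→L[ℝ] ℝ) i j k, φ ![(b i, 0), (0, f k), (b j, 0)]
      = - φ ![(b i, 0), (b j, 0), (0, f k)] := fun φ i j k => form_three_swap φ _ _ _
  have s2 : ∀ (φ : (V × W) [⋀^Fin 3]→L[ℝ] ℝ) i j k, φ ![(0, f k), (b i, 0), (b j, 0)]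
      = φ ![(b i, 0), (b j, 0), (0, f k)] := fun φ i j k => (form_three_cycle φ _ _ _).symm
  have s3 : ∀ (φ : (V × W) [⋀^Fin 3]→L[ℝ] ℝ) i j k, φ ![(0, f j), (0, f k), (b i, 0)]
      = φ ![(b i, 0), (0, f j), (0, f k)] := fun φ i j k => form_three_cycle φ _ _ _
  have s4 : ∀ (φ : (V × W) [⋀^Fin 3]→L[ℝ] ℝ) i j k, φ ![(0, f j), (b i, 0), (0, f k)]
      = - φ ![(b i, 0), (0, f j), (0, f k)] := fun φ i j k => by
    rw [form_three_swap, form_three_cycle]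
  simp only [s1, s2, s3, s4, neg_mul_neg]
  have c1 : ∀ g : ι → κ → ι → ℝ, ∑ i, ∑ k, ∑ j, g i k j = ∑ i, ∑ j, ∑ k, g i k j :=
    fun g => Finset.sum_congr rfl fun i _ => Finset.sum_comm
  have c2 : ∀ g : κ → ι → ι → ℝ, ∑ k, ∑ i, ∑ j, g k i j = ∑ i, ∑ j, ∑ k, g k i j :=
    fun g => by
      rw [Finset.sum_comm]
      exact Finset.sum_congr rfl fun i _ => Finset.sum_comm
  have c3 : ∀ g : κ → ι → κ → ℝ, ∑ j, ∑ i, ∑ k, g j i k = ∑ i, ∑ j, ∑ k, g j i k :=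
    fun g => Finset.sum_comm
  have c4 : ∀ g : κ → κ → ι → ℝ, ∑ j, ∑ k, ∑ i, g j k i = ∑ i, ∑ j, ∑ k, g j k i :=
    fun g => by
      rw [Finset.sum_comm (s := (Finset.univ : Finset ι))]
      exact Finset.sum_congr rfl fun j _ => Finset.sum_comm
  rw [c1, c2, c3, c4]
  have r1 : ∀ i j k, η i * ζ k * η j = η i * η j * ζ k := fun i j k => by ring
  have r2 : ∀ i j k, ζ k * η i * η j = η i * η j * ζ k := fun i j k => by ring
  have r3 : ∀ i j k, ζ j * η i * ζ k = η i * ζ j * ζ k := fun i j k => by ring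
  have r4 : ∀ i j k, ζ j * ζ k * η i = η i * ζ j * ζ k := fun i j k => by ring
  simp only [r1, r2, r3, r4]
  ring

theorem form_three_prod_ext {φ ψ : (V × W) [⋀^Fin 3]→L[ℝ] ℝ}
    (h0 : ∀ x y z : V, φ ![(x, 0), (y, 0), (z, 0)] = ψ ![(x, 0), (y, 0), (z, 0)])
    (h1 : ∀ (x y : V) (z : W), φ ![(x, 0), (y, 0), (0, z)] = ψ ![(x, 0), (y, 0), (0, z)])
    (h2 : ∀ (x : V) (y z : W), φ ![(x, 0), (0, y), (0, z)] = ψ ![(x, 0), (0, y), (0, z)])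
    (h3 : ∀ x y z : W, φ ![(0, x), (0, y), (0, z)] = ψ ![(0, x), (0, y), (0, z)]) : φ = ψ := by
  have : φ.toAlternatingMap = ψ.toAlternatingMap := by
    refine ((finBasis ℝ V).prod (finBasis ℝ W)).ext_alternating fun v _ => ?_
    have e : (fun i => ((finBasis ℝ V).prod (finBasis ℝ W)) (v i))
        = ![((finBasis ℝ V).prod (finBasis ℝ W)) (v 0), ((finBasis ℝ V).prod (finBasis ℝ W)) (v 1),
          ((finBasis ℝ V).prod (finBasis ℝ W)) (v 2)] := by ext a : 1; fin_cases a <;> rfl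
    rw [e]
    change φ _ = ψ _
    have s2 : ∀ (χ : (V × W) [⋀^Fin 3]→L[ℝ] ℝ) x y z, χ ![z, x, y] = χ ![x, y, z] :=
      fun χ x y z => (form_three_cycle χ _ _ _).symm
    have s3 : ∀ (χ : (V × W) [⋀^Fin 3]→L[ℝ] ℝ) x y z, χ ![y, x, z] = - χ ![x, y, z] :=
      fun χ x y z => by rw [s2, form_three_swap]
    rcases v 0 with i | i <;> rcases v 1 with j | j <;> rcases v 2 with k | k <;>
      simp only [Basis.prod_apply, LinearMap.coe_inl, LinearMap.coe_inr, Sum.elim_inl,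
        Sum.elim_inr, Function.comp_apply]
    · exact h0 _ _ _
    · exact h1 _ _ _
    · rw [form_three_swap, h1, form_three_swap ψ (_, 0) (_, 0)]
    · exact h2 _ _ _
    · exact (s2 φ _ _ _).trans ((h1 _ _ _).trans (s2 ψ _ _ _).symm)
    · rw [s3, h2, s3 ψ (_, 0)]
    · exact (form_three_cycle φ _ _ _).trans ((h2 _ _ _).trans (form_three_cycle ψ _ _ _).symm)
    · exact h3 _ _ _
  ext v
  exact congrArg (fun f : (V × W) [⋀^Fin 3]→ₗ[ℝ] ℝ => f v) this

end ProductAlgebra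

/-! ### The pointwise flux three-form -/

section FluxAlgebra

variable {V W : Type*} [AddCommGroup V] [Module ℝ V] [TopologicalSpace V]
  [AddCommGroup W] [Module ℝ W] [TopologicalSpace W]

theorem prodWedge_two_one_apply (A : V [⋀^Fin 2]→L[ℝ] ℝ) (β : W [⋀^Fin 1]→L[ℝ] ℝ)
    (x y : V) (z : W) : prodWedge A β ![(x, 0), (y, 0), (0, z)] = A ![x, y] * β ![z] := by
  rw [← prodWedge_append]
  congr 1; ext a : 1; fin_cases a <;> rfl

theorem prodWedge_one_two_apply (α : V [⋀^Fin 1]→L[ℝ] ℝ) (A : W [⋀^Fin 2]→L[ℝ] ℝ)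
    (x : V) (y z : W) : prodWedge α A ![(x, 0), (0, y), (0, z)] = α ![x] * A ![y, z] := by
  rw [← prodWedge_append]
  congr 1; ext a : 1; fin_cases a <;> rfl

/-- The three-form `λ ν + l A ∧ β + l α ∧ A' + λ ν'` on a product. -/
def fluxForm (ν : V [⋀^Fin 3]→L[ℝ] ℝ) (α : V [⋀^Fin 1]→L[ℝ] ℝ) (A : V [⋀^Fin 2]→L[ℝ] ℝ)
    (ν' : W [⋀^Fin 3]→L[ℝ] ℝ) (β : W [⋀^Fin 1]→L[ℝ] ℝ) (A' : W [⋀^Fin 2]→L[ℝ] ℝ)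
    (lam l : ℝ) : (V × W) [⋀^Fin 3]→L[ℝ] ℝ :=
  lam • ν.compContinuousLinearMap (ContinuousLinearMap.fst ℝ V W) + l • prodWedge A β
    + l • prodWedge α A' + lam • ν'.compContinuousLinearMap (ContinuousLinearMap.snd ℝ V W)

variable (ν : V [⋀^Fin 3]→L[ℝ] ℝ) (α : V [⋀^Fin 1]→L[ℝ] ℝ) (A : V [⋀^Fin 2]→L[ℝ] ℝ)
    (ν' : W [⋀^Fin 3]→L[ℝ] ℝ) (β : W [⋀^Fin 1]→L[ℝ] ℝ) (A' : W [⋀^Fin 2]→L[ℝ] ℝ)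
    (lam l : ℝ)

theorem fluxForm_apply (t : Fin 3 → V × W) :
    fluxForm ν α A ν' β A' lam l t = lam * ν (fun i => (t i).1) + l * prodWedge A β t
      + l * prodWedge α A' t + lam * ν' (fun i => (t i).2) := rfl

theorem fluxForm_fst_fst_fst (x y z : V) :
    fluxForm ν α A ν' β A' lam l ![(x, 0), (y, 0), (z, 0)] = lam * ν ![x, y, z] := by
  rw [fluxForm_apply]
  have e1 : prodWedge A β ![(x, 0), (y, 0), (z, 0)] = 0 :=
    prodWedge_eq_zero_of_snd _ _ _ Finset.univ (by simp) (by intro i _; fin_cases i <;> rfl)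
  have e2 : prodWedge α A' ![(x, 0), (y, 0), (z, 0)] = 0 :=
    prodWedge_eq_zero_of_snd _ _ _ Finset.univ (by simp) (by intro i _; fin_cases i <;> rfl)
  have e3 : ν' (fun i => ((![(x, 0), (y, 0), (z, 0)] : Fin 3 → V × W) i).2) = 0 :=
    ν'.toMultilinearMap.map_coord_zero 0 rfl
  have e4 : (fun i => ((![(x, 0), (y, 0), (z, 0)] : Fin 3 → V × W) i).1) = ![x, y, z] := by
    ext a : 1; fin_cases a <;> rfl
  rw [e1, e2, e3, e4]; ring

theorem fluxForm_fst_fst_snd (x y : V) (z : W) :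
    fluxForm ν α A ν' β A' lam l ![(x, 0), (y, 0), (0, z)] = l * (A ![x, y] * β ![z]) := by
  rw [fluxForm_apply]
  have e2 : prodWedge α A' ![(x, 0), (y, 0), (0, z)] = 0 :=
    prodWedge_eq_zero_of_snd _ _ _ {0, 1} (by decide) (by intro i hi; fin_cases hi <;> rfl)
  have e3 : ν' (fun i => ((![(x, 0), (y, 0), (0, z)] : Fin 3 → V × W) i).2) = 0 :=
    ν'.toMultilinearMap.map_coord_zero 0 rfl
  have e4 : ν (fun i => ((![(x, 0), (y, 0), (0, z)] : Fin 3 → V × W) i).1) = 0 :=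
    ν.toMultilinearMap.map_coord_zero 2 rfl
  rw [prodWedge_two_one_apply, e2, e3, e4]; ring

theorem fluxForm_fst_snd_snd (x : V) (y z : W) :
    fluxForm ν α A ν' β A' lam l ![(x, 0), (0, y), (0, z)] = l * (α ![x] * A' ![y, z]) := by
  rw [fluxForm_apply]
  have e2 : prodWedge A β ![(x, 0), (0, y), (0, z)] = 0 :=
    prodWedge_eq_zero_of_fst _ _ _ {1, 2} (by decide) (by intro i hi; fin_cases hi <;> rfl)
  have e3 : ν' (fun i => ((![(x, 0), (0, y), (0, z)] : Fin 3 → V × W) i).2) = 0 :=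
    ν'.toMultilinearMap.map_coord_zero 0 rfl
  have e4 : ν (fun i => ((![(x, 0), (0, y), (0, z)] : Fin 3 → V × W) i).1) = 0 :=
    ν.toMultilinearMap.map_coord_zero 2 rfl
  rw [prodWedge_one_two_apply, e2, e3, e4]; ring

theorem fluxForm_snd_snd_snd (x y z : W) :
    fluxForm ν α A ν' β A' lam l ![(0, x), (0, y), (0, z)] = lam * ν' ![x, y, z] := by
  rw [fluxForm_apply]
  have e1 : prodWedge A β ![(0, x), (0, y), (0, z)] = 0 :=
    prodWedge_eq_zero_of_fst _ _ _ Finset.univ (by simp) (by intro i _; fin_cases i <;> rfl)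
  have e2 : prodWedge α A' ![(0, x), (0, y), (0, z)] = 0 :=
    prodWedge_eq_zero_of_fst _ _ _ Finset.univ (by simp) (by intro i _; fin_cases i <;> rfl)
  have e3 : ν (fun i => ((![(0, x), (0, y), (0, z)] : Fin 3 → V × W) i).1) = 0 :=
    ν.toMultilinearMap.map_coord_zero 0 rfl
  have e4 : (fun i => ((![(0, x), (0, y), (0, z)] : Fin 3 → V × W) i).2) = ![x, y, z] := by
    ext a : 1; fin_cases a <;> rfl
  rw [e1, e2, e3, e4]; ring

/-! Values of `ν ∧ ν'`. -/

/-- The exterior product of three-forms on the two factors, as a six-form. -/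
def wedgeThreeThree : (V × W) [⋀^Fin 6]→L[ℝ] ℝ := prodWedge ν ν'

theorem wedgeThreeThree_apply (x y z : V) (u v w : W) :
    wedgeThreeThree ν ν' ![(x, 0), (y, 0), (z, 0), (0, u), (0, v), (0, w)]
      = ν ![x, y, z] * ν' ![u, v, w] := by
  rw [← prodWedge_append]
  change prodWedge ν ν' _ = _
  congr 1; ext a : 1; fin_cases a <;> rfl

theorem form_six_exchange (Φ : V [⋀^Fin 6]→L[ℝ] ℝ) (x y z u v w : V) :
    Φ ![u, v, w, x, y, z] = - Φ ![x, y, z, u, v, w] := by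
  have h := continuousAlternatingMap_comp_perm Φ ![x, y, z, u, v, w]
    (Equiv.swap (0 : Fin 6) 3 * Equiv.swap (1 : Fin 6) 4 * Equiv.swap (2 : Fin 6) 5)
  have e : ![x, y, z, u, v, w] ∘
      (Equiv.swap (0 : Fin 6) 3 * Equiv.swap (1 : Fin 6) 4 * Equiv.swap (2 : Fin 6) 5 :
        Equiv.Perm (Fin 6)) = ![u, v, w, x, y, z] := by
    ext a : 1; fin_cases a <;> rfl
  rw [← e]
  refine h.trans ?_
  rw [Equiv.Perm.sign_mul, Equiv.Perm.sign_mul, Equiv.Perm.sign_swap (by decide),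
    Equiv.Perm.sign_swap (by decide), Equiv.Perm.sign_swap (by decide)]
  simp

theorem form_six_swap (Φ : V [⋀^Fin 6]→L[ℝ] ℝ) (x y z u v w : V) :
    Φ ![x, y, u, z, v, w] = - Φ ![x, y, z, u, v, w] := by
  have h := continuousAlternatingMap_comp_perm Φ ![x, y, z, u, v, w] (Equiv.swap (2 : Fin 6) 3)
  have e : ![x, y, z, u, v, w] ∘ Equiv.swap (2 : Fin 6) 3 = ![x, y, u, z, v, w] := by
    ext a : 1; fin_cases a <;> rfl
  rw [← e]
  refine h.trans ?_
  rw [Equiv.Perm.sign_swap (by decide)]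
  simp

theorem form_six_swap_swap (Φ : V [⋀^Fin 6]→L[ℝ] ℝ) (x y z u v w : V) :
    Φ ![x, u, v, y, z, w] = Φ ![x, y, z, u, v, w] := by
  have h := continuousAlternatingMap_comp_perm Φ ![x, y, z, u, v, w]
    (Equiv.swap (1 : Fin 6) 3 * Equiv.swap (2 : Fin 6) 4)
  have e : ![x, y, z, u, v, w] ∘
      (Equiv.swap (1 : Fin 6) 3 * Equiv.swap (2 : Fin 6) 4 : Equiv.Perm (Fin 6))
      = ![x, u, v, y, z, w] := by
    ext a : 1; fin_cases a <;> rfl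
  rw [← e]
  refine h.trans ?_
  rw [Equiv.Perm.sign_mul, Equiv.Perm.sign_swap (by decide), Equiv.Perm.sign_swap (by decide)]
  simp

theorem wedgeThreeThree_apply_two_one (x y z : V) (u v w : W) :
    wedgeThreeThree ν ν' ![(x, 0), (y, 0), (0, u), (z, 0), (0, v), (0, w)]
      = - (ν ![x, y, z] * ν' ![u, v, w]) :=
  (form_six_swap (wedgeThreeThree ν ν') (x, 0) (y, 0) (z, 0) (0, u) (0, v) (0, w)).trans
    (congrArg Neg.neg (wedgeThreeThree_apply ν ν' x y z u v w))

theorem wedgeThreeThree_apply_one_two (x y z : V) (u v w : W) :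
    wedgeThreeThree ν ν' ![(x, 0), (0, u), (0, v), (y, 0), (z, 0), (0, w)]
      = ν ![x, y, z] * ν' ![u, v, w] :=
  (form_six_swap_swap (wedgeThreeThree ν ν') (x, 0) (y, 0) (z, 0) (0, u) (0, v) (0, w)).trans
    (wedgeThreeThree_apply ν ν' x y z u v w)

theorem wedgeThreeThree_apply_zero_three (x y z : V) (u v w : W) :
    wedgeThreeThree ν ν' ![(0, u), (0, v), (0, w), (x, 0), (y, 0), (z, 0)]
      = - (ν ![x, y, z] * ν' ![u, v, w]) :=
  (form_six_exchange (wedgeThreeThree ν ν') (x, 0) (y, 0) (z, 0) (0, u) (0, v) (0, w)).trans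
    (congrArg Neg.neg (wedgeThreeThree_apply ν ν' x y z u v w))

theorem insertFirst_three_apply (Φ : V [⋀^Fin 6]→L[ℝ] ℝ) (x y z u v w : V) :
    (insertFirst (k := 3) (m := 3) ![x, y, z] Φ) ![u, v, w] = Φ ![x, y, z, u, v, w] := by
  change Φ _ = _
  congr 1; ext a : 1; fin_cases a <;> rfl

theorem interior₃_apply (x y z : V) (Φ : V [⋀^Fin 3]→L[ℝ] ℝ) :
    interior₃ x Φ ![y, z] = Φ ![x, y, z] := by
  change Φ _ = _
  congr 1; ext a : 1; fin_cases a <;> rfl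

end FluxAlgebra

/-! ### Norm, square and Hodge dual of the flux three-form -/

section FluxMetric

variable {V W : Type*} [AddCommGroup V] [Module ℝ V] [TopologicalSpace V]
  [IsTopologicalAddGroup V] [ContinuousSMul ℝ V] [T2Space V] [FiniteDimensional ℝ V]
  [AddCommGroup W] [Module ℝ W] [TopologicalSpace W]
  [IsTopologicalAddGroup W] [ContinuousSMul ℝ W] [T2Space W] [FiniteDimensional ℝ W]
  {B : V →L[ℝ] V →L[ℝ] ℝ} {C : W →L[ℝ] W →L[ℝ] ℝ}
  {θ : V [⋀^Fin 3]→L[ℝ] ℝ} {κ : W [⋀^Fin 3]→L[ℝ] ℝ}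
  {b : Basis (Fin 3) ℝ V} {f : Basis (Fin 3) ℝ W} {η ζ : Fin 3 → ℝ}

/-- The flux three-form with the metric volume forms and Hodge duals inserted. -/
def metricFlux (B : V →L[ℝ] V →L[ℝ] ℝ) (θ : V [⋀^Fin 3]→L[ℝ] ℝ) (α : V [⋀^Fin 1]→L[ℝ] ℝ)
    (C : W →L[ℝ] W →L[ℝ] ℝ) (κ : W [⋀^Fin 3]→L[ℝ] ℝ) (β : W [⋀^Fin 1]→L[ℝ] ℝ) (lam l : ℝ) :
    (V × W) [⋀^Fin 3]→L[ℝ] ℝ :=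
  fluxForm (metricVolume B θ) α (hodge 1 2 B θ α) (metricVolume C κ) β (hodge 1 2 C κ β) lam l

variable (hb : IsOrientedFrame B θ b η (-1)) (hf : IsOrientedFrame C κ f ζ 1)
  (α : V [⋀^Fin 1]→L[ℝ] ℝ) (β : W [⋀^Fin 1]→L[ℝ] ℝ) (lam l : ℝ)

include hb hf

theorem contractForms_metricFlux :
    contractForms (prodBilin B C) (metricFlux B θ α C κ β lam l)
      (metricFlux B θ α C κ β lam l) = 0 := by
  rw [contractForms_three_prod hb.toIsOrthoFrame hf.toIsOrthoFrame]
  simp only [metricFlux, fluxForm_fst_fst_fst, fluxForm_fst_fst_snd, fluxForm_fst_snd_snd,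
    fluxForm_snd_snd_snd]
  have e1 := hb.sum_volume_sq
  have e2 := hf.sum_volume_sq
  have e3 := hb.sum_hodge_hodge α
  have e4 := hf.sum_hodge_hodge β
  have e5 := hb.contractForms_one α α
  have e6 := hf.contractForms_one β β
  rw [e5] at e3
  rw [e6] at e4
  simp only [Fin.sum_univ_three] at e1 e2 e3 e4 ⊢
  linear_combination lam ^ 2 * e1 + lam ^ 2 * e2
    + 3 * l ^ 2 * (ζ 0 * (β ![f 0] * β ![f 0]) + ζ 1 * (β ![f 1] * β ![f 1])
      + ζ 2 * (β ![f 2] * β ![f 2])) * e3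
    + 3 * l ^ 2 * (η 0 * (α ![b 0] * α ![b 0]) + η 1 * (α ![b 1] * α ![b 1])
      + η 2 * (α ![b 2] * α ![b 2])) * e4

theorem contractForms_interior_metricFlux (x y : V × W) :
    contractForms (prodBilin B C) (interior₃ x (metricFlux B θ α C κ β lam l))
      (interior₃ y (metricFlux B θ α C κ β lam l))
      = -(2 * lam ^ 2) * B x.1 y.1 + 2 * lam ^ 2 * C x.2 y.2
        - 2 * l ^ 2 * contractForms C β β *
          (contractForms B α α * B x.1 y.1 - 2 * (α ![x.1] * α ![y.1]))
        + 2 * l ^ 2 * contractForms B α α *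
          (contractForms C β β * C x.2 y.2 - 2 * (β ![x.2] * β ![y.2])) := by
  set H := metricFlux B θ α C κ β lam l with hH
  have key : ∀ (z : V × W) p q, H ![z, p, q] = H ![(z.1, 0), p, q] + H ![(0, z.2), p, q] := by
    intro z p q
    rw [← form_three_add]; simp
  have s2 : ∀ p q r, H ![r, p, q] = H ![p, q, r] := fun p q r => (form_three_cycle H _ _ _).symm
  have s3 : ∀ p q r, H ![q, p, r] = - H ![p, q, r] := fun p q r => by
    rw [s2, form_three_swap]
  have k1 : ∀ (z : V × W) p q, H ![z, (p, 0), (q, 0)] = lam * metricVolume B θ ![z.1, p, q]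
      + l * (hodge 1 2 B θ α ![p, q] * β ![z.2]) := by
    intro z p q
    rw [key, s2 (p, 0) (q, 0) (0, z.2), hH, metricFlux, fluxForm_fst_fst_fst, fluxForm_fst_fst_snd]
  have k2 : ∀ (z : V × W) p q, H ![z, (p, 0), (0, q)] = l * (hodge 1 2 B θ α ![z.1, p] * β ![q])
      - l * (α ![p] * hodge 1 2 C κ β ![z.2, q]) := by
    intro z p q
    rw [key, s3 (p, 0) (0, z.2) (0, q), hH, metricFlux, fluxForm_fst_fst_snd,
      fluxForm_fst_snd_snd]
    ring
  have k3 : ∀ (z : V × W) p q, H ![z, (0, p), (0, q)] = l * (α ![z.1] * hodge 1 2 C κ β ![p, q])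
      + lam * metricVolume C κ ![z.2, p, q] := by
    intro z p q
    rw [key, hH, metricFlux, fluxForm_fst_snd_snd, fluxForm_snd_snd_snd]
  have k4 : ∀ (z : V × W) p q, H ![z, (0, q), (p, 0)] = - H ![z, (p, 0), (0, q)] :=
    fun z p q => form_three_swap H _ _ _
  rw [(hb.toIsOrthoFrame.prod hf.toIsOrthoFrame).contractForms_two]
  simp only [Fintype.sum_sum_type, Sum.elim_inl, Sum.elim_inr, Basis.prod_apply,
    LinearMap.coe_inl, LinearMap.coe_inr, Finset.sum_add_distrib, Function.comp_apply,
    interior₃_apply, k4, k1, k2, k3, neg_mul_neg]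
  have e1 := hb.sum_volume_volume x.1 y.1
  have e2 := hf.sum_volume_volume x.2 y.2
  have e3 := hb.sum_volume_hodge α x.1
  have e4 := hb.sum_volume_hodge α y.1
  have e5 := hf.sum_volume_hodge β x.2
  have e6 := hf.sum_volume_hodge β y.2
  have e7 := hb.sum_hodge_hodge α
  have e8 := hf.sum_hodge_hodge β
  have e9 := hb.sum_hodge_apply_hodge_apply α x.1 y.1
  have e10 := hf.sum_hodge_apply_hodge_apply β x.2 y.2
  have e11 := hb.sum_hodge_apply_mul α x.1
  have e12 := hb.sum_hodge_apply_mul α y.1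
  have e13 := hb.contractForms_one α α
  have e14 := hf.contractForms_one β β
  have p1 : ∑ i, ∑ j, η i * η j *
      ((lam * metricVolume B θ ![x.1, b i, b j] + l * (hodge 1 2 B θ α ![b i, b j] * β ![x.2])) *
      (lam * metricVolume B θ ![y.1, b i, b j] + l * (hodge 1 2 B θ α ![b i, b j] * β ![y.2])))
      = lam ^ 2 * (2 * -1 * B x.1 y.1) + lam * l * β ![y.2] * (2 * -1 * α ![x.1])
        + lam * l * β ![x.2] * (2 * -1 * α ![y.1])
        + l ^ 2 * (β ![x.2] * β ![y.2]) * (2 * -1 * contractForms B α α) := by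
    simp only [Fin.sum_univ_three] at e1 e3 e4 e7 ⊢
    linear_combination lam ^ 2 * e1 + lam * l * β ![y.2] * e3 + lam * l * β ![x.2] * e4
      + l ^ 2 * (β ![x.2] * β ![y.2]) * e7
  have p2 : ∑ i, ∑ j, η i * ζ j *
      ((l * (hodge 1 2 B θ α ![x.1, b i] * β ![f j]) -
        l * (α ![b i] * hodge 1 2 C κ β ![x.2, f j])) *
      (l * (hodge 1 2 B θ α ![y.1, b i] * β ![f j]) -
        l * (α ![b i] * hodge 1 2 C κ β ![y.2, f j])))
      = l ^ 2 * contractForms C β β *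
          (-1 * (contractForms B α α * B x.1 y.1 - α ![x.1] * α ![y.1]))
        + l ^ 2 * contractForms B α α *
          (1 * (contractForms C β β * C x.2 y.2 - β ![x.2] * β ![y.2])) := by
    rw [← e9, ← e10, e13, e14]
    simp only [Fin.sum_univ_three] at e11 e12 ⊢
    linear_combination (-l ^ 2 * (ζ 0 * (β ![f 0] * hodge 1 2 C κ β ![y.2, f 0])
        + ζ 1 * (β ![f 1] * hodge 1 2 C κ β ![y.2, f 1])
        + ζ 2 * (β ![f 2] * hodge 1 2 C κ β ![y.2, f 2]))) * e11
      + (-l ^ 2 * (ζ 0 * (β ![f 0] * hodge 1 2 C κ β ![x.2, f 0])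
        + ζ 1 * (β ![f 1] * hodge 1 2 C κ β ![x.2, f 1])
        + ζ 2 * (β ![f 2] * hodge 1 2 C κ β ![x.2, f 2]))) * e12
  have p3 : ∑ i, ∑ j, ζ i * ζ j *
      ((l * (α ![x.1] * hodge 1 2 C κ β ![f i, f j]) + lam * metricVolume C κ ![x.2, f i, f j]) *
      (l * (α ![y.1] * hodge 1 2 C κ β ![f i, f j]) + lam * metricVolume C κ ![y.2, f i, f j]))
      = lam ^ 2 * (2 * 1 * C x.2 y.2) + lam * l * α ![y.1] * (2 * 1 * β ![x.2])
        + lam * l * α ![x.1] * (2 * 1 * β ![y.2])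
        + l ^ 2 * (α ![x.1] * α ![y.1]) * (2 * 1 * contractForms C β β) := by
    simp only [Fin.sum_univ_three] at e2 e5 e6 e8 ⊢
    linear_combination lam ^ 2 * e2 + lam * l * α ![y.1] * e5 + lam * l * α ![x.1] * e6
      + l ^ 2 * (α ![x.1] * α ![y.1]) * e8
  have r : ∀ i j, ζ j * η i = η i * ζ j := fun i j => mul_comm _ _
  rw [Finset.sum_comm (s := Finset.univ) (t := Finset.univ)
    (f := fun i j => ζ i * η j * _)]
  simp only [r]
  rw [p1, p2, p3]
  ring

theorem hodge_metricFlux :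
    hodge 3 3 (prodBilin B C) (wedgeThreeThree θ κ) (metricFlux B θ α C κ β lam l)
      = metricFlux B θ α C κ β (-lam) l := by
  set H := metricFlux B θ α C κ β lam l with hH
  set ν := metricVolume B θ with hν
  set ν' := metricVolume C κ with hν'
  have hvol : metricVolume (prodBilin B C) (wedgeThreeThree θ κ) = wedgeThreeThree ν ν' :=
    metricVolume_prod hb.toIsOrthoFrame hf.toIsOrthoFrame θ κ
  have key : ∀ x y z : V × W, hodge 3 3 (prodBilin B C) (wedgeThreeThree θ κ) H ![x, y, z]
      = -(1 / 6) * contractForms (prodBilin B C) H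
        (insertFirst (k := 3) (m := 3) ![x, y, z] (wedgeThreeThree ν ν')) := by
    intro x y z
    rw [(hb.toIsOrthoFrame.prod hf.toIsOrthoFrame).hodge_three_three,
      (hb.toIsOrthoFrame.prod hf.toIsOrthoFrame).contractForms_three]
    simp only [insertFirst_three_apply]
    rw [neg_mul, ← mul_neg, ← Finset.sum_neg_distrib]
    congr 1
    refine Finset.sum_congr rfl fun i _ => ?_
    rw [← Finset.sum_neg_distrib]
    refine Finset.sum_congr rfl fun j _ => ?_
    rw [← Finset.sum_neg_distrib]
    refine Finset.sum_congr rfl fun k _ => ?_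
    rw [hvol]
    have := form_six_exchange (wedgeThreeThree ν ν') x y z
      ((b.prod f) i) ((b.prod f) j) ((b.prod f) k)
    rw [this]; ring
  have zN : ∀ (t : Fin 6 → V × W) (S : Finset (Fin 6)), 3 < S.card → (∀ i ∈ S, (t i).2 = 0) →
      wedgeThreeThree ν ν' t = 0 := fun t S => prodWedge_eq_zero_of_snd ν ν' t S
  have zX : ∀ (t : Fin 6 → V × W) (S : Finset (Fin 6)), 3 < S.card → (∀ i ∈ S, (t i).1 = 0) →
      wedgeThreeThree ν ν' t = 0 := fun t S => prodWedge_eq_zero_of_fst ν ν' t S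
  have key2 := fun x y z => (key x y z).trans (congrArg (fun t => -(1 / 6) * t)
    (contractForms_three_prod hb.toIsOrthoFrame hf.toIsOrthoFrame H _))
  simp only [insertFirst_three_apply] at key2
  simp only [hH, metricFlux, fluxForm_fst_fst_fst, fluxForm_fst_fst_snd, fluxForm_fst_snd_snd,
    fluxForm_snd_snd_snd, ← hν, ← hν'] at key2
  refine form_three_prod_ext (fun x y z => ?_) (fun x y z => ?_) (fun x y z => ?_)
    (fun x y z => ?_)
  · have z1 : ∀ p q r, wedgeThreeThree ν ν' ![(x, 0), (y, 0), (z, 0), (p, 0), (q, 0), (r, 0)] = 0 :=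
      fun p q r => zN _ {0, 1, 2, 3} (by decide) (by intro i hi; fin_cases hi <;> rfl)
    have z2 : ∀ p q r, wedgeThreeThree ν ν' ![(x, 0), (y, 0), (z, 0), (p, 0), (q, 0), (0, r)] = 0 :=
      fun p q r => zN _ {0, 1, 2, 3} (by decide) (by intro i hi; fin_cases hi <;> rfl)
    have z3 : ∀ p q r, wedgeThreeThree ν ν' ![(x, 0), (y, 0), (z, 0), (p, 0), (0, q), (0, r)] = 0 :=
      fun p q r => zN _ {0, 1, 2, 3} (by decide) (by intro i hi; fin_cases hi <;> rfl)
    refine (key2 _ _ _).trans ?_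
    rw [metricFlux, fluxForm_fst_fst_fst]
    simp only [z1, z2, z3, mul_zero, Finset.sum_const_zero, wedgeThreeThree_apply]
    have e := hf.sum_volume_sq
    simp only [Fin.sum_univ_three, ← hν, ← hν'] at e ⊢
    linear_combination (-(1 / 6) * lam * ν ![x, y, z]) * e
  · have z1 : ∀ p q r, wedgeThreeThree ν ν' ![(x, 0), (y, 0), (0, z), (p, 0), (q, 0), (r, 0)] = 0 :=
      fun p q r => zN _ {0, 1, 3, 4} (by decide) (by intro i hi; fin_cases hi <;> rfl)
    have z2 : ∀ p q r, wedgeThreeThree ν ν' ![(x, 0), (y, 0), (0, z), (p, 0), (q, 0), (0, r)] = 0 :=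
      fun p q r => zN _ {0, 1, 3, 4} (by decide) (by intro i hi; fin_cases hi <;> rfl)
    have z3 : ∀ p q r, wedgeThreeThree ν ν' ![(x, 0), (y, 0), (0, z), (0, p), (0, q), (0, r)] = 0 :=
      fun p q r => zX _ {2, 3, 4, 5} (by decide) (by intro i hi; fin_cases hi <;> rfl)
    refine (key2 _ _ _).trans ?_
    rw [metricFlux, fluxForm_fst_fst_snd]
    simp only [z1, z2, z3, mul_zero, Finset.sum_const_zero, wedgeThreeThree_apply_two_one]
    have e := hf.sum_volume_hodge β z
    have e' := hb.hodge_one_two θ α x y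
    have c : ∀ p, ν ![x, y, p] = ν ![p, x, y] := fun p => form_three_cycle ν _ _ _
    rw [e']
    simp only [Fin.sum_univ_three, ← hν, ← hν', c] at e ⊢
    linear_combination (1 / 2 * l * (η 0 * (α ![b 0] * ν ![b 0, x, y])
      + η 1 * (α ![b 1] * ν ![b 1, x, y]) + η 2 * (α ![b 2] * ν ![b 2, x, y]))) * e
  · have z1 : ∀ p q r, wedgeThreeThree ν ν' ![(x, 0), (0, y), (0, z), (p, 0), (q, 0), (r, 0)] = 0 :=
      fun p q r => zN _ {0, 3, 4, 5} (by decide) (by intro i hi; fin_cases hi <;> rfl)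
    have z2 : ∀ p q r, wedgeThreeThree ν ν' ![(x, 0), (0, y), (0, z), (p, 0), (0, q), (0, r)] = 0 :=
      fun p q r => zX _ {1, 2, 4, 5} (by decide) (by intro i hi; fin_cases hi <;> rfl)
    have z3 : ∀ p q r, wedgeThreeThree ν ν' ![(x, 0), (0, y), (0, z), (0, p), (0, q), (0, r)] = 0 :=
      fun p q r => zX _ {1, 2, 4, 5} (by decide) (by intro i hi; fin_cases hi <;> rfl)
    refine (key2 _ _ _).trans ?_
    rw [metricFlux, fluxForm_fst_snd_snd]
    simp only [z1, z2, z3, mul_zero, Finset.sum_const_zero, wedgeThreeThree_apply_one_two]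
    have e := hb.sum_volume_hodge α x
    have e' := hf.hodge_one_two κ β y z
    have c : ∀ p, ν' ![y, z, p] = ν' ![p, y, z] := fun p => form_three_cycle ν' _ _ _
    rw [e']
    simp only [Fin.sum_univ_three, ← hν, ← hν', c] at e ⊢
    linear_combination (-1 / 2 * l * (ζ 0 * (β ![f 0] * ν' ![f 0, y, z])
      + ζ 1 * (β ![f 1] * ν' ![f 1, y, z]) + ζ 2 * (β ![f 2] * ν' ![f 2, y, z]))) * e
  · have z1 : ∀ p q r, wedgeThreeThree ν ν' ![(0, x), (0, y), (0, z), (p, 0), (q, 0), (0, r)] = 0 :=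
      fun p q r => zX _ {0, 1, 2, 5} (by decide) (by intro i hi; fin_cases hi <;> rfl)
    have z2 : ∀ p q r, wedgeThreeThree ν ν' ![(0, x), (0, y), (0, z), (p, 0), (0, q), (0, r)] = 0 :=
      fun p q r => zX _ {0, 1, 2, 5} (by decide) (by intro i hi; fin_cases hi <;> rfl)
    have z3 : ∀ p q r, wedgeThreeThree ν ν' ![(0, x), (0, y), (0, z), (0, p), (0, q), (0, r)] = 0 :=
      fun p q r => zX _ {0, 1, 2, 5} (by decide) (by intro i hi; fin_cases hi <;> rfl)
    refine (key2 _ _ _).trans ?_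
    rw [metricFlux, fluxForm_snd_snd_snd]
    simp only [z1, z2, z3, mul_zero, Finset.sum_const_zero, wedgeThreeThree_apply_zero_three]
    have e := hb.sum_volume_sq
    simp only [Fin.sum_univ_three, ← hν, ← hν'] at e ⊢
    linear_combination ((1 / 6) * lam * ν' ![x, y, z]) * e

end FluxMetric

/-! ### The Ricci tensor of a product metric in coordinates -/

section ProductCurvature

variable {E : Type*} [NormedAddCommGroup E] [NormedSpace ℝ E]
  {E' : Type*} [NormedAddCommGroup E'] [NormedSpace ℝ E']

theorem christoffelLower_apply (g : E → E →L[ℝ] E →L[ℝ] ℝ) (z u v w : E) :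
    christoffelLower g z u v w
      = 1 / 2 * (fderiv ℝ g z u v w + fderiv ℝ g z v u w - fderiv ℝ g z w u v) := by
  simp [christoffelLower]

theorem christoffel_apply (g : E → E →L[ℝ] E →L[ℝ] ℝ) (z u v : E) :
    christoffel g z u v = (g z).inverse (christoffelLower g z u v) := by
  simp [christoffel]

theorem Filter.EventuallyEq.christoffel {g g' : E → E →L[ℝ] E →L[ℝ] ℝ} {p : E}
    (h : g =ᶠ[𝓝 p] g') : christoffel g =ᶠ[𝓝 p] christoffel g' := by
  filter_upwards [h, h.fderiv (𝕜 := ℝ)] with z h1 h2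
  ext u v : 2
  rw [christoffel_apply, christoffel_apply, h1]
  congr 1
  ext w
  rw [christoffelLower_apply, christoffelLower_apply, h2]

theorem Filter.EventuallyEq.ricciCoord_eq {g g' : E → E →L[ℝ] E →L[ℝ] ℝ} {p : E}
    (h : g =ᶠ[𝓝 p] g') (v w : E) : ricciCoord g p v w = ricciCoord g' p v w := by
  unfold ricciCoord
  congr 1
  ext u
  change riemannCoord g p u v w = riemannCoord g' p u v w
  have h1 := h.christoffel
  rw [riemannCoord, riemannCoord, h1.fderiv_eq, h1.self_of_nhds]

theorem contDiffAt_christoffel [CompleteSpace E] {g : E → E →L[ℝ] E →L[ℝ] ℝ} {p : E}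
    (hg : ContDiffAt ℝ ∞ g p) (hi : (g p).IsInvertible) :
    ContDiffAt ℝ ∞ (christoffel g) p := by
  have h1 : ContDiffAt ℝ ∞ (fun z => (g z).inverse) p :=
    (ContinuousLinearMap.IsInvertible.contDiffAt_map_inverse hi).comp p hg
  have h2 : ContDiffAt ℝ ∞ (fderiv ℝ g) p := hg.fderiv_right (by simp)
  have h3 : ContDiffAt ℝ ∞ (fun z => (fderiv ℝ g z).flip) p :=
    (ContinuousLinearMap.flipₗᵢ ℝ E E (E →L[ℝ] ℝ)).toContinuousLinearEquiv.contDiff.contDiffAt.comp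
      p h2
  have h4 : ContDiffAt ℝ ∞ (christoffelLower g) p := by
    unfold christoffelLower
    exact ContDiffAt.const_smul (1 / 2 : ℝ) ((h2.add h3).sub (contDiffAt_const.clm_comp h3))
  exact ((ContinuousLinearMap.contDiff _).contDiffAt.comp p h1).clm_comp h4

variable [FiniteDimensional ℝ E] [FiniteDimensional ℝ E']

theorem fderiv_linear_prod {A A' P : Type*} [NormedAddCommGroup A] [NormedSpace ℝ A]
    [NormedAddCommGroup A'] [NormedSpace ℝ A'] [NormedAddCommGroup P] [NormedSpace ℝ P]
    [FiniteDimensional ℝ A] [FiniteDimensional ℝ A']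
    (Q : A × A' →ₗ[ℝ] P) {a : E → A} {a' : E' → A'} {p : E × E'}
    (ha : DifferentiableAt ℝ a p.1) (ha' : DifferentiableAt ℝ a' p.2) (u : E × E') :
    fderiv ℝ (fun z : E × E' => Q (a z.1, a' z.2)) p u
      = Q (fderiv ℝ a p.1 u.1, fderiv ℝ a' p.2 u.2) := by
  have h1 : HasFDerivAt (fun z : E × E' => a z.1)
      ((fderiv ℝ a p.1).comp (ContinuousLinearMap.fst ℝ E E')) p :=
    ha.hasFDerivAt.comp p hasFDerivAt_fst
  have h2 : HasFDerivAt (fun z : E × E' => a' z.2)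
      ((fderiv ℝ a' p.2).comp (ContinuousLinearMap.snd ℝ E E')) p :=
    ha'.hasFDerivAt.comp p hasFDerivAt_snd
  have h3 := (Q.toContinuousLinearMap.hasFDerivAt).comp p (h1.prodMk h2)
  have h4 : fderiv ℝ (fun z : E × E' => Q (a z.1, a' z.2)) p = _ := h3.fderiv
  rw [h4]
  rfl

theorem inverse_prodBilin {B : E →L[ℝ] E →L[ℝ] ℝ} {C : E' →L[ℝ] E' →L[ℝ] ℝ}
    (hB : B.IsInvertible) (hC : C.IsInvertible) (φ : E × E' →L[ℝ] ℝ) :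
    (prodBilin B C).inverse φ = (B.inverse (φ ∘L ContinuousLinearMap.inl ℝ E E'),
      C.inverse (φ ∘L ContinuousLinearMap.inr ℝ E E')) := by
  obtain ⟨e, rfl⟩ := hB
  obtain ⟨e', rfl⟩ := hC
  have hinv : (prodBilin (e : E →L[ℝ] E →L[ℝ] ℝ) (e' : E' →L[ℝ] E' →L[ℝ] ℝ)).IsInvertible := by
    refine isInvertible_of_nondegenerate fun v hv => ?_
    have h1 : e v.1 = 0 := by
      ext w; simpa using hv (w, 0)
    have h2 : e' v.2 = 0 := by
      ext w; simpa using hv (0, w)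
    exact Prod.ext (by simpa using h1) (by simpa using h2)
  obtain ⟨d, hd⟩ := hinv
  rw [← hd, ContinuousLinearMap.inverse_equiv, ContinuousLinearMap.inverse_equiv,
    ContinuousLinearMap.inverse_equiv, ContinuousLinearEquiv.coe_coe,
    ContinuousLinearEquiv.symm_apply_eq]
  have hd' : ∀ x, d x = prodBilin (e : E →L[ℝ] E →L[ℝ] ℝ) (e' : E' →L[ℝ] E' →L[ℝ] ℝ) x :=
    fun x => by rw [← hd]; rfl
  rw [hd']
  ext w <;> simp <;> exact map_zero φ

/-- `prodBilin` as a linear map. -/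
def prodBilinₗ (E E' : Type*) [NormedAddCommGroup E] [NormedSpace ℝ E] [NormedAddCommGroup E']
    [NormedSpace ℝ E'] : (E →L[ℝ] E →L[ℝ] ℝ) × (E' →L[ℝ] E' →L[ℝ] ℝ) →ₗ[ℝ]
      (E × E' →L[ℝ] E × E' →L[ℝ] ℝ) where
  toFun x := prodBilin x.1 x.2
  map_add' x y := by ext <;> simp [prodBilin]
  map_smul' c x := by ext <;> simp [prodBilin]

/-- The direct sum of two bilinear maps `E × E → E` and `E' × E' → E'`. -/
def prodBilinMapₗ (E E' : Type*) [NormedAddCommGroup E] [NormedSpace ℝ E] [NormedAddCommGroup E']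
    [NormedSpace ℝ E'] : (E →L[ℝ] E →L[ℝ] E) × (E' →L[ℝ] E' →L[ℝ] E') →ₗ[ℝ]
      (E × E' →L[ℝ] E × E' →L[ℝ] E × E') where
  toFun x :=
    (ContinuousLinearMap.precomp (E × E') (ContinuousLinearMap.fst ℝ E E')) ∘L
      (ContinuousLinearMap.compL ℝ E E (E × E') (ContinuousLinearMap.inl ℝ E E')) ∘L x.1 ∘L
        (ContinuousLinearMap.fst ℝ E E') +
    (ContinuousLinearMap.precomp (E × E') (ContinuousLinearMap.snd ℝ E E')) ∘L
      (ContinuousLinearMap.compL ℝ E' E' (E × E') (ContinuousLinearMap.inr ℝ E E')) ∘L x.2 ∘L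
        (ContinuousLinearMap.snd ℝ E E')
  map_add' x y := by ext <;> simp
  map_smul' c x := by ext <;> simp

@[simp]
theorem prodBilinMapₗ_apply (x : (E →L[ℝ] E →L[ℝ] E) × (E' →L[ℝ] E' →L[ℝ] E')) (u v : E × E') :
    prodBilinMapₗ E E' x u v = (x.1 u.1 v.1, x.2 u.2 v.2) := by
  simp [prodBilinMapₗ]

theorem christoffel_prod {g : E → E →L[ℝ] E →L[ℝ] ℝ} {g' : E' → E' →L[ℝ] E' →L[ℝ] ℝ}
    {p : E × E'} (hg : DifferentiableAt ℝ g p.1) (hg' : DifferentiableAt ℝ g' p.2)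
    (hi : (g p.1).IsInvertible) (hi' : (g' p.2).IsInvertible) :
    christoffel (fun z : E × E' => prodBilin (g z.1) (g' z.2)) p
      = prodBilinMapₗ E E' (christoffel g p.1, christoffel g' p.2) := by
  have hD := fderiv_linear_prod (prodBilinₗ E E') hg hg'
  have hD' : ∀ u, fderiv ℝ (fun z : E × E' => prodBilin (g z.1) (g' z.2)) p u
      = prodBilin (fderiv ℝ g p.1 u.1) (fderiv ℝ g' p.2 u.2) := hD
  refine ContinuousLinearMap.ext fun u => ContinuousLinearMap.ext fun v => ?_
  rw [christoffel_apply, inverse_prodBilin hi hi', prodBilinMapₗ_apply, christoffel_apply,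
    christoffel_apply]
  refine Prod.ext ?_ ?_
  · dsimp only
    congr 1
    ext w
    simp [christoffelLower_apply, hD']
  · dsimp only
    congr 1
    ext w
    simp [christoffelLower_apply, hD']

theorem ricciCoord_prod {g : E → E →L[ℝ] E →L[ℝ] ℝ} {g' : E' → E' →L[ℝ] E' →L[ℝ] ℝ}
    {p : E × E'} (hg : ∀ᶠ z in 𝓝 p.1, ContDiffAt ℝ ∞ g z ∧ (g z).IsInvertible)
    (hg' : ∀ᶠ z in 𝓝 p.2, ContDiffAt ℝ ∞ g' z ∧ (g' z).IsInvertible) (v w : E × E') :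
    ricciCoord (fun z : E × E' => prodBilin (g z.1) (g' z.2)) p v w
      = ricciCoord g p.1 v.1 w.1 + ricciCoord g' p.2 v.2 w.2 := by
  have hΓ : christoffel (fun z : E × E' => prodBilin (g z.1) (g' z.2)) =ᶠ[𝓝 p]
      fun z => prodBilinMapₗ E E' (christoffel g z.1, christoffel g' z.2) := by
    have h1 := (continuous_fst.tendsto p).eventually hg
    have h2 := (continuous_snd.tendsto p).eventually hg'
    filter_upwards [h1, h2] with z hz hz'
    exact christoffel_prod (hz.1.differentiableAt (by simp)) (hz'.1.differentiableAt (by simp))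
      hz.2 hz'.2
  have d1 := (contDiffAt_christoffel hg.self_of_nhds.1 hg.self_of_nhds.2).differentiableAt
    (by simp)
  have d2 := (contDiffAt_christoffel hg'.self_of_nhds.1 hg'.self_of_nhds.2).differentiableAt
    (by simp)
  have hD := fderiv_linear_prod (prodBilinMapₗ E E') d1 d2
  have hR : ∀ u, riemannCoord (fun z : E × E' => prodBilin (g z.1) (g' z.2)) p u v w
      = (riemannCoord g p.1 u.1 v.1 w.1, riemannCoord g' p.2 u.2 v.2 w.2) := by
    intro u
    rw [riemannCoord, hΓ.fderiv_eq, hΓ.self_of_nhds, hD, hD]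
    simp [riemannCoord]
  unfold ricciCoord
  rw [← LinearMap.trace_prodMap']
  congr 1
  ext : 1
  · ext x <;> simp [hR]
  · ext x <;> simp [hR]

end ProductCurvature

/-! ### Differential forms on finite-dimensional vector spaces -/

section FlatForms

variable {E : Type*} [NormedAddCommGroup E] [NormedSpace ℝ E] [FiniteDimensional ℝ E]
  {E' : Type*} [NormedAddCommGroup E'] [NormedSpace ℝ E'] [FiniteDimensional ℝ E']
  {Y : Type*} [NormedAddCommGroup Y] [NormedSpace ℝ Y]

theorem form_ext_basis {ι : Type*} {k : ℕ} (b : Basis ι ℝ E)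
    {φ ψ : E [⋀^Fin k]→L[ℝ] ℝ} (h : ∀ v : Fin k → ι, φ (fun a => b (v a)) = ψ (fun a => b (v a))) :
    φ = ψ := by
  have : φ.toMultilinearMap = ψ.toMultilinearMap :=
    Basis.ext_multilinear (fun _ => b) h
  ext v
  exact congrArg (fun f : MultilinearMap ℝ (fun _ : Fin k => E) ℝ => f v) this

theorem contDiffAt_form {k : ℕ} {n : ℕ∞ω} {F : Y → E [⋀^Fin k]→L[ℝ] ℝ} {p : Y}
    (h : ∀ v, ContDiffAt ℝ n (fun z => F z v) p) : ContDiffAt ℝ n F p := by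
  let ev : (E [⋀^Fin k]→L[ℝ] ℝ) →ₗ[ℝ] ((Fin k → Fin (finrank ℝ E)) → ℝ) :=
    { toFun := fun φ v => φ (fun a => finBasis ℝ E (v a))
      map_add' := fun _ _ => rfl
      map_smul' := fun _ _ => rfl }
  have hker : LinearMap.ker ev = ⊥ := by
    rw [LinearMap.ker_eq_bot]
    intro φ ψ hφψ
    exact form_ext_basis (finBasis ℝ E) (fun v => congrFun hφψ v)
  obtain ⟨g, hg⟩ := ev.exists_leftInverse_of_injective hker
  have h1 : F = fun z => g.toContinuousLinearMap (ev (F z)) := by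
    ext1 z
    exact (LinearMap.congr_fun hg (F z)).symm
  rw [h1]
  refine g.toContinuousLinearMap.contDiff.contDiffAt.comp p ?_
  exact contDiffAt_pi.2 fun v => h _

theorem ContDiffAt.form_apply {k : ℕ} {n : ℕ∞ω} {F : Y → E [⋀^Fin k]→L[ℝ] ℝ} {p : Y}
    (h : ContDiffAt ℝ n F p) (v : Fin k → E) : ContDiffAt ℝ n (fun z => F z v) p :=
  (ContinuousAlternatingMap.apply ℝ E ℝ v).contDiff.contDiffAt.comp p h

theorem ContDiffAt.form_comp {k : ℕ} {n : ℕ∞ω} {F : Y → E [⋀^Fin k]→L[ℝ] ℝ} {p : Y}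
    (h : ContDiffAt ℝ n F p) (L : E' →L[ℝ] E) :
    ContDiffAt ℝ n (fun z => (F z).compContinuousLinearMap L) p :=
  contDiffAt_form fun v => h.form_apply (fun a => L (v a))

theorem ContDiffAt.wedge {k m : ℕ} {n : ℕ∞ω} {F : Y → E [⋀^Fin k]→L[ℝ] ℝ}
    {G : Y → E [⋀^Fin m]→L[ℝ] ℝ} {p : Y} (hF : ContDiffAt ℝ n F p) (hG : ContDiffAt ℝ n G p) :
    ContDiffAt ℝ n (fun z => wedge (F z) (G z)) p := by
  refine contDiffAt_form fun v => ?_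
  simp only [wedge_apply]
  refine contDiffAt_const.mul (ContDiffAt.sum fun σ _ => contDiffAt_const.mul ?_)
  exact (hF.form_apply _).mul (hG.form_apply _)

theorem ContDiffAt.extDeriv {k : ℕ} {F : E → E [⋀^Fin k]→L[ℝ] ℝ} {p : E}
    (hF : ContDiffAt ℝ ∞ F p) : ContDiffAt ℝ ∞ (extDeriv F) p :=
  (ContinuousAlternatingMap.alternatizeUncurryFinCLM ℝ E ℝ).contDiff.contDiffAt.comp p
    (hF.fderiv_right (by simp))

theorem sum_perm_fin_three (F : Equiv.Perm (Fin 3) → ℝ) :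
    ∑ σ, F σ = F 1 + F (Equiv.swap 0 1) + F (Equiv.swap 0 2) + F (Equiv.swap 1 2)
      + F (Equiv.swap 0 1 * Equiv.swap 1 2) + F (Equiv.swap 1 2 * Equiv.swap 0 1) := by
  have h : (Finset.univ : Finset (Equiv.Perm (Fin 3))) = {1, Equiv.swap 0 1, Equiv.swap 0 2,
      Equiv.swap 1 2, Equiv.swap 0 1 * Equiv.swap 1 2, Equiv.swap 1 2 * Equiv.swap 0 1} := by
    decide
  rw [h, Finset.sum_insert (by decide), Finset.sum_insert (by decide),
    Finset.sum_insert (by decide), Finset.sum_insert (by decide), Finset.sum_insert (by decide),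
    Finset.sum_singleton]
  ring

theorem sum_sign_perm_fin_three (G : Fin 3 → Fin 3 → Fin 3 → ℝ) :
    ∑ σ : Equiv.Perm (Fin 3), ((Equiv.Perm.sign σ : ℤ) : ℝ) * G (σ 0) (σ 1) (σ 2)
      = G 0 1 2 - G 1 0 2 - G 2 1 0 - G 0 2 1 + G 1 2 0 + G 2 0 1 := by
  rw [sum_perm_fin_three]
  have s1 : Equiv.Perm.sign (Equiv.swap (0 : Fin 3) 1) = -1 := Equiv.Perm.sign_swap (by decide)
  have s2 : Equiv.Perm.sign (Equiv.swap (0 : Fin 3) 2) = -1 := Equiv.Perm.sign_swap (by decide)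
  have s3 : Equiv.Perm.sign (Equiv.swap (1 : Fin 3) 2) = -1 := Equiv.Perm.sign_swap (by decide)
  simp only [Equiv.Perm.sign_mul, s1, s2, s3, Equiv.Perm.sign_one, Equiv.Perm.mul_apply]
  rw [show (Equiv.swap (0 : Fin 3) 1) 0 = 1 from rfl, show (Equiv.swap (0 : Fin 3) 1) 1 = 0 from rfl,
    show (Equiv.swap (0 : Fin 3) 1) 2 = 2 from rfl, show (Equiv.swap (0 : Fin 3) 2) 0 = 2 from rfl,
    show (Equiv.swap (0 : Fin 3) 2) 1 = 1 from rfl, show (Equiv.swap (0 : Fin 3) 2) 2 = 0 from rfl,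
    show (Equiv.swap (1 : Fin 3) 2) 0 = 0 from rfl, show (Equiv.swap (1 : Fin 3) 2) 1 = 2 from rfl,
    show (Equiv.swap (1 : Fin 3) 2) 2 = 1 from rfl]
  simp [show (Equiv.swap (0 : Fin 3) 1) 2 = 2 from rfl]
  ring

theorem wedge_one_one_apply (a b : E [⋀^Fin 1]→L[ℝ] ℝ) (x y : E) :
    wedge a b ![x, y] = a ![x] * b ![y] - a ![y] * b ![x] := by
  have h : (Finset.univ : Finset (Equiv.Perm (Fin 2))) = {1, Equiv.swap 0 1} := by decide
  have e : ∀ t : Fin 1 → E, t = ![t 0] := fun t => by ext i; fin_cases i; rfl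
  rw [wedge_apply]
  change 1 / _ * ∑ σ : Equiv.Perm (Fin 2), _ = _
  rw [h, Finset.sum_insert (by decide), Finset.sum_singleton, Equiv.Perm.sign_swap (by decide),
    e (fun i => _), e (fun j => ![x, y] ((1 : Equiv.Perm (Fin 2)) _)),
    e (fun i => ![x, y] (Equiv.swap (0 : Fin 2) 1 (Fin.castAdd 1 i))),
    e (fun i => ![x, y] (Equiv.swap (0 : Fin 2) 1 (Fin.natAdd 1 i)))]
  simp
  ring_nf

theorem wedge_two_one_apply (A : E [⋀^Fin 2]→L[ℝ] ℝ) (b : E [⋀^Fin 1]→L[ℝ] ℝ) (x y z : E) :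
    wedge A b ![x, y, z] = A ![x, y] * b ![z] + A ![y, z] * b ![x] - A ![x, z] * b ![y] := by
  have h1 : ∀ σ : Equiv.Perm (Fin 3), (fun i : Fin 2 => ![x, y, z] (σ (Fin.castAdd 1 i)))
      = ![![x, y, z] (σ 0), ![x, y, z] (σ 1)] := fun σ => by ext i; fin_cases i <;> rfl
  have h2 : ∀ σ : Equiv.Perm (Fin 3), (fun i : Fin 1 => ![x, y, z] (σ (Fin.natAdd 2 i)))
      = ![![x, y, z] (σ 2)] := fun σ => by ext i; fin_cases i; rfl
  refine (wedge_apply A b ![x, y, z]).trans ?_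
  change 1 / _ * ∑ σ : Equiv.Perm (Fin 3), ((Equiv.Perm.sign σ : ℤ) : ℝ) *
    (A (fun i : Fin 2 => ![x, y, z] (σ (Fin.castAdd 1 i))) *
      b (fun i : Fin 1 => ![x, y, z] (σ (Fin.natAdd 2 i)))) = _
  simp only [h1, h2]
  rw [sum_sign_perm_fin_three (fun i j k => A ![![x, y, z] i, ![x, y, z] j] * b ![![x, y, z] k])]
  have e1 := form_two_swap A x y
  have e2 := form_two_swap A x z
  have e3 := form_two_swap A y z
  simp [e1, e2, e3]
  ring

theorem wedge_one_two_apply (a : E [⋀^Fin 1]→L[ℝ] ℝ) (A : E [⋀^Fin 2]→L[ℝ] ℝ) (x y z : E) :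
    wedge a A ![x, y, z] = a ![x] * A ![y, z] - a ![y] * A ![x, z] + a ![z] * A ![x, y] := by
  have h1 : ∀ σ : Equiv.Perm (Fin 3), (fun i : Fin 1 => ![x, y, z] (σ (Fin.castAdd 2 i)))
      = ![![x, y, z] (σ 0)] := fun σ => by ext i; fin_cases i; rfl
  have h2 : ∀ σ : Equiv.Perm (Fin 3), (fun i : Fin 2 => ![x, y, z] (σ (Fin.natAdd 1 i)))
      = ![![x, y, z] (σ 1), ![x, y, z] (σ 2)] := fun σ => by ext i; fin_cases i <;> rfl
  refine (wedge_apply a A ![x, y, z]).trans ?_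
  change 1 / _ * ∑ σ : Equiv.Perm (Fin 3), ((Equiv.Perm.sign σ : ℤ) : ℝ) *
    (a (fun i : Fin 1 => ![x, y, z] (σ (Fin.castAdd 2 i))) *
      A (fun i : Fin 2 => ![x, y, z] (σ (Fin.natAdd 1 i)))) = _
  simp only [h1, h2]
  rw [sum_sign_perm_fin_three (fun i j k => a ![![x, y, z] i] * A ![![x, y, z] j, ![x, y, z] k])]
  have e1 := form_two_swap A x y
  have e2 := form_two_swap A x z
  have e3 := form_two_swap A y z
  simp [e1, e2, e3]
  ring

theorem extDeriv_one_apply {a : E → E [⋀^Fin 1]→L[ℝ] ℝ} {p : E} (ha : DifferentiableAt ℝ a p)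
    (x y : E) : extDeriv a p ![x, y] = fderiv ℝ a p x ![y] - fderiv ℝ a p y ![x] := by
  have h := extDeriv_apply ha ![x, y]
  refine h.trans ?_
  have h1 : (0 : Fin 2).removeNth ![x, y] = ![y] := by ext i; fin_cases i; rfl
  have h2 : (1 : Fin 2).removeNth ![x, y] = ![x] := by ext i; fin_cases i; rfl
  rw [Fin.sum_univ_two, h1, h2, fderiv_continuousAlternatingMap_apply_const_apply ha,
    fderiv_continuousAlternatingMap_apply_const_apply ha]
  simp
  ring

theorem extDeriv_two_apply {A : E → E [⋀^Fin 2]→L[ℝ] ℝ} {p : E} (hA : DifferentiableAt ℝ A p)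
    (x y z : E) : extDeriv A p ![x, y, z]
      = fderiv ℝ A p x ![y, z] - fderiv ℝ A p y ![x, z] + fderiv ℝ A p z ![x, y] := by
  have h := extDeriv_apply hA ![x, y, z]
  refine h.trans ?_
  have h1 : (0 : Fin 3).removeNth ![x, y, z] = ![y, z] := by ext i; fin_cases i <;> rfl
  have h2 : (1 : Fin 3).removeNth ![x, y, z] = ![x, z] := by ext i; fin_cases i <;> rfl
  have h3 : (2 : Fin 3).removeNth ![x, y, z] = ![x, y] := by ext i; fin_cases i <;> rfl
  rw [Fin.sum_univ_three, h1, h2, h3, fderiv_continuousAlternatingMap_apply_const_apply hA,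
    fderiv_continuousAlternatingMap_apply_const_apply hA,
    fderiv_continuousAlternatingMap_apply_const_apply hA]
  simp
  ring

/-- The Leibniz rule for one-forms. -/
theorem extDeriv_wedge_one_one {a b : E → E [⋀^Fin 1]→L[ℝ] ℝ} {p : E}
    (ha : ContDiffAt ℝ ∞ a p) (hb : ContDiffAt ℝ ∞ b p) :
    (extDeriv (fun z => (wedge (a z) (b z) : E [⋀^Fin 2]→L[ℝ] ℝ)) p : E [⋀^Fin 3]→L[ℝ] ℝ)
      = (wedge (extDeriv a p : E [⋀^Fin 2]→L[ℝ] ℝ) (b p) : E [⋀^Fin 3]→L[ℝ] ℝ)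
        - (wedge (a p) (extDeriv b p : E [⋀^Fin 2]→L[ℝ] ℝ) : E [⋀^Fin 3]→L[ℝ] ℝ) := by
  have hda := ha.differentiableAt (by simp)
  have hdb := hb.differentiableAt (by simp)
  have hW : DifferentiableAt ℝ (fun z => (wedge (a z) (b z) : E [⋀^Fin 2]→L[ℝ] ℝ)) p :=
    (ha.wedge hb).differentiableAt (by simp)
  have hv : ∀ (c : E → E [⋀^Fin 1]→L[ℝ] ℝ) (hc : DifferentiableAt ℝ c p) (x : E),
      HasFDerivAt (fun z => c z ![x]) ((ContinuousAlternatingMap.apply ℝ E ℝ ![x]) ∘L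
        fderiv ℝ c p) p :=
    fun c hc x => (ContinuousAlternatingMap.apply ℝ E ℝ ![x]).hasFDerivAt.comp p hc.hasFDerivAt
  have key : ∀ u x y, fderiv ℝ (fun z => (wedge (a z) (b z) : E [⋀^Fin 2]→L[ℝ] ℝ)) p u ![x, y]
      = fderiv ℝ a p u ![x] * b p ![y] + a p ![x] * fderiv ℝ b p u ![y]
        - (fderiv ℝ a p u ![y] * b p ![x] + a p ![y] * fderiv ℝ b p u ![x]) := by
    intro u x y
    rw [← fderiv_continuousAlternatingMap_apply_const_apply hW]
    have h1 : (fun z => (wedge (a z) (b z) : E [⋀^Fin 2]→L[ℝ] ℝ) ![x, y])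
        = fun z => a z ![x] * b z ![y] - a z ![y] * b z ![x] := by
      ext z; exact wedge_one_one_apply _ _ _ _
    have h2 : fderiv ℝ (fun z => a z ![x] * b z ![y] - a z ![y] * b z ![x]) p = _ :=
      (((hv a hda x).mul (hv b hdb y)).sub ((hv a hda y).mul (hv b hdb x))).fderiv
    rw [h1, h2]
    simp
    ring
  ext v
  have hv3 : v = ![v 0, v 1, v 2] := by ext i; fin_cases i <;> rfl
  rw [hv3]
  generalize v 0 = x, v 1 = y, v 2 = z
  rw [extDeriv_two_apply hW, key, key, key]
  change _ = (wedge (extDeriv a p : E [⋀^Fin 2]→L[ℝ] ℝ) (b p) : E [⋀^Fin 3]→L[ℝ] ℝ) ![x, y, z]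
    - (wedge (a p) (extDeriv b p : E [⋀^Fin 2]→L[ℝ] ℝ) : E [⋀^Fin 3]→L[ℝ] ℝ) ![x, y, z]
  have h1 := wedge_two_one_apply (extDeriv a p : E [⋀^Fin 2]→L[ℝ] ℝ) (b p) x y z
  have h2 := wedge_one_two_apply (a p) (extDeriv b p : E [⋀^Fin 2]→L[ℝ] ℝ) x y z
  refine Eq.trans ?_ (congrArg₂ (fun s t : ℝ => s - t) h1 h2).symm
  simp only [extDeriv_one_apply hda, extDeriv_one_apply hdb]
  ring

theorem form_eq_zero_of_finrank_lt {k : ℕ} (h : finrank ℝ E < k) (φ : E [⋀^Fin k]→L[ℝ] ℝ) :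
    φ = 0 := by
  ext v
  have : ¬ LinearIndependent ℝ v := by
    intro hv
    have := hv.fintype_card_le_finrank
    simp at this
    omega
  exact φ.toAlternatingMap.map_linearDependent v this

theorem minSmoothness_two_le : minSmoothness ℝ 2 ≤ ∞ := by
  rw [minSmoothness_of_isRCLikeNormedField]
  exact WithTop.coe_le_coe.2 (le_top : (2 : ℕ∞) ≤ ⊤)

theorem extDeriv_comp_fst {k : ℕ} {F : E → E [⋀^Fin k]→L[ℝ] ℝ} {p : E × E'}
    (hF : DifferentiableAt ℝ F p.1) :
    extDeriv (fun z : E × E' => (F z.1).compContinuousLinearMap (ContinuousLinearMap.fst ℝ E E')) p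
      = (extDeriv F p.1).compContinuousLinearMap (ContinuousLinearMap.fst ℝ E E') := by
  have h := extDeriv_pullback (r := ∞) (f := (Prod.fst : E × E' → E)) (x := p) hF contDiffAt_fst
    minSmoothness_two_le
  simpa only [fderiv_fst] using h

theorem extDeriv_comp_snd {k : ℕ} {F : E' → E' [⋀^Fin k]→L[ℝ] ℝ} {p : E × E'}
    (hF : DifferentiableAt ℝ F p.2) :
    extDeriv (fun z : E × E' => (F z.2).compContinuousLinearMap (ContinuousLinearMap.snd ℝ E E')) p
      = (extDeriv F p.2).compContinuousLinearMap (ContinuousLinearMap.snd ℝ E E') := by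
  have h := extDeriv_pullback (r := ∞) (f := (Prod.snd : E × E' → E')) (x := p) hF contDiffAt_snd
    minSmoothness_two_le
  simpa only [fderiv_snd] using h

theorem contDiffAt_fluxForm {ν : E → E [⋀^Fin 3]→L[ℝ] ℝ} {a : E → E [⋀^Fin 1]→L[ℝ] ℝ}
    {A : E → E [⋀^Fin 2]→L[ℝ] ℝ} {ν' : E' → E' [⋀^Fin 3]→L[ℝ] ℝ}
    {b : E' → E' [⋀^Fin 1]→L[ℝ] ℝ} {A' : E' → E' [⋀^Fin 2]→L[ℝ] ℝ} {p : E × E'}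
    (hν : ContDiffAt ℝ ∞ ν p.1) (ha : ContDiffAt ℝ ∞ a p.1) (hA : ContDiffAt ℝ ∞ A p.1)
    (hν' : ContDiffAt ℝ ∞ ν' p.2) (hb : ContDiffAt ℝ ∞ b p.2) (hA' : ContDiffAt ℝ ∞ A' p.2)
    (lam l : ℝ) :
    ContDiffAt ℝ ∞ (fun z : E × E' =>
      fluxForm (ν z.1) (a z.1) (A z.1) (ν' z.2) (b z.2) (A' z.2) lam l) p := by
  have f1 : ∀ {k : ℕ} {F : E → E [⋀^Fin k]→L[ℝ] ℝ}, ContDiffAt ℝ ∞ F p.1 →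
      ContDiffAt ℝ ∞ (fun z : E × E' => (F z.1).compContinuousLinearMap
        (ContinuousLinearMap.fst ℝ E E')) p :=
    fun hF => ContDiffAt.form_comp (hF.comp p contDiffAt_fst) _
  have f2 : ∀ {k : ℕ} {F : E' → E' [⋀^Fin k]→L[ℝ] ℝ}, ContDiffAt ℝ ∞ F p.2 →
      ContDiffAt ℝ ∞ (fun z : E × E' => (F z.2).compContinuousLinearMap
        (ContinuousLinearMap.snd ℝ E E')) p :=
    fun hF => ContDiffAt.form_comp (hF.comp p contDiffAt_snd) _
  exact ((((f1 hν).const_smul lam).add (((f1 hA).wedge (f2 hb)).const_smul l)).add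
    (((f1 ha).wedge (f2 hA')).const_smul l)).add ((f2 hν').const_smul lam)

theorem extDeriv_fluxForm {ν : E → E [⋀^Fin 3]→L[ℝ] ℝ} {a : E → E [⋀^Fin 1]→L[ℝ] ℝ}
    {ν' : E' → E' [⋀^Fin 3]→L[ℝ] ℝ} {b : E' → E' [⋀^Fin 1]→L[ℝ] ℝ} {p : E × E'}
    (hE : finrank ℝ E = 3) (hE' : finrank ℝ E' = 3)
    (hν : ContDiffAt ℝ ∞ ν p.1) (ha : ∀ᶠ z in 𝓝 p.1, ContDiffAt ℝ ∞ a z)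
    (hν' : ContDiffAt ℝ ∞ ν' p.2) (hb : ∀ᶠ z in 𝓝 p.2, ContDiffAt ℝ ∞ b z) (lam l : ℝ) :
    extDeriv (fun z : E × E' =>
      fluxForm (ν z.1) (a z.1) (-extDeriv a z.1) (ν' z.2) (b z.2) (extDeriv b z.2) lam l) p
      = 0 := by
  let a₁ : E × E' → (E × E') [⋀^Fin 1]→L[ℝ] ℝ := fun z =>
    (a z.1).compContinuousLinearMap (ContinuousLinearMap.fst ℝ E E')
  let b₁ : E × E' → (E × E') [⋀^Fin 1]→L[ℝ] ℝ := fun z =>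
    (b z.2).compContinuousLinearMap (ContinuousLinearMap.snd ℝ E E')
  let ν₁ : E × E' → (E × E') [⋀^Fin 3]→L[ℝ] ℝ := fun z =>
    (ν z.1).compContinuousLinearMap (ContinuousLinearMap.fst ℝ E E')
  let ν₂ : E × E' → (E × E') [⋀^Fin 3]→L[ℝ] ℝ := fun z =>
    (ν' z.2).compContinuousLinearMap (ContinuousLinearMap.snd ℝ E E')
  let φ₀ : E × E' → (E × E') [⋀^Fin 2]→L[ℝ] ℝ := fun z => wedge (a₁ z) (b₁ z)
  have ha₁ : ∀ᶠ z in 𝓝 p, ContDiffAt ℝ ∞ a₁ z :=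
    ((continuous_fst.tendsto p).eventually ha).mono fun z hz =>
      ContDiffAt.form_comp (hz.comp z contDiffAt_fst) _
  have hb₁ : ∀ᶠ z in 𝓝 p, ContDiffAt ℝ ∞ b₁ z :=
    ((continuous_snd.tendsto p).eventually hb).mono fun z hz =>
      ContDiffAt.form_comp (hz.comp z contDiffAt_snd) _
  have hν₁ : ContDiffAt ℝ ∞ ν₁ p := ContDiffAt.form_comp (hν.comp p contDiffAt_fst) _
  have hν₂ : ContDiffAt ℝ ∞ ν₂ p := ContDiffAt.form_comp (hν'.comp p contDiffAt_snd) _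
  have hφ₀ : ContDiffAt ℝ ∞ φ₀ p := ha₁.self_of_nhds.wedge hb₁.self_of_nhds
  have hF : (fun z : E × E' =>
      fluxForm (ν z.1) (a z.1) (-extDeriv a z.1) (ν' z.2) (b z.2) (extDeriv b z.2) lam l)
      =ᶠ[𝓝 p] (lam • ν₁ + lam • ν₂) + (-l) • extDeriv φ₀ := by
    filter_upwards [ha₁, hb₁, (continuous_fst.tendsto p).eventually ha,
      (continuous_snd.tendsto p).eventually hb] with z h1 h2 h3 h4
    have e1 : extDeriv a₁ z = (extDeriv a z.1).compContinuousLinearMap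
        (ContinuousLinearMap.fst ℝ E E') := extDeriv_comp_fst (h3.differentiableAt (by simp))
    have e2 : extDeriv b₁ z = (extDeriv b z.2).compContinuousLinearMap
        (ContinuousLinearMap.snd ℝ E E') := extDeriv_comp_snd (h4.differentiableAt (by simp))
    have e3 := extDeriv_wedge_one_one h1 h2
    have e4 : (prodWedge (-extDeriv a z.1 : E [⋀^Fin 2]→L[ℝ] ℝ) (b z.2))
        = (-1 : ℝ) • prodWedge (extDeriv a z.1 : E [⋀^Fin 2]→L[ℝ] ℝ) (b z.2) := by
      have := prodWedge_smul_smul (-1) 1 (extDeriv a z.1 : E [⋀^Fin 2]→L[ℝ] ℝ) (b z.2)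
      rwa [one_smul, mul_one, neg_one_smul] at this
    have e5 : extDeriv φ₀ z = (prodWedge (extDeriv a z.1 : E [⋀^Fin 2]→L[ℝ] ℝ) (b z.2)
        : (E × E') [⋀^Fin 3]→L[ℝ] ℝ)
        - (prodWedge (a z.1) (extDeriv b z.2 : E' [⋀^Fin 2]→L[ℝ] ℝ) : (E × E') [⋀^Fin 3]→L[ℝ] ℝ) := by
      refine e3.trans ?_
      rw [e1, e2]
      rfl
    change fluxForm _ _ _ _ _ _ _ _ = (lam • ν₁ z + lam • ν₂ z) + (-l) • extDeriv φ₀ z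
    rw [e5, fluxForm]
    refine (congrArg (fun t => lam • ν₁ z + l • t + l • (prodWedge (a z.1)
      (extDeriv b z.2 : E' [⋀^Fin 2]→L[ℝ] ℝ) : (E × E') [⋀^Fin 3]→L[ℝ] ℝ) + lam • ν₂ z) e4).trans ?_
    module
  rw [hF.extDeriv_eq]
  have d1 := hν₁.differentiableAt (n := ∞) (by simp)
  have d2 := hν₂.differentiableAt (n := ∞) (by simp)
  have d3 := hφ₀.extDeriv.differentiableAt (by simp)
  rw [extDeriv_add ((d1.const_smul lam).add (d2.const_smul lam)) (d3.const_smul (-l)),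
    extDeriv_add (d1.const_smul lam) (d2.const_smul lam), extDeriv_smul, extDeriv_smul,
    extDeriv_smul, extDeriv_extDeriv_apply hφ₀ minSmoothness_two_le]
  have z1 : extDeriv ν₁ p = 0 := by
    refine (extDeriv_comp_fst (hν.differentiableAt (by simp))).trans ?_
    rw [form_eq_zero_of_finrank_lt (by rw [hE]; norm_num) (extDeriv ν p.1)]
    rfl
  have z2 : extDeriv ν₂ p = 0 := by
    refine (extDeriv_comp_snd (hν'.differentiableAt (by simp))).trans ?_
    rw [form_eq_zero_of_finrank_lt (by rw [hE']; norm_num) (extDeriv ν' p.2)]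
    rfl
  rw [z1, z2]
  simp

end FlatForms

/-! ### Naturality and smoothness of the metric volume form -/

section Naturality

variable {V W : Type*} [AddCommGroup V] [Module ℝ V] [TopologicalSpace V]
  [IsTopologicalAddGroup V] [ContinuousSMul ℝ V] [T2Space V] [FiniteDimensional ℝ V]
  [AddCommGroup W] [Module ℝ W] [TopologicalSpace W]
  [IsTopologicalAddGroup W] [ContinuousSMul ℝ W] [T2Space W] [FiniteDimensional ℝ W]

/-- The pullback of a bilinear form along a linear map. -/
def pullBilin (L : W →L[ℝ] V) (B : V →L[ℝ] V →L[ℝ] ℝ) : W →L[ℝ] W →L[ℝ] ℝ :=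
  (ContinuousLinearMap.precomp ℝ L) ∘L B ∘L L

@[simp]
theorem pullBilin_apply (L : W →L[ℝ] V) (B : V →L[ℝ] V →L[ℝ] ℝ) (x y : W) :
    pullBilin L B x y = B (L x) (L y) := rfl

theorem pullBilin_isInvertible {L : W →L[ℝ] V} (hL : L.IsInvertible) {B : V →L[ℝ] V →L[ℝ] ℝ}
    (hB : ∀ v, (∀ w, B v w = 0) → v = 0) : (pullBilin L B).IsInvertible := by
  obtain ⟨e, rfl⟩ := hL
  refine isInvertible_of_nondegenerate fun v hv => ?_
  have : e v = 0 := hB _ fun w => by simpa using hv (e.symm w)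
  simpa using this

theorem contractForms_pullBilin {L : W →L[ℝ] V} (hL : L.IsInvertible) {B : V →L[ℝ] V →L[ℝ] ℝ}
    (hB : ∀ v, (∀ w, B v w = 0) → v = 0) {k : ℕ} (ρ σ : V [⋀^Fin k]→L[ℝ] ℝ) :
    contractForms (pullBilin L B) (ρ.compContinuousLinearMap L) (σ.compContinuousLinearMap L)
      = contractForms B ρ σ := by
  have hinv := pullBilin_isInvertible hL hB
  obtain ⟨e, rfl⟩ := hL
  have hr := isDualFrame_raisedBasis (isInvertible_of_nondegenerate hB)
  have hd : IsDualFrame (pullBilin (e : W →L[ℝ] V) B)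
      ((finBasis ℝ V).map e.symm.toLinearEquiv) (fun i => e.symm (raisedBasis B i)) :=
    ⟨fun i j => by simpa using hr.apply_eq i j, hinv⟩
  rw [contractForms_eq_sum hd, contractForms]
  refine Finset.sum_congr rfl fun j _ => ?_
  congr 1
  · change ρ _ = ρ _
    congr 1; ext a : 1; simp
  · change σ _ = σ _
    congr 1; ext a : 1; simp

theorem metricVolume_pullBilin {L : W →L[ℝ] V} (hL : L.IsInvertible) {B : V →L[ℝ] V →L[ℝ] ℝ}
    (hB : ∀ v, (∀ w, B v w = 0) → v = 0) {n : ℕ} (θ : V [⋀^Fin n]→L[ℝ] ℝ) :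
    metricVolume (pullBilin L B) (θ.compContinuousLinearMap L)
      = (metricVolume B θ).compContinuousLinearMap L := by
  rw [metricVolume, contractForms_pullBilin hL hB]
  rfl

end Naturality

section SmoothVolume

variable {E : Type*} [NormedAddCommGroup E] [NormedSpace ℝ E] [FiniteDimensional ℝ E]
  {Y : Type*} [NormedAddCommGroup Y] [NormedSpace ℝ Y]

theorem form_top_eq_det {n : ℕ} (b : Basis (Fin n) ℝ E) (θ : E [⋀^Fin n]→L[ℝ] ℝ)
    (v : Fin n → E) : θ v = θ b * b.det v :=
  congrArg (fun f : E [⋀^Fin n]→ₗ[ℝ] ℝ => f v) (θ.toAlternatingMap.eq_smul_basis_det b)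

theorem contDiffAt_top_form_apply {n : ℕ} (b : Basis (Fin n) ℝ E)
    {θ : Y → E [⋀^Fin n]→L[ℝ] ℝ} {w : Y → Fin n → E} {p : Y} (hθ : ContDiffAt ℝ ∞ θ p)
    (hw : ∀ i, ContDiffAt ℝ ∞ (fun z => w z i) p) : ContDiffAt ℝ ∞ (fun z => θ z (w z)) p := by
  have h : (fun z => θ z (w z)) = fun z => θ z b * b.det (w z) :=
    funext fun z => form_top_eq_det b _ _
  rw [h]
  refine (hθ.form_apply _).mul ?_
  simp only [Basis.det_apply, Matrix.det_apply', Basis.toMatrix_apply]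
  refine ContDiffAt.sum fun σ _ => contDiffAt_const.mul (contDiffAt_prod fun i _ => ?_)
  exact ((b.coord (σ i)).toContinuousLinearMap.contDiff.contDiffAt.comp p (hw i))

theorem contDiffAt_metricVolume {n : ℕ} (b : Basis (Fin n) ℝ E)
    {g : E → E →L[ℝ] E →L[ℝ] ℝ} {θ : E → E [⋀^Fin n]→L[ℝ] ℝ} {p : E}
    (hg : ContDiffAt ℝ ∞ g p) (hθ : ContDiffAt ℝ ∞ θ p) (hi : (g p).IsInvertible)
    (h0 : contractForms (g p) (θ p) (θ p) ≠ 0) :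
    ContDiffAt ℝ ∞ (fun z => metricVolume (g z) (θ z)) p := by
  have hinv : ContDiffAt ℝ ∞ (fun z => (g z).inverse) p :=
    (ContinuousLinearMap.IsInvertible.contDiffAt_map_inverse hi).comp p hg
  have hr : ∀ i, ContDiffAt ℝ ∞ (fun z => raisedBasis (g z) i) p := fun i =>
    hinv.clm_apply contDiffAt_const
  have hc : ContDiffAt ℝ ∞ (fun z => contractForms (g z) (θ z) (θ z)) p := by
    unfold contractForms
    refine ContDiffAt.sum fun i _ => ContDiffAt.mul ?_ (hθ.form_apply _)
    exact contDiffAt_top_form_apply b hθ fun a => hr (i a)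
  have habs : ContDiffAt ℝ ∞ (fun z => |contractForms (g z) (θ z) (θ z)|) p :=
    hc.abs h0
  refine ContDiffAt.smul (ContDiffAt.sqrt (contDiffAt_const.div habs (abs_ne_zero.2 h0)) ?_) hθ
  exact div_ne_zero (by positivity) (abs_ne_zero.2 h0)

end SmoothVolume

/-! ### Pullbacks and coordinate expressions on manifolds -/

section Pullback

variable {E : Type*} [NormedAddCommGroup E] [NormedSpace ℝ E]
  {H : Type*} [TopologicalSpace H] {I : ModelWithCorners ℝ E H}
  {M : Type*} [TopologicalSpace M] [ChartedSpace H M]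
  {E' : Type*} [NormedAddCommGroup E'] [NormedSpace ℝ E']
  {H' : Type*} [TopologicalSpace H'] {I' : ModelWithCorners ℝ E' H'}
  {M' : Type*} [TopologicalSpace M'] [ChartedSpace H' M']
  {E'' : Type*} [NormedAddCommGroup E''] [NormedSpace ℝ E'']
  {H'' : Type*} [TopologicalSpace H''] {I'' : ModelWithCorners ℝ E'' H''}
  {M'' : Type*} [TopologicalSpace M''] [ChartedSpace H'' M'']

theorem pullbackForm_congr {k : ℕ} {f f' : M → M'} {x : M} (h : f =ᶠ[𝓝 x] f')
    (θ : FormField I' M' k) :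
    pullbackForm (I := I) f θ x = pullbackForm (I := I) f' θ x := by
  have h1 : ∀ (p q : M') (_ : p = q) (w : Fin k → E'),
      (θ p : E' [⋀^Fin k]→L[ℝ] ℝ) w = (θ q : E' [⋀^Fin k]→L[ℝ] ℝ) w := by
    rintro _ _ rfl w; rfl
  ext v
  have h2 : (mfderiv I I' f x : E →L[ℝ] E') = mfderiv I I' f' x := h.mfderiv_eq
  change (θ (f x) : E' [⋀^Fin k]→L[ℝ] ℝ) (fun a => (mfderiv I I' f x : E →L[ℝ] E') (v a))
    = (θ (f' x) : E' [⋀^Fin k]→L[ℝ] ℝ) (fun a => (mfderiv I I' f' x : E →L[ℝ] E') (v a))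
  rw [h2]
  exact h1 _ _ h.self_of_nhds _

theorem pullbackForm_comp {k : ℕ} {f : M → M'} {f' : M' → M''} {x : M}
    (hf : MDifferentiableAt I I' f x) (hf' : MDifferentiableAt I' I'' f' (f x))
    (θ : FormField I'' M'' k) :
    pullbackForm (I := I) (f' ∘ f) θ x
      = (pullbackForm (I := I') f' θ (f x)).compContinuousLinearMap (mfderiv I I' f x) := by
  ext v
  change (θ (f' (f x))) (fun a => mfderiv I I'' (f' ∘ f) x (v a)) = _
  rw [mfderiv_comp x hf' hf]
  rfl

theorem pullbackBilin_comp {f : M → M'} {f' : M' → M''} {x : M}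
    (hf : MDifferentiableAt I I' f x) (hf' : MDifferentiableAt I' I'' f' (f x))
    (g : BilinField I'' M'') :
    pullbackBilin (I := I) (f' ∘ f) g x
      = pullBilin (mfderiv I I' f x) (pullbackBilin (I := I') f' g (f x)) := by
  refine ContinuousLinearMap.ext fun v => ContinuousLinearMap.ext fun w => ?_
  change (g (f' (f x))) (mfderiv I I'' (f' ∘ f) x v) (mfderiv I I'' (f' ∘ f) x w) = _
  rw [mfderiv_comp x hf' hf]
  rfl

variable [I.Boundaryless] [IsManifold I ∞ M] [I'.Boundaryless] [IsManifold I' ∞ M']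

theorem mdifferentiableAt_extChartAt_symm {x : M} {z : E} (hz : z ∈ (extChartAt I x).target) :
    MDifferentiableAt 𝓘(ℝ, E) I (extChartAt I x).symm z := by
  have : IsManifold I 1 M := .of_le (n := ∞) (by simp)
  have h := mdifferentiableWithinAt_extChartAt_symm (I := I) hz
  rwa [I.range_eq_univ, mdifferentiableWithinAt_univ] at h

theorem isInvertible_coordFrame {x : M} {z : E} (hz : z ∈ (extChartAt I x).target) :
    (coordFrame (I := I) x z).IsInvertible := by
  have : IsManifold I 1 M := .of_le (n := ∞) (by simp)
  have h := isInvertible_mfderivWithin_extChartAt_symm (I := I) hz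
  rwa [I.range_eq_univ, mfderivWithin_univ] at h

theorem inChart_volumeForm [FiniteDimensional ℝ E] {n : ℕ} {g : BilinField I M}
    (θ : FormField I M n) (hg : ∀ x v, (∀ w, g x v w = 0) → v = 0) {x : M} {z : E}
    (hz : z ∈ (extChartAt I x).target) :
    (volumeForm g θ).inChart x z = metricVolume (g.inChart x z) (θ.inChart x z) :=
  (metricVolume_pullBilin (isInvertible_coordFrame hz) (hg _) _).symm

theorem isInvertible_inChart [FiniteDimensional ℝ E] {g : BilinField I M}
    (hg : ∀ x v, (∀ w, g x v w = 0) → v = 0) {x : M} {z : E}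
    (hz : z ∈ (extChartAt I x).target) : (g.inChart x z).IsInvertible :=
  pullBilin_isInvertible (isInvertible_coordFrame hz) (hg _)

theorem FormField.isSmooth_iff {k : ℕ} {θ : FormField I M k} :
    θ.IsSmooth ↔ ∀ (x : M), ∀ z ∈ (extChartAt I x).target, ContDiffAt ℝ ∞ (θ.inChart x) z :=
  forall_congr' fun x => (isOpen_extChartAt_target x).contDiffOn_iff

theorem BilinField.isSmooth_iff {g : BilinField I M} :
    g.IsSmooth ↔ ∀ (x : M), ∀ z ∈ (extChartAt I x).target, ContDiffAt ℝ ∞ (g.inChart x) z :=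
  forall_congr' fun x => (isOpen_extChartAt_target x).contDiffOn_iff

/-- The exterior derivative can be computed in any chart. -/
theorem inChart_extD {k : ℕ} {θ : FormField I M k} (hθ : θ.IsSmooth) {x : M} {z : E}
    (hz : z ∈ (extChartAt I x).target) : (extD θ).inChart x z = extDeriv (θ.inChart x) z := by
  have : IsManifold I 1 M := .of_le (n := ∞) (by simp)
  set y : M := (extChartAt I x).symm z with hy
  let τ : E → E := extChartAt I y ∘ (extChartAt I x).symm
  have hys : y ∈ (extChartAt I y).source := mem_extChartAt_source y
  have hdom : ∀ᶠ w in 𝓝 z, w ∈ (extChartAt I x).target ∧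
      (extChartAt I x).symm w ∈ (extChartAt I y).source := by
    refine ((isOpen_extChartAt_target x).eventually_mem hz).and ?_
    have hc : ContinuousAt (extChartAt I x).symm z :=
      (continuousOn_extChartAt_symm x).continuousAt ((isOpen_extChartAt_target x).mem_nhds hz)
    exact hc.eventually ((isOpen_extChartAt_source y).eventually_mem hys)
  have hτ : ContDiffAt ℝ ∞ τ z :=
    (contDiffOn_ext_coord_change (n := ∞) y x).contDiffAt (by
      filter_upwards [hdom] with w hw
      simpa [PartialEquiv.trans_source] using hw)
  have hmd : ∀ w, w ∈ (extChartAt I x).target → (extChartAt I x).symm w ∈ (extChartAt I y).source →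
      MDifferentiableAt 𝓘(ℝ, E) 𝓘(ℝ, E) τ w ∧ mfderiv 𝓘(ℝ, E) 𝓘(ℝ, E) τ w
        = (mfderiv I 𝓘(ℝ, E) (extChartAt I y) ((extChartAt I x).symm w)) ∘L
          (mfderiv 𝓘(ℝ, E) I (extChartAt I x).symm w) := by
    intro w hw hw'
    have h1 := mdifferentiableAt_extChartAt_symm (I := I) hw
    have h2 : MDifferentiableAt I 𝓘(ℝ, E) (extChartAt I y) ((extChartAt I x).symm w) :=
      mdifferentiableAt_extChartAt (by rwa [extChartAt_source] at hw')
    exact ⟨h2.comp w h1, mfderiv_comp w h2 h1⟩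
  have hloc : θ.inChart x =ᶠ[𝓝 z]
      fun w => (θ.inChart y (τ w)).compContinuousLinearMap (fderiv ℝ τ w) := by
    filter_upwards [hdom, hdom.eventually_nhds] with w hw hwn
    have hτw : τ w ∈ (extChartAt I y).target := (extChartAt I y).map_source hw.2
    have h1 : (extChartAt I x).symm =ᶠ[𝓝 w] (extChartAt I y).symm ∘ τ := by
      filter_upwards [hwn] with u hu
      exact ((extChartAt I y).left_inv hu.2).symm
    have h2 := pullbackForm_congr (I := 𝓘(ℝ, E)) h1 θ
    have h3 := pullbackForm_comp (I := 𝓘(ℝ, E)) (hmd w hw.1 hw.2).1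
      (mdifferentiableAt_extChartAt_symm (I := I) hτw) θ
    refine (h2.trans h3).trans ?_
    rw [mfderiv_eq_fderiv]
    rfl
  have hτz : τ z = extChartAt I y y := rfl
  have hd : DifferentiableAt ℝ (θ.inChart y) (τ z) :=
    (FormField.isSmooth_iff.1 hθ y _ ((extChartAt I y).map_source hys)).differentiableAt (by simp)
  rw [hloc.extDeriv_eq, extDeriv_pullback hd hτ minSmoothness_two_le, ← mfderiv_eq_fderiv,
    (hmd z hz hys).2]
  rfl

end Pullback

/-! ### Tensor fields on a product manifold -/

section ProductManifold

variable {E : Type*} [NormedAddCommGroup E] [NormedSpace ℝ E]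
  {H : Type*} [TopologicalSpace H] {I : ModelWithCorners ℝ E H}
  {M : Type*} [TopologicalSpace M] [ChartedSpace H M]
  {E' : Type*} [NormedAddCommGroup E'] [NormedSpace ℝ E']
  {H' : Type*} [TopologicalSpace H'] {I' : ModelWithCorners ℝ E' H'}
  {M' : Type*} [TopologicalSpace M'] [ChartedSpace H' M']

theorem extChartAt_prod_symm_apply (p : M × M') (z : E × E') :
    (extChartAt (I.prod I') p).symm z
      = ((extChartAt I p.1).symm z.1, (extChartAt I' p.2).symm z.2) := by
  rw [extChartAt_prod]
  rfl

theorem extChartAt_prod_apply (p q : M × M') :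
    extChartAt (I.prod I') p q = (extChartAt I p.1 q.1, extChartAt I' p.2 q.2) := by
  rw [extChartAt_prod]
  rfl

theorem mem_extChartAt_prod_target {p : M × M'} {z : E × E'} :
    z ∈ (extChartAt (I.prod I') p).target ↔
      z.1 ∈ (extChartAt I p.1).target ∧ z.2 ∈ (extChartAt I' p.2).target := by
  rw [extChartAt_prod]
  rfl

theorem prodMetric_eq (g : BilinField I M) (g' : BilinField I' M') (p : M × M') :
    prodMetric g g' p = prodBilin (V := TangentSpace I p.1) (W := TangentSpace I' p.2)
      (g p.1) (g' p.2) := by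
  unfold prodMetric pullbackBilin
  rw [mfderiv_fst, mfderiv_snd]
  rfl

theorem prodForm_eq {k m : ℕ} (ρ : FormField I M k) (σ : FormField I' M' m) (p : M × M') :
    prodForm ρ σ p = prodWedge (V := TangentSpace I p.1) (W := TangentSpace I' p.2)
      (ρ p.1) (σ p.2) := by
  unfold prodForm pullbackForm
  rw [mfderiv_fst, mfderiv_snd]
  rfl

theorem pullbackForm_fst {k : ℕ} (ρ : FormField I M k) (p : M × M') :
    pullbackForm (I := I.prod I') Prod.fst ρ p
      = (ρ p.1).compContinuousLinearMap
        (ContinuousLinearMap.fst ℝ (TangentSpace I p.1) (TangentSpace I' p.2)) := by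
  unfold pullbackForm
  rw [mfderiv_fst]
  rfl

theorem pullbackForm_snd {k : ℕ} (ρ : FormField I' M' k) (p : M × M') :
    pullbackForm (I := I.prod I') Prod.snd ρ p
      = (ρ p.2).compContinuousLinearMap
        (ContinuousLinearMap.snd ℝ (TangentSpace I p.1) (TangentSpace I' p.2)) := by
  unfold pullbackForm
  rw [mfderiv_snd]
  rfl

theorem sugraFlux_eq [FiniteDimensional ℝ E] [FiniteDimensional ℝ E']
    (χ : BilinField I M) (θN : FormField I M 3) (αN : FormField I M 1)
    (h : BilinField I' M') (θX : FormField I' M' 3) (αX : FormField I' M' 1) (lam l : ℝ)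
    (p : M × M') :
    sugraFlux χ θN αN h θX αX lam l p = metricFlux (V := TangentSpace I p.1)
      (W := TangentSpace I' p.2) (χ p.1) (θN p.1) (αN p.1) (h p.2) (θX p.2) (αX p.2) lam l := by
  unfold sugraFlux
  rw [pullbackForm_fst, pullbackForm_snd, prodForm_eq, prodForm_eq]
  rfl

variable [I.Boundaryless] [IsManifold I ∞ M] [I'.Boundaryless] [IsManifold I' ∞ M']

theorem inChart_pullbackForm_fst {k : ℕ} (ρ : FormField I M k) {p : M × M'} {z : E × E'}
    (hz : z ∈ (extChartAt (I.prod I') p).target) :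
    (pullbackForm (I := I.prod I') Prod.fst ρ).inChart p z
      = (ρ.inChart p.1 z.1).compContinuousLinearMap (ContinuousLinearMap.fst ℝ E E') := by
  have h1 := pullbackForm_comp (I := 𝓘(ℝ, E × E')) (I' := I.prod I') (f' := Prod.fst)
    (mdifferentiableAt_extChartAt_symm hz) mdifferentiableAt_fst ρ
  have h2 := pullbackForm_comp (I := 𝓘(ℝ, E × E')) (I' := 𝓘(ℝ, E)) (f := Prod.fst) (x := z)
    differentiableAt_fst.mdifferentiableAt
    (mdifferentiableAt_extChartAt_symm (mem_extChartAt_prod_target.1 hz).1) ρ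
  have h3 : Prod.fst ∘ (extChartAt (I.prod I') p).symm = (extChartAt I p.1).symm ∘ Prod.fst :=
    funext fun w => by rw [Function.comp_apply, extChartAt_prod_symm_apply]; rfl
  rw [h3] at h1
  refine (h1.symm.trans h2).trans ?_
  rw [mfderiv_eq_fderiv, fderiv_fst]
  rfl

theorem inChart_pullbackForm_snd {k : ℕ} (ρ : FormField I' M' k) {p : M × M'} {z : E × E'}
    (hz : z ∈ (extChartAt (I.prod I') p).target) :
    (pullbackForm (I := I.prod I') Prod.snd ρ).inChart p z
      = (ρ.inChart p.2 z.2).compContinuousLinearMap (ContinuousLinearMap.snd ℝ E E') := by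
  have h1 := pullbackForm_comp (I := 𝓘(ℝ, E × E')) (I' := I.prod I') (f' := Prod.snd)
    (mdifferentiableAt_extChartAt_symm hz) mdifferentiableAt_snd ρ
  have h2 := pullbackForm_comp (I := 𝓘(ℝ, E × E')) (I' := 𝓘(ℝ, E')) (f := Prod.snd) (x := z)
    differentiableAt_snd.mdifferentiableAt
    (mdifferentiableAt_extChartAt_symm (mem_extChartAt_prod_target.1 hz).2) ρ
  have h3 : Prod.snd ∘ (extChartAt (I.prod I') p).symm = (extChartAt I' p.2).symm ∘ Prod.snd :=
    funext fun w => by rw [Function.comp_apply, extChartAt_prod_symm_apply]; rfl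
  rw [h3] at h1
  refine (h1.symm.trans h2).trans ?_
  rw [mfderiv_eq_fderiv, fderiv_snd]
  rfl

theorem inChart_pullbackBilin_fst (g : BilinField I M) {p : M × M'} {z : E × E'}
    (hz : z ∈ (extChartAt (I.prod I') p).target) :
    BilinField.inChart (I := I.prod I') (pullbackBilin Prod.fst g) p z
      = pullBilin (ContinuousLinearMap.fst ℝ E E') (g.inChart p.1 z.1) := by
  have h1 := pullbackBilin_comp (I := 𝓘(ℝ, E × E')) (I' := I.prod I') (f' := Prod.fst)
    (mdifferentiableAt_extChartAt_symm hz) mdifferentiableAt_fst g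
  have h2 := pullbackBilin_comp (I := 𝓘(ℝ, E × E')) (I' := 𝓘(ℝ, E)) (f := Prod.fst) (x := z)
    differentiableAt_fst.mdifferentiableAt
    (mdifferentiableAt_extChartAt_symm (mem_extChartAt_prod_target.1 hz).1) g
  have h3 : Prod.fst ∘ (extChartAt (I.prod I') p).symm = (extChartAt I p.1).symm ∘ Prod.fst :=
    funext fun w => by rw [Function.comp_apply, extChartAt_prod_symm_apply]; rfl
  rw [h3] at h1
  refine (h1.symm.trans h2).trans ?_
  rw [mfderiv_eq_fderiv, fderiv_fst]
  rfl

theorem inChart_pullbackBilin_snd (g : BilinField I' M') {p : M × M'} {z : E × E'}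
    (hz : z ∈ (extChartAt (I.prod I') p).target) :
    BilinField.inChart (I := I.prod I') (pullbackBilin Prod.snd g) p z
      = pullBilin (ContinuousLinearMap.snd ℝ E E') (g.inChart p.2 z.2) := by
  have h1 := pullbackBilin_comp (I := 𝓘(ℝ, E × E')) (I' := I.prod I') (f' := Prod.snd)
    (mdifferentiableAt_extChartAt_symm hz) mdifferentiableAt_snd g
  have h2 := pullbackBilin_comp (I := 𝓘(ℝ, E × E')) (I' := 𝓘(ℝ, E')) (f := Prod.snd) (x := z)
    differentiableAt_snd.mdifferentiableAt
    (mdifferentiableAt_extChartAt_symm (mem_extChartAt_prod_target.1 hz).2) g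
  have h3 : Prod.snd ∘ (extChartAt (I.prod I') p).symm = (extChartAt I' p.2).symm ∘ Prod.snd :=
    funext fun w => by rw [Function.comp_apply, extChartAt_prod_symm_apply]; rfl
  rw [h3] at h1
  refine (h1.symm.trans h2).trans ?_
  rw [mfderiv_eq_fderiv, fderiv_snd]
  rfl

theorem inChart_prodMetric (g : BilinField I M) (g' : BilinField I' M') {p : M × M'}
    {z : E × E'} (hz : z ∈ (extChartAt (I.prod I') p).target) :
    (prodMetric g g').inChart p z = prodBilin (g.inChart p.1 z.1) (g'.inChart p.2 z.2) := by
  have h : (prodMetric g g').inChart p z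
      = BilinField.inChart (I := I.prod I') (pullbackBilin Prod.fst g) p z
        + BilinField.inChart (I := I.prod I') (pullbackBilin Prod.snd g') p z := rfl
  rw [h, inChart_pullbackBilin_fst g hz, inChart_pullbackBilin_snd g' hz]
  rfl

theorem inChart_prodForm {k m : ℕ} (ρ : FormField I M k) (σ : FormField I' M' m) {p : M × M'}
    {z : E × E'} (hz : z ∈ (extChartAt (I.prod I') p).target) :
    (prodForm ρ σ).inChart p z = prodWedge (ρ.inChart p.1 z.1) (σ.inChart p.2 z.2) := by
  have h : (prodForm ρ σ).inChart p z
      = wedge ((pullbackForm (I := I.prod I') Prod.fst ρ).inChart p z)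
        ((pullbackForm (I := I.prod I') Prod.snd σ).inChart p z) :=
    wedge_compContinuousLinearMap _ _ _
  rw [h, inChart_pullbackForm_fst ρ hz, inChart_pullbackForm_snd σ hz]
  rfl

theorem inChart_sugraFlux [FiniteDimensional ℝ E] [FiniteDimensional ℝ E']
    (χ : BilinField I M) (θN : FormField I M 3) (αN : FormField I M 1)
    (h : BilinField I' M') (θX : FormField I' M' 3) (αX : FormField I' M' 1) (lam l : ℝ)
    {p : M × M'} {z : E × E'} (hz : z ∈ (extChartAt (I.prod I') p).target) :
    (sugraFlux χ θN αN h θX αX lam l).inChart p z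
      = fluxForm ((volumeForm χ θN).inChart p.1 z.1) (αN.inChart p.1 z.1)
        ((hodgeStar 1 2 χ θN αN).inChart p.1 z.1) ((volumeForm h θX).inChart p.2 z.2)
        (αX.inChart p.2 z.2) ((hodgeStar 1 2 h θX αX).inChart p.2 z.2) lam l := by
  have e : (sugraFlux χ θN αN h θX αX lam l).inChart p z
      = lam • (pullbackForm (I := I.prod I') Prod.fst (volumeForm χ θN)).inChart p z
        + l • (prodForm (hodgeStar 1 2 χ θN αN) αX).inChart p z
        + l • (prodForm αN (hodgeStar 1 2 h θX αX)).inChart p z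
        + lam • (pullbackForm (I := I.prod I') Prod.snd (volumeForm h θX)).inChart p z := rfl
  rw [e, inChart_pullbackForm_fst _ hz, inChart_pullbackForm_snd _ hz, inChart_prodForm _ _ hz,
    inChart_prodForm _ _ hz]
  rfl

theorem coordVec_prod (p : M × M') (v : TangentSpace (I.prod I') p) :
    (coordVec (I := I.prod I') p v : E × E')
      = (coordVec (I := I) p.1 (v.1 : E), coordVec (I := I') p.2 (v.2 : E')) := by
  have : IsManifold I 1 M := .of_le (n := ∞) (by simp)
  have : IsManifold I' 1 M' := .of_le (n := ∞) (by simp)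
  have h0 : MDifferentiableAt (I.prod I') 𝓘(ℝ, E × E') (extChartAt (I.prod I') p) p :=
    mdifferentiableAt_extChartAt (mem_chart_source _ p)
  have h1 : MDifferentiableAt I 𝓘(ℝ, E) (extChartAt I p.1) p.1 :=
    mdifferentiableAt_extChartAt (mem_chart_source _ p.1)
  have h2 : MDifferentiableAt I' 𝓘(ℝ, E') (extChartAt I' p.2) p.2 :=
    mdifferentiableAt_extChartAt (mem_chart_source _ p.2)
  have f1 : Prod.fst ∘ extChartAt (I.prod I') p = extChartAt I p.1 ∘ Prod.fst :=
    funext fun w => by rw [Function.comp_apply, extChartAt_prod_apply]; rfl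
  have f2 : Prod.snd ∘ extChartAt (I.prod I') p = extChartAt I' p.2 ∘ Prod.snd :=
    funext fun w => by rw [Function.comp_apply, extChartAt_prod_apply]; rfl
  have a1 := mfderiv_comp (I'' := 𝓘(ℝ, E)) p (g := (Prod.fst : E × E' → E))
    differentiableAt_fst.mdifferentiableAt h0
  have a2 := mfderiv_comp (I'' := 𝓘(ℝ, E')) p (g := (Prod.snd : E × E' → E'))
    differentiableAt_snd.mdifferentiableAt h0
  have b1 := mfderiv_comp (I := I.prod I') (f := (Prod.fst : M × M' → M)) p h1
    mdifferentiableAt_fst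
  have b2 := mfderiv_comp (I := I.prod I') (f := (Prod.snd : M × M' → M')) p h2
    mdifferentiableAt_snd
  rw [f1, b1, mfderiv_eq_fderiv, fderiv_fst, mfderiv_fst] at a1
  rw [f2, b2, mfderiv_eq_fderiv, fderiv_snd, mfderiv_snd] at a2
  exact Prod.ext (DFunLike.congr_fun a1 v).symm (DFunLike.congr_fun a2 v).symm

end ProductManifold

/-! ### Contact three-manifolds -/

section ContactThreeManifold

variable {E : Type*} [NormedAddCommGroup E] [NormedSpace ℝ E] [FiniteDimensional ℝ E]
  {H : Type*} [TopologicalSpace H] {I : ModelWithCorners ℝ E H}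
  {M : Type*} [TopologicalSpace M] [ChartedSpace H M]
  {g : BilinField I M} {θ : FormField I M 3} {α : FormField I M 1} {s ε : ℝ}

/-- Every tangent space has an oriented orthonormal frame, and the sign of the determinant of the
metric is `s`. -/
def HasOrientedFrames (g : BilinField I M) (θ : FormField I M 3) (s : ℝ) : Prop :=
  ∀ x : M, ∃ (b : Basis (Fin 3) ℝ (TangentSpace I x)) (η : Fin 3 → ℝ),
    IsOrientedFrame (g x) (θ x) b η s

theorem IsLorentzianMetric.hasOrientedFrames (hg : IsLorentzianMetric g)
    (hθ : IsOrientationForm θ) : HasOrientedFrames g θ (-1) := fun x =>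
  exists_isOrientedFrame_of_lorentzian (hg.symm x) (hg.signature x) hθ.dim (hθ.ne_zero x)

theorem IsRiemannianMetric.hasOrientedFrames (hg : IsRiemannianMetric g)
    (hθ : IsOrientationForm θ) : HasOrientedFrames g θ 1 := fun x =>
  exists_isOrientedFrame_of_pos (hg.symm x) (hg.pos x) hθ.dim (hθ.ne_zero x)

theorem HasOrientedFrames.nondegenerate (hf : HasOrientedFrames g θ s) (x : M)
    (v : TangentSpace I x) (hv : ∀ w, g x v w = 0) : v = 0 := by
  obtain ⟨b, η, h⟩ := hf x
  obtain ⟨e, he⟩ := h.isDualFrame.invertible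
  apply e.injective
  rw [map_zero]
  ext w
  have : e v = g x v := DFunLike.congr_fun he v
  rw [this, hv w]
  rfl

theorem HasOrientedFrames.contractForms_ne_zero (hf : HasOrientedFrames g θ s) (x : M) :
    contractForms (g x) (θ x) (θ x) ≠ 0 := by
  obtain ⟨b, η, h⟩ := hf x
  rw [h.contractForms_top]
  refine mul_ne_zero (by positivity) (mul_ne_zero ?_ (pow_ne_zero _ h.pos.ne'))
  exact Finset.prod_ne_zero_iff.2 fun i _ h0 => by simpa [h0] using h.sq_eq i

theorem HasOrientedFrames.hodgeStar_eq (hf : HasOrientedFrames g θ s)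
    (hα : IsEpsContact g θ α ε) : hodgeStar 1 2 g θ α = fun x => s • extD α x := by
  funext x
  obtain ⟨b, η, h⟩ := hf x
  rw [← h.hodge_hodge (extD α x)]
  exact congrArg (hodge 1 2 (g x) (θ x)) (congrFun hα.eq_star_d x)

variable [I.Boundaryless] [IsManifold I ∞ M]

theorem HasOrientedFrames.inChart_hodgeStar (hf : HasOrientedFrames g θ s)
    (hα : IsEpsContact g θ α ε) {x : M} {z : E} (hz : z ∈ (extChartAt I x).target) :
    (hodgeStar 1 2 g θ α).inChart x z = s • extDeriv (α.inChart x) z := by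
  rw [hf.hodgeStar_eq hα, ← inChart_extD hα.smooth hz]
  rfl

theorem HasOrientedFrames.contDiffAt_inChart_volumeForm (hf : HasOrientedFrames g θ s)
    (hg : g.IsSmooth) (hθ : IsOrientationForm θ) {x : M} {z : E}
    (hz : z ∈ (extChartAt I x).target) :
    ContDiffAt ℝ ∞ ((volumeForm g θ).inChart x) z := by
  have he : (volumeForm g θ).inChart x =ᶠ[𝓝 z]
      fun w => metricVolume (g.inChart x w) (θ.inChart x w) := by
    filter_upwards [(isOpen_extChartAt_target x).eventually_mem hz] with w hw
    exact inChart_volumeForm θ hf.nondegenerate hw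
  refine ContDiffAt.congr_of_eventuallyEq ?_ he
  refine contDiffAt_metricVolume ((finBasis ℝ E).reindex (finCongr hθ.dim))
    (BilinField.isSmooth_iff.1 hg x z hz) (FormField.isSmooth_iff.1 hθ.smooth x z hz)
    (isInvertible_inChart hf.nondegenerate hz) ?_
  have := contractForms_pullBilin (isInvertible_coordFrame (I := I) hz) (hf.nondegenerate _)
    (θ ((extChartAt I x).symm z)) (θ ((extChartAt I x).symm z))
  exact this.trans_ne (hf.contractForms_ne_zero _)

end ContactThreeManifold

/-! ### The product of two contact three-manifolds -/

section ContactProduct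

variable {E : Type*} [NormedAddCommGroup E] [NormedSpace ℝ E] [FiniteDimensional ℝ E]
  {H : Type*} [TopologicalSpace H] {I : ModelWithCorners ℝ E H}
  {M : Type*} [TopologicalSpace M] [ChartedSpace H M]
  {E' : Type*} [NormedAddCommGroup E'] [NormedSpace ℝ E'] [FiniteDimensional ℝ E']
  {H' : Type*} [TopologicalSpace H'] {I' : ModelWithCorners ℝ E' H'}
  {M' : Type*} [TopologicalSpace M'] [ChartedSpace H' M']
  {χ : BilinField I M} {θN : FormField I M 3} {αN : FormField I M 1}
  {h : BilinField I' M'} {θX : FormField I' M' 3} {αX : FormField I' M' 1} {ε ε' : ℝ}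

theorem hodgeStar_sugraFlux (hN : HasOrientedFrames χ θN (-1)) (hX : HasOrientedFrames h θX 1)
    (lam l : ℝ) :
    hodgeStar 3 3 (prodMetric χ h) (prodForm θN θX) (sugraFlux χ θN αN h θX αX lam l)
      = sugraFlux χ θN αN h θX αX (-lam) l := by
  funext p
  obtain ⟨b, η, hb⟩ := hN p.1
  obtain ⟨f, ζ, hf⟩ := hX p.2
  unfold hodgeStar
  rw [sugraFlux_eq, sugraFlux_eq, prodMetric_eq, prodForm_eq]
  exact hodge_metricFlux hb hf _ _ lam l

theorem contractForms_sugraFlux (hN : HasOrientedFrames χ θN (-1)) (hX : HasOrientedFrames h θX 1)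
    (lam l : ℝ) (p : M × M') :
    contractForms (prodMetric χ h p) (sugraFlux χ θN αN h θX αX lam l p)
      (sugraFlux χ θN αN h θX αX lam l p) = 0 := by
  obtain ⟨b, η, hb⟩ := hN p.1
  obtain ⟨f, ζ, hf⟩ := hX p.2
  rw [sugraFlux_eq, prodMetric_eq]
  exact contractForms_metricFlux hb hf _ _ lam l

theorem compForms_sugraFlux (hN : HasOrientedFrames χ θN (-1)) (hX : HasOrientedFrames h θX 1)
    (hα : IsEpsContact χ θN αN ε) (hα' : IsEpsContact h θX αX ε') (lam l : ℝ) (p : M × M')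
    (v w : TangentSpace (I.prod I') p) :
    compForms (prodMetric χ h) (sugraFlux χ θN αN h θX αX lam l)
        (sugraFlux χ θN αN h θX αX lam l) p v w
      = -(2 * lam ^ 2) * χ p.1 v.1 w.1 + 2 * lam ^ 2 * h p.2 v.2 w.2
        - 2 * l ^ 2 * ε' * (ε * χ p.1 v.1 w.1 - 2 * (αN p.1 ![v.1] * αN p.1 ![w.1]))
        + 2 * l ^ 2 * ε * (ε' * h p.2 v.2 w.2 - 2 * (αX p.2 ![v.2] * αX p.2 ![w.2])) := by
  obtain ⟨b, η, hb⟩ := hN p.1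
  obtain ⟨f, ζ, hf⟩ := hX p.2
  unfold compForms
  rw [sugraFlux_eq, prodMetric_eq, ← hα.norm_sq p.1, ← hα'.norm_sq p.2]
  exact contractForms_interior_metricFlux hb hf _ _ lam l v w

variable [I.Boundaryless] [IsManifold I ∞ M] [I'.Boundaryless] [IsManifold I' ∞ M']

theorem ricci_prodMetric (hχ : χ.IsSmooth) (hh : h.IsSmooth)
    (hN : HasOrientedFrames χ θN (-1)) (hX : HasOrientedFrames h θX 1) (p : M × M')
    (v w : TangentSpace (I.prod I') p) :
    ricci (prodMetric χ h) p v w = ricci χ p.1 v.1 w.1 + ricci h p.2 v.2 w.2 := by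
  have hp : extChartAt (I.prod I') p p ∈ (extChartAt (I.prod I') p).target :=
    mem_extChartAt_target p
  have he : BilinField.inChart (prodMetric χ h) p =ᶠ[𝓝 (extChartAt (I.prod I') p p)]
      fun z : E × E' => prodBilin (χ.inChart p.1 z.1) (h.inChart p.2 z.2) := by
    filter_upwards [(isOpen_extChartAt_target p).eventually_mem hp] with z hz
    exact inChart_prodMetric χ h hz
  unfold ricci
  refine (he.ricciCoord_eq _ _).trans ?_
  rw [extChartAt_prod_apply, ricciCoord_prod, coordVec_prod, coordVec_prod]
  · filter_upwards [(isOpen_extChartAt_target p.1).eventually_mem (mem_extChartAt_target p.1)]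
      with z hz
    exact ⟨BilinField.isSmooth_iff.1 hχ _ z hz, isInvertible_inChart hN.nondegenerate hz⟩
  · filter_upwards [(isOpen_extChartAt_target p.2).eventually_mem (mem_extChartAt_target p.2)]
      with z hz
    exact ⟨BilinField.isSmooth_iff.1 hh _ z hz, isInvertible_inChart hX.nondegenerate hz⟩

theorem isLorentzianMetric_prodMetric (hχ : IsLorentzianMetric χ) (hh : IsRiemannianMetric h) :
    IsLorentzianMetric (prodMetric χ h) where
  smooth := by
    refine BilinField.isSmooth_iff.2 fun p z hz => ?_
    have he : BilinField.inChart (prodMetric χ h) p =ᶠ[𝓝 z]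
        fun z : E × E' => (prodBilinₗ E E').toContinuousLinearMap
          (χ.inChart p.1 z.1, h.inChart p.2 z.2) := by
      filter_upwards [(isOpen_extChartAt_target p).eventually_mem hz] with z hz
      exact inChart_prodMetric χ h hz
    refine ContDiffAt.congr_of_eventuallyEq ?_ he
    have hz' := mem_extChartAt_prod_target.1 hz
    refine ContDiffAt.comp z (ContinuousLinearMap.contDiff _).contDiffAt (ContDiffAt.prodMk ?_ ?_)
    · exact (BilinField.isSmooth_iff.1 hχ.smooth p.1 z.1 hz'.1).comp z contDiffAt_fst
    · exact (BilinField.isSmooth_iff.1 hh.smooth p.2 z.2 hz'.2).comp z contDiffAt_snd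
  symm p v w := by
    rw [prodMetric_eq]
    exact congrArg₂ (· + ·) (hχ.symm p.1 v.1 w.1) (hh.symm p.2 v.2 w.2)
  signature p := by
    rw [prodMetric_eq]
    exact prodBilin_signature (V := TangentSpace I p.1) (W := TangentSpace I' p.2)
       (hχ.signature p.1) (hh.pos p.2)

theorem isOrientationForm_prodForm {k m : ℕ} {ρ : FormField I M k} {σ : FormField I' M' m}
    (hρ : IsOrientationForm ρ) (hσ : IsOrientationForm σ) :
    IsOrientationForm (prodForm ρ σ) where
  dim := by rw [finrank_prod, hρ.dim, hσ.dim]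
  smooth := by
    refine FormField.isSmooth_iff.2 fun p z hz => ?_
    have he : (prodForm ρ σ).inChart p =ᶠ[𝓝 z]
        fun z : E × E' => prodWedge (ρ.inChart p.1 z.1) (σ.inChart p.2 z.2) := by
      filter_upwards [(isOpen_extChartAt_target p).eventually_mem hz] with z hz
      exact inChart_prodForm ρ σ hz
    refine ContDiffAt.congr_of_eventuallyEq ?_ he
    have hz' := mem_extChartAt_prod_target.1 hz
    refine ContDiffAt.wedge (ContDiffAt.form_comp ?_ _) (ContDiffAt.form_comp ?_ _)
    · exact (FormField.isSmooth_iff.1 hρ.smooth p.1 z.1 hz'.1).comp z contDiffAt_fst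
    · exact (FormField.isSmooth_iff.1 hσ.smooth p.2 z.2 hz'.2).comp z contDiffAt_snd
  ne_zero p h0 := by
    rw [prodForm_eq] at h0
    let b : Basis (Fin k) ℝ (TangentSpace I p.1) := (finBasis ℝ E).reindex (finCongr hρ.dim)
    let f : Basis (Fin m) ℝ (TangentSpace I' p.2) := (finBasis ℝ E').reindex (finCongr hσ.dim)
    have h1 := prodWedge_append (V := TangentSpace I p.1) (W := TangentSpace I' p.2)
      (ρ p.1) (σ p.2) b f
    rw [h0] at h1
    exact mul_ne_zero (basis_apply_ne_zero b (hρ.ne_zero p.1))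
      (basis_apply_ne_zero f (hσ.ne_zero p.2)) h1.symm

theorem inChart_sugraFlux_eventuallyEq (hN : HasOrientedFrames χ θN (-1))
    (hX : HasOrientedFrames h θX 1) (hα : IsEpsContact χ θN αN ε) (hα' : IsEpsContact h θX αX ε')
    (lam l : ℝ) {p : M × M'} {z : E × E'} (hz : z ∈ (extChartAt (I.prod I') p).target) :
    (sugraFlux χ θN αN h θX αX lam l).inChart p =ᶠ[𝓝 z] fun z : E × E' =>
      fluxForm ((volumeForm χ θN).inChart p.1 z.1) (αN.inChart p.1 z.1)
        (-extDeriv (αN.inChart p.1) z.1) ((volumeForm h θX).inChart p.2 z.2)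
        (αX.inChart p.2 z.2) (extDeriv (αX.inChart p.2) z.2) lam l := by
  filter_upwards [(isOpen_extChartAt_target p).eventually_mem hz] with z hz
  have hz' := mem_extChartAt_prod_target.1 hz
  rw [inChart_sugraFlux χ θN αN h θX αX lam l hz, hN.inChart_hodgeStar hα hz'.1,
    hX.inChart_hodgeStar hα' hz'.2, neg_one_smul, one_smul]

theorem isSmooth_sugraFlux (hN : HasOrientedFrames χ θN (-1))
    (hX : HasOrientedFrames h θX 1) (hα : IsEpsContact χ θN αN ε) (hα' : IsEpsContact h θX αX ε')
    (hχ : χ.IsSmooth) (hh : h.IsSmooth) (hθN : IsOrientationForm θN) (hθX : IsOrientationForm θX)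
    (lam l : ℝ) : (sugraFlux χ θN αN h θX αX lam l).IsSmooth := by
  refine FormField.isSmooth_iff.2 fun p z hz => ?_
  refine ContDiffAt.congr_of_eventuallyEq ?_
    (inChart_sugraFlux_eventuallyEq hN hX hα hα' lam l hz)
  have hz' := mem_extChartAt_prod_target.1 hz
  have h1 := FormField.isSmooth_iff.1 hα.smooth p.1 z.1 hz'.1
  have h2 := FormField.isSmooth_iff.1 hα'.smooth p.2 z.2 hz'.2
  exact contDiffAt_fluxForm (A := fun z => -extDeriv (αN.inChart p.1) z)
    (hN.contDiffAt_inChart_volumeForm hχ hθN hz'.1) h1 h1.extDeriv.neg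
    (hX.contDiffAt_inChart_volumeForm hh hθX hz'.2) h2 h2.extDeriv lam l

theorem extD_sugraFlux (hN : HasOrientedFrames χ θN (-1))
    (hX : HasOrientedFrames h θX 1) (hα : IsEpsContact χ θN αN ε) (hα' : IsEpsContact h θX αX ε')
    (hχ : χ.IsSmooth) (hh : h.IsSmooth) (hθN : IsOrientationForm θN) (hθX : IsOrientationForm θX)
    (lam l : ℝ) : extD (sugraFlux χ θN αN h θX αX lam l) = 0 := by
  funext p
  have hz := mem_extChartAt_target (I := I.prod I') p
  have hz' := mem_extChartAt_prod_target.1 hz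
  unfold extD
  have h0 := (inChart_sugraFlux_eventuallyEq hN hX hα hα' lam l hz).extDeriv_eq
  have h1 := extDeriv_fluxForm (p := extChartAt (I.prod I') p p) hθN.dim hθX.dim
    (hN.contDiffAt_inChart_volumeForm hχ hθN hz'.1)
    (by
      filter_upwards [(isOpen_extChartAt_target p.1).eventually_mem hz'.1] with z hz
      exact FormField.isSmooth_iff.1 hα.smooth p.1 z hz)
    (hX.contDiffAt_inChart_volumeForm hh hθX hz'.2)
    (by
      filter_upwards [(isOpen_extChartAt_target p.2).eventually_mem hz'.2] with z hz
      exact FormField.isSmooth_iff.1 hα'.smooth p.2 z hz) lam l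
  rw [h0.trans h1]
  rfl

end ContactProduct

end

theorem mainTheorem1
    {N : Type*} [TopologicalSpace N] [ChartedSpace (EuclideanSpace ℝ (Fin 3)) N]
    [IsManifold (𝓡 3) ∞ N]
    {X : Type*} [TopologicalSpace X] [ChartedSpace (EuclideanSpace ℝ (Fin 3)) X]
    [IsManifold (𝓡 3) ∞ X]
    (θN : FormField (𝓡 3) N 3) (χ : BilinField (𝓡 3) N) (αN : FormField (𝓡 3) N 1)
    (θX : FormField (𝓡 3) X 3) (h : BilinField (𝓡 3) X) (αX : FormField (𝓡 3) X 1)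
    (εN lam l : ℝ)
    (hN : IsLorentzianEpsEtaEinstein χ θN αN εN (lam ^ 2) (l ^ 2))
    (hX : IsRiemannianEpsEtaEinstein h θX αX (lam ^ 2) (εN * l ^ 2)) :
    IsSugraSolution (M := N × X) (prodForm θN θX) (prodMetric χ h)
      (sugraFlux χ θN αN h θX αX lam l) := by
  have hfN := hN.metric.hasOrientedFrames hN.orientation
  have hfX := hX.metric.hasOrientedFrames hX.orientation
  refine ⟨isOrientationForm_prodForm hN.orientation hX.orientation,
    isLorentzianMetric_prodMetric hN.metric hX.metric,
    isSmooth_sugraFlux hfN hfX hN.contact hX.contact hN.metric.smooth hX.metric.smooth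
      hN.orientation hX.orientation lam l, fun p v w => ?_,
    extD_sugraFlux hfN hfX hN.contact hX.contact hN.metric.smooth hX.metric.smooth
      hN.orientation hX.orientation lam l, ?_, contractForms_sugraFlux hfN hfX lam l⟩
  · rw [ricci_prodMetric hN.metric.smooth hX.metric.smooth hfN hfX,
      compForms_sugraFlux hfN hfX hN.contact hX.contact]
    have key : ∀ (v₁ w₁ : TangentSpace (𝓡 3) p.1) (v₂ w₂ : TangentSpace (𝓡 3) p.2),
        ricci χ p.1 v₁ w₁ + ricci h p.2 v₂ w₂
          - 1 / 4 * (-(2 * lam ^ 2) * χ p.1 v₁ w₁ + 2 * lam ^ 2 * h p.2 v₂ w₂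
            - 2 * l ^ 2 * 1 * (εN * χ p.1 v₁ w₁ - 2 * (αN p.1 ![v₁] * αN p.1 ![w₁]))
            + 2 * l ^ 2 * εN * (1 * h p.2 v₂ w₂ - 2 * (αX p.2 ![v₂] * αX p.2 ![w₂]))) = 0 := by
      intro v₁ w₁ v₂ w₂
      rw [hN.einstein, hX.einstein]
      ring
    exact key v.1 w.1 v.2 w.2
  · rw [hodgeStar_sugraFlux hfN hfX]
    exact extD_sugraFlux hfN hfX hN.contact hX.contact hN.metric.smooth hX.metric.smooth
      hN.orientation hX.orientation (-lam) l
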